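/- Let $A=\bigoplus_{i=-d}^{d}A^i$ be a graded Frobenius algebra of degree $d$ over $\mathbb{Q}$: a finite dimensional graded vector space with an associative, unital, graded commutative multiplication of degree $d$ (so $1\in A^{-d}$, $ab=(-1)^{|a||b|}ba$) and a linear form $\int:A\to\mathbb{Q}$ of degree $-d$ such that $\langle a,b\rangle=\int ab$ is non-degenerate. For a finite set $I$ let $A^{\otimes I}$ be the tensor power with factors indexed by $I$, with the product $(\otimes a_i)(\otimes b_i)=\pm\otimes a_ib_i$ (sign of reordering the $a$'s and $b$'s) and the integral $\int\otimes a_i=\prod\int a_i$. A surjection $\varphi:I\to J$ induces the ring homomorphism $\varphi^*:A^{\otimes I}\to A^{\otimes J}$, $\otimes_i a_i\mapsto\pm\otimes_j\prod_{\varphi(i)=j}a_i$ (sign of reordering the $a$'s), and its adjoint $\varphi_*:A^{\otimes J}\to A^{\otimes I}$, $\langle\varphi_*x,y\rangle=\langle x,\varphi^*y\rangle$. Let $e\in A$ be the image of $1$ under $A\xrightarrow{\Delta_*}A\otimes A\to A$, where the second map is the multiplication and $\Delta_*$ is its adjoint, and $e^\nu=\otimes_i e^{\nu(i)}$ for $\nu:I\to\mathbb{N}_0$.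 For a subgroup $H\subset S_n$ let $H\backslash[n]$ be the set of orbits of $H$ on $[n]=\{1,\dots,n\}$. Let $$A\{S_n\}=\bigoplus_{\pi\in S_n}A^{\otimes\langle\pi\rangle\backslash[n]}\,\pi,\qquad |a\pi|=|a|,$$ with the bilinear product $$a\pi\cdot b\rho=f_*\bigl(f_1^*(a)\,f_2^*(b)\,e^{g(\pi,\rho)}\bigr)\,\pi\rho,$$ where $f_1,f_2,f$ are the projections of $\langle\pi\rangle\backslash[n]$, $\langle\rho\rangle\backslash[n]$, $\langle\pi\rho\rangle\backslash[n]$ onto $\langle\pi,\rho\rangle\backslash[n]$ and $$g(\pi,\rho)(B)=\tfrac12\bigl(|B|+2-|\langle\pi\rangle\backslash B|-|\langle\rho\rangle\backslash B|-|\langle\pi\rho\rangle\backslash B|\bigr)$$ (a non-negative integer). The group $S_n$ acts by $\tilde\sigma(a\pi)=\sigma^*(a)\,\sigma\pi\sigma^{-1}$, where $\sigma^*$ is induced by the bijection $x\mapsto\sigma x$ from $\langle\pi\rangle\backslash[n]$ to $\langle\sigma\pi\sigma^{-1}\rangle\backslash[n]$. Let $A^{[n]}=(A\{S_n\})^{S_n}$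 be the subspace of invariants. Then for every $n\ge 0$: 1. $A\{S_n\}$ is an associative ring with unit $(1\otimes\cdots\otimes1)\,\mathrm{id}$. 2. For all $\pi,\rho\in S_n$ and homogeneous $a\in A^{\otimes\langle\pi\rangle\backslash[n]}$, $b\in A^{\otimes\langle\rho\rangle\backslash[n]}$, $$a\pi\cdot b\rho=(-1)^{|a||b|}\,\pi^*(b)\,\pi\rho\pi^{-1}\cdot a\pi=(-1)^{|a||b|}\,\tilde\pi(b\rho)\cdot a\pi .$$ 3. $A^{[n]}$ is a graded subspace of $A\{S_n\}$ (it is the sum of its homogeneous parts), it contains the unit and it is closed under the product, so that it is a subring. 4. $A^{[n]}$ is contained in the graded centre of $A\{S_n\}$: $x\cdot y=(-1)^{|x||y|}\,y\cdot x$ for all homogeneous $x\in A^{[n]}$ and $y\in A\{S_n\}$. In particular $A^{[n]}$ is graded commutative. -/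

import Mathlib

open scoped TensorProduct DirectSum

noncomputable section

/-- A graded Frobenius algebra of degree `d` over `ℚ`, centred around degree `0`: a finite
dimensional graded vector space `A = ⨁_{i=-d}^{d} A^i` with an associative, unital, graded
commutative multiplication of degree `d` and a linear form `∫ : A → ℚ` of degree `-d` such that
`⟨a, b⟩ = ∫ (a b)` is non-degenerate. -/
structure GradedFrobeniusAlgebra (d : ℕ) (A : Type*) [Ring A] [Algebra ℚ A] where
  finite : Module.Finite ℚ A
  grade : ℤ → Submodule ℚ A
  isInternal : DirectSum.IsInternal grade
  grade_eq_bot : ∀ i : ℤ, (d : ℤ) < |i| → grade i = ⊥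
  one_mem : (1 : A) ∈ grade (-(d : ℤ))
  mul_mem : ∀ (i j : ℤ) (a b : A), a ∈ grade i → b ∈ grade j → a * b ∈ grade (i + j + d)
  graded_comm : ∀ (i j : ℤ) (a b : A), a ∈ grade i → b ∈ grade j →
    a * b = (-1 : ℚ) ^ (i * j) • (b * a)
  integral : A →ₗ[ℚ] ℚ
  integral_eq_zero : ∀ (i : ℤ) (a : A), a ∈ grade i → i ≠ d → integral a = 0
  nondegenerate : ∀ a : A, (∀ b : A, integral (a * b) = 0) → a = 0

namespace GradedFrobeniusAlgebra

variable {A : Type*} [Ring A] [Algebra ℚ A] {d : ℕ} (F : GradedFrobeniusAlgebra d A)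

theorem coeLinearMap_bijective : Function.Bijective (DirectSum.coeLinearMap F.grade) :=
  F.isInternal

/-- The projection of `A` onto its part of parity `p`, i.e. onto `⨁_{i ≡ p mod 2} A^i`. -/
def parityProj (p : ZMod 2) : A →ₗ[ℚ] A :=
  DirectSum.toModule ℚ ℤ A (fun i => if (i : ZMod 2) = p then (F.grade i).subtype else 0) ∘ₗ
    (LinearEquiv.ofBijective (DirectSum.coeLinearMap F.grade) F.coeLinearMap_bijective).symm.toLinearMap

theorem parityProj_of_mem (p : ZMod 2) {i : ℤ} {a : A} (ha : a ∈ F.grade i) :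
    F.parityProj p a = if (i : ZMod 2) = p then a else 0 := by
  have h : (LinearEquiv.ofBijective (DirectSum.coeLinearMap F.grade) F.coeLinearMap_bijective).symm a
      = DirectSum.lof ℚ ℤ (fun i => F.grade i) i ⟨a, ha⟩ := by
    rw [LinearEquiv.symm_apply_eq, LinearEquiv.ofBijective_apply]
    exact (DirectSum.coeLinearMap_lof F.grade i ⟨a, ha⟩).symm
  rw [parityProj, LinearMap.comp_apply, LinearEquiv.coe_coe, h, DirectSum.toModule_lof]
  split_ifs <;> simp

theorem homogeneous_induction {P : A → Prop} (h0 : P 0) (hadd : ∀ a b, P a → P b → P (a + b))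
    (hom : ∀ i, ∀ a ∈ F.grade i, P a) (a : A) : P a := by
  have ha : a ∈ ⨆ i, F.grade i := by
    rw [F.isInternal.submodule_iSup_eq_top]
    trivial
  exact Submodule.iSup_induction (motive := P) _ ha hom h0 hadd

theorem sum_parityProj (a : A) : ∑ p, F.parityProj p a = a := by
  induction a using F.homogeneous_induction with
  | h0 => simp
  | hadd a b ha hb => simp [Finset.sum_add_distrib, ha, hb]
  | hom i a ha => simp [F.parityProj_of_mem _ ha]

theorem integral_parityProj_mul (p q : ZMod 2) (a b : A) :
    F.integral (F.parityProj p a * F.parityProj q b) =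
      if p = q then F.integral (a * F.parityProj q b) else 0 := by
  induction a using F.homogeneous_induction with
  | h0 => simp
  | hadd a a' ha ha' => simp only [map_add, add_mul, ha, ha']; split_ifs <;> simp
  | hom i a ha =>
    induction b using F.homogeneous_induction with
    | h0 => simp
    | hadd b b' hb hb' => simp only [map_add, mul_add, hb, hb']; split_ifs <;> simp
    | hom j b hb =>
      have key : (i : ZMod 2) ≠ j → F.integral (a * b) = 0 := fun hij =>
        F.integral_eq_zero _ _ (F.mul_mem i j a b ha hb) fun h => hij (by
          have h' : i = -j := by lia
          rw [h', Int.cast_neg, ZMod.neg_eq_self_mod_two])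
      rw [F.parityProj_of_mem _ ha, F.parityProj_of_mem _ hb]
      by_cases h1 : (i : ZMod 2) = p <;> by_cases h2 : (j : ZMod 2) = q <;>
        by_cases h3 : p = q <;> simp_all

/-- The underlying vector space of `A^{⊗ I}`, for a finite index set `I`. The graded ring structure
(`tensorMul`) and the maps between these spaces use a linear order on `I`, that is, they are written
through the canonical isomorphism `A^{⊗ n} ≅ A^{⊗ I}` of the increasing enumeration of `I`. The
signless ring structure that Mathlib puts on this space is not used. -/
abbrev TensorPower (_F : GradedFrobeniusAlgebra d A) (I : Type*) : Type _ := ⨂[ℚ] _i : I, A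

/-- The degree `p` part of `A^{⊗ I}`: it is spanned by the tensors `⊗ a_i` of homogeneous elements
with `∑ |a_i| = p`. -/
def tensorGrade (I : Type*) [Fintype I] (p : ℤ) : Submodule ℚ (F.TensorPower I) :=
  Submodule.span ℚ {x | ∃ (k : I → ℤ) (a : I → A),
    (∀ i, a i ∈ F.grade (k i)) ∧ ∑ i, k i = p ∧ x = PiTensorProduct.tprod ℚ a}

theorem exists_list_prod_update {I M : Type*} [DecidableEq I] [Monoid M] (a : I → M) (i : I) :
    ∀ l : List I, l.Nodup → i ∈ l →
      ∃ u v : M, ∀ x, (l.map (Function.update a i x)).prod = u * x * v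
  | [], _, h => by simp at h
  | k :: l, hl, h => by
    rw [List.nodup_cons] at hl
    by_cases hk : k = i
    · subst hk
      refine ⟨1, (l.map a).prod, fun x => ?_⟩
      have : l.map (Function.update a k x) = l.map a :=
        List.map_congr_left fun j hj => Function.update_of_ne (by rintro rfl; exact hl.1 hj) _ _
      simp [this]
    · obtain ⟨u, v, huv⟩ := exists_list_prod_update a i l hl.2
        ((List.mem_cons.1 h).resolve_left (Ne.symm hk))
      exact ⟨a k * u, v, fun x => by simp [huv, Function.update_of_ne hk, mul_assoc]⟩

theorem exists_fiber_prod_update {I J : Type*} [Fintype I] [LinearOrder I] [LinearOrder J]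
    (φ : I → J) (a : I → A) (i : I) : ∃ (c : J → A) (u v : A), ∀ x,
      (fun j => (((Finset.univ.filter fun i => φ i = j).sort (· ≤ ·)).map
        (Function.update a i x)).prod) = Function.update c (φ i) (u * x * v) := by
  obtain ⟨u, v, h⟩ := exists_list_prod_update a i
    ((Finset.univ.filter fun k => φ k = φ i).sort (· ≤ ·)) (Finset.sort_nodup _ _) (by simp)
  refine ⟨fun j => (((Finset.univ.filter fun i => φ i = j).sort (· ≤ ·)).map a).prod, u, v,
    fun x => funext fun j => ?_⟩
  by_cases hj : j = φ i
  · subst hj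
    simp [h]
  · rw [Function.update_of_ne hj]
    congr 1
    refine List.map_congr_left fun k hk => Function.update_of_ne ?_ _ _
    rintro rfl
    simp only [Finset.mem_sort, Finset.mem_filter] at hk
    exact hj hk.2.symm

section Order

variable {I J : Type*} [Fintype I] [LinearOrder I] [Fintype J] [LinearOrder J]

/-- The sign `ε(a, b)` of the reordering of `a_1, …, a_n, b_1, …, b_n` into
`a_1, b_1, …, a_n, b_n`, where `a_i` has parity `p i` and `b_i` has parity `q i`. -/
def shuffleSign (p q : I → ZMod 2) : ℚ :=
  ∏ i, ∏ j, if j < i ∧ p i = 1 ∧ q j = 1 then -1 else 1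

/-- The sign of the reordering of the `a_i`, `i ∈ I`, from the order of `I` into the order by
`φ i` (and by `i` where `φ i` is the same), where `a_i` has parity `p i`. -/
def sortSign (φ : I → J) (p : I → ZMod 2) : ℚ :=
  ∏ i, ∏ j, if i < j ∧ φ j < φ i ∧ p i = 1 ∧ p j = 1 then -1 else 1

/-- The product of `A^{⊗ I}`: the bilinear map with
`(⊗ a_i) (⊗ b_i) = ε(a, b) ⊗ (a_i b_i)` for homogeneous `a_i`, `b_i`. -/
def tensorMul : F.TensorPower I →ₗ[ℚ] F.TensorPower I →ₗ[ℚ] F.TensorPower I :=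
  ∑ p : I → ZMod 2, ∑ q : I → ZMod 2, shuffleSign p q •
    (PiTensorProduct.map₂ (fun _ : I => LinearMap.mul ℚ A)).compl₁₂
      (PiTensorProduct.map fun i => F.parityProj (p i))
      (PiTensorProduct.map fun i => F.parityProj (q i))

/-- The integral of `A^{⊗ I}`, `∫ ⊗ a_i = ∏ ∫ a_i`. -/
def tensorIntegral : F.TensorPower I →ₗ[ℚ] ℚ :=
  PiTensorProduct.lift ((MultilinearMap.mkPiAlgebra ℚ I ℚ).compLinearMap fun _ => F.integral)

/-- The bilinear form `⟨x, y⟩ = ∫ (x y)` of `A^{⊗ I}`. -/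
def pairing : F.TensorPower I →ₗ[ℚ] F.TensorPower I →ₗ[ℚ] ℚ :=
  F.tensorMul.compr₂ F.tensorIntegral

/-- The multilinear map sending `(a_i)` to `⊗_j ∏_{φ i = j} a_i`, where the products are taken in
increasing order of the indices `i`. -/
def fiberProd (φ : I → J) : MultilinearMap ℚ (fun _ : I => A) (F.TensorPower J) where
  toFun a := PiTensorProduct.tprod ℚ fun j => (((Finset.univ.filter fun i => φ i = j).sort (· ≤ ·)).map a).prod
  map_update_add' {inst} a i x y := by
    obtain rfl : inst = LinearOrder.toDecidableEq := Subsingleton.elim _ _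
    obtain ⟨c, u, v, h⟩ := exists_fiber_prod_update φ a i
    simp only [h, mul_add, add_mul]
    exact MultilinearMap.map_update_add _ _ _ _ _
  map_update_smul' {inst} a i r x := by
    obtain rfl : inst = LinearOrder.toDecidableEq := Subsingleton.elim _ _
    obtain ⟨c, u, v, h⟩ := exists_fiber_prod_update φ a i
    simp only [h, mul_smul_comm, smul_mul_assoc]
    exact MultilinearMap.map_update_smul _ _ _ _ _

/-- The map `φ^* : A^{⊗ I} → A^{⊗ J}` of a map `φ : I → J`: for homogeneous `a_i` it sends `⊗ a_i`
to `± ⊗_j ∏_{φ i = j} a_i`, with the sign of the reordering of the `a_i`. For a permutation of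
`{1, …, n}` it is the action of `S_n` on `A^{⊗ n}`. -/
def pull (φ : I → J) : F.TensorPower I →ₗ[ℚ] F.TensorPower J :=
  ∑ p : I → ZMod 2, sortSign φ p •
    PiTensorProduct.lift ((F.fiberProd φ).compLinearMap fun i => F.parityProj (p i))

theorem pairing_tensor_parity (a b : I → A) (r : I → ZMod 2) :
    F.pairing (PiTensorProduct.tprod ℚ a) (PiTensorProduct.tprod ℚ fun i => F.parityProj (r i) (b i)) =
      shuffleSign r r * ∏ i, F.integral (a i * F.parityProj (r i) (b i)) := by
  have hpp : ∀ (p q : ZMod 2) (b : A), F.parityProj p (F.parityProj q b) =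
      if p = q then F.parityProj q b else 0 := by
    intro p q b
    induction b using F.homogeneous_induction with
    | h0 => simp
    | hadd b b' hb hb' => simp only [map_add, hb, hb']; split_ifs <;> simp
    | hom j b hb =>
      by_cases h2 : (j : ZMod 2) = q <;> by_cases h3 : p = q <;>
        simp_all [F.parityProj_of_mem _ hb, eq_comm]
  have hterm : ∀ p q : I → ZMod 2,
      F.tensorIntegral ((PiTensorProduct.map₂ (fun _ : I => LinearMap.mul ℚ A)
        (PiTensorProduct.map (fun i => F.parityProj (p i)) (PiTensorProduct.tprod ℚ a)))
        (PiTensorProduct.map (fun i => F.parityProj (q i))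
          (PiTensorProduct.tprod ℚ fun i => F.parityProj (r i) (b i)))) =
      if p = r then (if q = r then ∏ i, F.integral (a i * F.parityProj (r i) (b i)) else 0)
        else 0 := by
    intro p q
    rw [PiTensorProduct.map_tprod, PiTensorProduct.map_tprod, PiTensorProduct.map₂_tprod_tprod,
      tensorIntegral, PiTensorProduct.lift.tprod]
    simp only [MultilinearMap.compLinearMap_apply, MultilinearMap.mkPiAlgebra_apply,
      LinearMap.mul_apply', hpp]
    split_ifs with h1 h2
    · subst h1 h2
      simp [F.integral_parityProj_mul]
    · obtain ⟨i, hi⟩ := Function.ne_iff.1 h2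
      exact Finset.prod_eq_zero (Finset.mem_univ i) (by simp [hi])
    · obtain ⟨i, hi⟩ := Function.ne_iff.1 h1
      refine Finset.prod_eq_zero (Finset.mem_univ i) ?_
      split_ifs
      · rw [F.integral_parityProj_mul, if_neg hi]
      · simp
  have : F.pairing (PiTensorProduct.tprod ℚ a) (PiTensorProduct.tprod ℚ fun i => F.parityProj (r i) (b i)) =
      ∑ p : I → ZMod 2, ∑ q : I → ZMod 2, shuffleSign p q *
        F.tensorIntegral ((PiTensorProduct.map₂ (fun _ : I => LinearMap.mul ℚ A)
        (PiTensorProduct.map (fun i => F.parityProj (p i)) (PiTensorProduct.tprod ℚ a)))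
        (PiTensorProduct.map (fun i => F.parityProj (q i))
          (PiTensorProduct.tprod ℚ fun i => F.parityProj (r i) (b i)))) := by
    simp only [pairing, tensorMul, LinearMap.compr₂_apply, LinearMap.sum_apply, map_sum,
      LinearMap.smul_apply, map_smul, smul_eq_mul]
    rfl
  rw [this]
  simp only [hterm, mul_ite, mul_zero]
  rw [Finset.sum_comm]
  simp

theorem shuffleSign_ne_zero (p q : I → ZMod 2) : shuffleSign p q ≠ 0 :=
  Finset.prod_ne_zero_iff.2 fun i _ => Finset.prod_ne_zero_iff.2 fun j _ => by
    split_ifs <;> norm_num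

theorem pairing_injective : Function.Injective (F.pairing (I := I)) := by
  classical
  have := F.finite
  -- the bilinear form without signs
  let U : (⨂[ℚ] _ : I, A) →ₗ[ℚ] (⨂[ℚ] _ : I, A) →ₗ[ℚ] ℚ :=
    (PiTensorProduct.map₂ (fun _ : I => LinearMap.mul ℚ A)).compr₂ F.tensorIntegral
  have hU : ∀ a b : I → A, U (PiTensorProduct.tprod ℚ a) (PiTensorProduct.tprod ℚ b) =
      ∏ i, F.integral (a i * b i) := by
    intro a b
    simp only [U, LinearMap.compr₂_apply, PiTensorProduct.map₂_tprod_tprod]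
    erw [PiTensorProduct.lift.tprod]
    simp
  refine (injective_iff_map_eq_zero _).2 fun x hx => ?_
  have hx' : ∀ b : I → A, U x (PiTensorProduct.tprod ℚ b) = 0 := by
    intro b
    have hr : ∀ r : I → ZMod 2,
        U x (PiTensorProduct.tprod ℚ fun i => F.parityProj (r i) (b i)) = 0 := by
      intro r
      have h : (F.pairing.flip (PiTensorProduct.tprod ℚ fun i => F.parityProj (r i) (b i)) :
          (⨂[ℚ] _ : I, A) →ₗ[ℚ] ℚ) = shuffleSign r r •
            U.flip (PiTensorProduct.tprod ℚ fun i => F.parityProj (r i) (b i)) := by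
        ext a
        exact (F.pairing_tensor_parity a b r).trans (by simp [hU])
      have h' := LinearMap.congr_fun h x
      have h0 : (F.pairing.flip (PiTensorProduct.tprod ℚ fun i => F.parityProj (r i) (b i)) :
          (⨂[ℚ] _ : I, A) →ₗ[ℚ] ℚ) x = 0 := LinearMap.congr_fun hx _
      rw [h0] at h'
      exact (smul_eq_zero.1 h'.symm).resolve_left (shuffleSign_ne_zero r r)
    have hb : b = fun i => ∑ p, F.parityProj p (b i) := funext fun i => (F.sum_parityProj _).symm
    rw [hb, MultilinearMap.map_sum, map_sum]
    exact Finset.sum_eq_zero fun r _ => hr r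
  -- a basis and its dual basis
  let L : A ≃ₗ[ℚ] Module.Dual ℚ A :=
    LinearMap.linearEquivOfInjective ((LinearMap.mul ℚ A).compr₂ F.integral)
      ((injective_iff_map_eq_zero _).2 fun a ha =>
        F.nondegenerate a fun b => LinearMap.congr_fun ha b) Subspace.dual_finrank_eq.symm
  let c := Module.finBasis ℚ A
  let b := c.dualBasis.map L.symm
  have hb : ∀ a j, b.repr a j = F.integral (a * c j) := by
    intro a j
    simp only [b, Module.Basis.map_repr, LinearEquiv.trans_apply, LinearEquiv.symm_symm,
      Module.Basis.dualBasis_repr]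
    rfl
  refine (Module.Basis.forall_coord_eq_zero_iff (Basis.piTensorProduct fun _ : I => b)).1
    fun q => ?_
  have : (Basis.piTensorProduct fun _ : I => b).coord q =
      U.flip (PiTensorProduct.tprod ℚ fun i => c (q i)) := by
    ext a
    simp [Basis.piTensorProduct_repr_tprod_apply, hb, hU]
  exact (LinearMap.congr_fun this x).trans (hx' _)

/-- The isomorphism of `A^{⊗ I}` with its dual given by `⟨-, -⟩`. -/
def pairingEquiv : F.TensorPower I ≃ₗ[ℚ] Module.Dual ℚ (F.TensorPower I) :=
  have := F.finite
  LinearMap.linearEquivOfInjective F.pairing F.pairing_injective Subspace.dual_finrank_eq.symm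

/-- The map `φ_* : A^{⊗ J} → A^{⊗ I}` adjoint to `φ^*`. -/
def push (φ : I → J) : F.TensorPower J →ₗ[ℚ] F.TensorPower I :=
  F.pairingEquiv.symm.toLinearMap ∘ₗ (F.pull φ).dualMap ∘ₗ F.pairing

theorem pairing_push (φ : I → J) (x : F.TensorPower J) (y : F.TensorPower I) :
    F.pairing (F.push φ x) y = F.pairing x (F.pull φ y) := by
  have h : F.pairingEquiv (F.push φ x) = (F.pull φ).dualMap (F.pairing x) := by
    simp [push]
  exact LinearMap.congr_fun h y

end Order

/-- The Euler class `e ∈ A`: the image of `1` under `A → A ⊗ A → A`, the comultiplication adjoint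
to the multiplication followed by the multiplication. -/
def eulerClass : A :=
  PiTensorProduct.subsingletonEquiv (R := ℚ) (s := fun _ : Fin 1 => A) 0
    (F.pull (fun _ : Fin 2 => (0 : Fin 1))
      (F.push (fun _ : Fin 2 => (0 : Fin 1)) (PiTensorProduct.tprod ℚ fun _ => 1)))

/-- `e^ν = ⊗_i e^{ν i} ∈ A^{⊗ I}`. -/
def eulerPow {I : Type*} (ν : I → ℕ) : F.TensorPower I :=
  PiTensorProduct.tprod ℚ fun i => F.eulerClass ^ ν i

end GradedFrobeniusAlgebra

section Orbits

variable {n : ℕ}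

/-- The orbit space `H \ [n]` of a subgroup `H` of `S_n`. -/
def OrbitSpace (H : Subgroup (Equiv.Perm (Fin n))) : Type :=
  MulAction.orbitRel.Quotient H (Fin n)

namespace OrbitSpace

/-- The orbit of `x`. -/
def mk (H : Subgroup (Equiv.Perm (Fin n))) (x : Fin n) : OrbitSpace H :=
  Quotient.mk _ x

theorem mk_eq_mk {H : Subgroup (Equiv.Perm (Fin n))} {x y : Fin n} :
    mk H x = mk H y ↔ ∃ h ∈ H, h y = x := by
  refine Quotient.eq''.trans ?_
  rw [MulAction.orbitRel_apply, MulAction.mem_orbit_iff]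
  exact ⟨fun ⟨h, hh⟩ => ⟨h, h.2, hh⟩, fun ⟨h, hH, hh⟩ => ⟨⟨h, hH⟩, hh⟩⟩

theorem mk_surjective (H : Subgroup (Equiv.Perm (Fin n))) : Function.Surjective (mk H) :=
  Quotient.mk_surjective

instance (H : Subgroup (Equiv.Perm (Fin n))) : Finite (OrbitSpace H) :=
  Finite.of_surjective _ (mk_surjective H)

instance (H : Subgroup (Equiv.Perm (Fin n))) : Fintype (OrbitSpace H) :=
  Fintype.ofFinite _

open Classical in
/-- The smallest element of an orbit. -/
def minElt {H : Subgroup (Equiv.Perm (Fin n))} (B : OrbitSpace H) : Fin n :=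
  (Finset.univ.filter fun x => mk H x = B).min'
    ((mk_surjective H B).imp fun x hx => by simpa using hx)

theorem mk_minElt {H : Subgroup (Equiv.Perm (Fin n))} (B : OrbitSpace H) :
    mk H B.minElt = B := by
  classical
  have := Finset.min'_mem (Finset.univ.filter fun x => mk H x = B)
    ((mk_surjective H B).imp fun x hx => by simpa using hx)
  exact (Finset.mem_filter.1 this).2

/-- Orbits are ordered by their smallest elements. -/
instance (H : Subgroup (Equiv.Perm (Fin n))) : LinearOrder (OrbitSpace H) :=
  LinearOrder.lift' minElt (Function.LeftInverse.injective mk_minElt)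

/-- The surjection `H \ [n] → K \ [n]` for `H ≤ K`. -/
def proj {H K : Subgroup (Equiv.Perm (Fin n))} (h : H ≤ K) : OrbitSpace H → OrbitSpace K :=
  Quotient.lift (mk K) fun x y hxy => by
    obtain ⟨g, hg, e⟩ := mk_eq_mk.1 (Quotient.sound hxy : mk H x = mk H y)
    exact mk_eq_mk.2 ⟨g, h hg, e⟩

/-- The orbit space `⟨π⟩ \ [n]`. -/
abbrev cyc (π : Equiv.Perm (Fin n)) : Type := OrbitSpace (Subgroup.zpowers π)

/-- The orbit space `⟨π, ρ⟩ \ [n]`. -/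
abbrev gen (π ρ : Equiv.Perm (Fin n)) : Type := OrbitSpace (Subgroup.closure {π, ρ})

theorem le_left (π ρ : Equiv.Perm (Fin n)) : Subgroup.zpowers π ≤ Subgroup.closure {π, ρ} :=
  Subgroup.zpowers_le.2 (Subgroup.subset_closure (by simp))

theorem le_right (π ρ : Equiv.Perm (Fin n)) : Subgroup.zpowers ρ ≤ Subgroup.closure {π, ρ} :=
  Subgroup.zpowers_le.2 (Subgroup.subset_closure (by simp))

theorem le_mul (π ρ : Equiv.Perm (Fin n)) :
    Subgroup.zpowers (π * ρ) ≤ Subgroup.closure {π, ρ} :=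
  Subgroup.zpowers_le.2 (mul_mem (Subgroup.subset_closure (by simp))
    (Subgroup.subset_closure (by simp)))

/-- The bijection `⟨π⟩ \ [n] → ⟨σ π σ⁻¹⟩ \ [n]`, `x ↦ σ x`. -/
def conj (σ π : Equiv.Perm (Fin n)) : cyc π → cyc (σ * π * σ⁻¹) :=
  Quotient.lift (fun x => mk _ (σ x)) fun x y hxy => by
    obtain ⟨g, hg, e⟩ := mk_eq_mk.1 (Quotient.sound hxy : mk (Subgroup.zpowers π) x = mk _ y)
    obtain ⟨k, rfl⟩ := Subgroup.mem_zpowers_iff.1 hg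
    exact mk_eq_mk.2 ⟨(σ * π * σ⁻¹) ^ k, Subgroup.zpow_mem_zpowers _ _, by
      simp [conj_zpow, e]⟩

/-- The graph defect `g(π, ρ)(B) = (|B| + 2 - |⟨π⟩ \ B| - |⟨ρ⟩ \ B| - |⟨πρ⟩ \ B|) / 2` of an
orbit `B` of `⟨π, ρ⟩`. -/
def graphDefect (π ρ : Equiv.Perm (Fin n)) (B : gen π ρ) : ℚ :=
  ((Nat.card {x : Fin n // mk _ x = B} : ℚ) + 2
    - Nat.card {C : cyc π // proj (le_left π ρ) C = B}
    - Nat.card {C : cyc ρ // proj (le_right π ρ) C = B}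
    - Nat.card {C : cyc (π * ρ) // proj (le_mul π ρ) C = B}) / 2

end OrbitSpace

end Orbits

namespace GradedFrobeniusAlgebra

variable {A : Type*} [Ring A] [Algebra ℚ A] {d : ℕ} (F : GradedFrobeniusAlgebra d A)

/-- The graded vector space `A{S_n} = ⨁_π A^{⊗ ⟨π⟩ \ [n]} π`. -/
def SymAlg (n : ℕ) : Type _ :=
  ⨁ π : Equiv.Perm (Fin n), F.TensorPower (OrbitSpace.cyc π)

instance (n : ℕ) : AddCommGroup (F.SymAlg n) :=
  inferInstanceAs (AddCommGroup (⨁ π : Equiv.Perm (Fin n), F.TensorPower (OrbitSpace.cyc π)))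

instance (n : ℕ) : Module ℚ (F.SymAlg n) :=
  inferInstanceAs (Module ℚ (⨁ π : Equiv.Perm (Fin n), F.TensorPower (OrbitSpace.cyc π)))

variable {n : ℕ}

/-- The element `a π` of `A{S_n}`, for `a ∈ A^{⊗ ⟨π⟩ \ [n]}`. -/
def term (π : Equiv.Perm (Fin n)) : F.TensorPower (OrbitSpace.cyc π) →ₗ[ℚ] F.SymAlg n :=
  DirectSum.lof ℚ (Equiv.Perm (Fin n)) (fun π => F.TensorPower (OrbitSpace.cyc π)) π

/-- The coefficient in `A^{⊗ ⟨π⟩ \ [n]}` of an element of `A{S_n}`. -/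
def coeff (π : Equiv.Perm (Fin n)) : F.SymAlg n →ₗ[ℚ] F.TensorPower (OrbitSpace.cyc π) :=
  DirectSum.component ℚ (Equiv.Perm (Fin n)) (fun π => F.TensorPower (OrbitSpace.cyc π)) π

/-- The degree `p` part of `A{S_n}`, where `|a π| = |a|`. -/
def symGrade (n : ℕ) (p : ℤ) : Submodule ℚ (F.SymAlg n) :=
  ⨅ π : Equiv.Perm (Fin n), (F.tensorGrade (OrbitSpace.cyc π) p).comap (F.coeff π)

/-- The map `σ^* : A^{⊗ ⟨π⟩ \ [n]} → A^{⊗ ⟨σ π σ⁻¹⟩ \ [n]}`. -/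
def conjMap (σ π : Equiv.Perm (Fin n)) :
    F.TensorPower (OrbitSpace.cyc π) →ₗ[ℚ] F.TensorPower (OrbitSpace.cyc (σ * π * σ⁻¹)) :=
  F.pull (OrbitSpace.conj σ π)

/-- The action `a π ↦ σ^*(a) σ π σ⁻¹` of `σ ∈ S_n` on `A{S_n}`. -/
def act (σ : Equiv.Perm (Fin n)) : F.SymAlg n →ₗ[ℚ] F.SymAlg n :=
  DirectSum.toModule ℚ (Equiv.Perm (Fin n)) (F.SymAlg n) fun π =>
    F.term (σ * π * σ⁻¹) ∘ₗ F.conjMap σ π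

/-- The subspace `A^{[n]} = (A{S_n})^{S_n}` of invariants. -/
def invariants (n : ℕ) : Submodule ℚ (F.SymAlg n) :=
  ⨅ σ : Equiv.Perm (Fin n), LinearMap.eqLocus (F.act σ) LinearMap.id

/-- The bilinear map `m_{π,ρ}(a ⊗ b) = f_{⟨π,ρ⟩,πρ} (f^{π,⟨π,ρ⟩}(a) f^{ρ,⟨π,ρ⟩}(b) e^{g(π,ρ)})`. The
graph defect takes values in the non-negative integers, so the floor only changes its type. -/
def termMul (π ρ : Equiv.Perm (Fin n)) :
    F.TensorPower (OrbitSpace.cyc π) →ₗ[ℚ] F.TensorPower (OrbitSpace.cyc ρ) →ₗ[ℚ]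
      F.TensorPower (OrbitSpace.cyc (π * ρ)) :=
  (F.tensorMul.compl₁₂ (F.pull (OrbitSpace.proj (OrbitSpace.le_left π ρ)))
    (F.pull (OrbitSpace.proj (OrbitSpace.le_right π ρ)))).compr₂
      (F.push (OrbitSpace.proj (OrbitSpace.le_mul π ρ)) ∘ₗ
        F.tensorMul.flip (F.eulerPow fun B => ⌊OrbitSpace.graphDefect π ρ B⌋₊))

/-- The product of `A{S_n}`: the bilinear map with `a π · b ρ = m_{π,ρ}(a ⊗ b) πρ`. -/
def symMul (n : ℕ) : F.SymAlg n →ₗ[ℚ] F.SymAlg n →ₗ[ℚ] F.SymAlg n :=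
  DirectSum.toModule ℚ (Equiv.Perm (Fin n)) (F.SymAlg n →ₗ[ℚ] F.SymAlg n) fun π =>
    (DirectSum.toModule ℚ (Equiv.Perm (Fin n))
      (F.TensorPower (OrbitSpace.cyc π) →ₗ[ℚ] F.SymAlg n) fun ρ =>
        ((F.termMul π ρ).compr₂ (F.term (π * ρ))).flip).flip

instance : Mul (F.SymAlg n) := ⟨fun x y => F.symMul n x y⟩

/-- The unit `(1 ⊗ … ⊗ 1) id` of `A{S_n}`. -/
instance : One (F.SymAlg n) := ⟨F.term 1 (PiTensorProduct.tprod ℚ fun _ => 1)⟩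

end GradedFrobeniusAlgebra

end

/-!
The signs are handled once and for all in the powers `A^{⊗ I}`. With its graded product `A^{⊗ I}` is
a supercommutative algebra generated by its factors (`inj_induction`); `φ^*` is the algebra
homomorphism that sends the factor `i` to the factor `φ i` (`pullHom`), hence functorial, and its
adjoint `φ_*` satisfies the projection formula (`pushLinear_mul`, `mul_pushLinear`). Only parities
matter for all this, and the product has even degree: an algebra with odd `d` is zero, since then
`1 * 1 = -(1 * 1)` (`even_or_subsingleton`).

Associativity rests on a base change formula (`base_change`): for a pushout square of finite sets,
with `α : I → J` surjective, `β^*(α_* x) = β'_*(α'^*(x) e^κ)` for some exponents `κ`. The element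
`α_*(1)` is the product of the classes of the diagonals along a forest whose components are the
fibres of `α`. The homomorphism `β^*` turns it into the product of the classes of the diagonals
along a graph with components the fibres of `β'`, and such a product is `β'_*(e^ν)` with `ν` the
first Betti number of the components (`list_prod_diagClass`): contracting an edge that is not a loop
is a push forward, and a loop contributes a factor `e`. Therefore both bracketings of a triple
product are push forwards from the set of orbits of `⟨π, ρ, σ⟩` of the same element. Its exponent of
the Euler class is determined by the numbers of points and of cycles in each orbit, and in this form
it does not see the bracketing (`IsTripleProduct`).

That the graph defect is a non-negative integer is a statement about a transitive pair of
permutations (`exists_genus`): parity follows from the signs of `π`, `ρ` and `πρ`, non-negativity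
from a dimension count for the maps `f ↦ f ∘ π - f` (`two_mul_card_le_finrank_permDiff`).

The product `aπ · bρ` can be computed with any set `L` identified with the orbits of `⟨π, ρ⟩`
(`Model`, `superTerm_mul_superTerm`). As `⟨πρπ⁻¹, π⟩ = ⟨π, ρ⟩`, the products `aπ · bρ` and
`π^*(b) πρπ⁻¹ · aπ` are computed with the same data, up to exchanging two factors in the
supercommutative algebra `A^{⊗ L}`, which gives the commutation relation.
Similarly the orbits of `⟨π, ρ⟩` serve for `⟨σπσ⁻¹, σρσ⁻¹⟩`, so `S_n` acts by automorphisms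
(`act_mul`) and the invariants are a subring. The sum over the group has values in the invariants
and preserves degrees, so they form a graded subspace (`invariants_eq_iSup`), and for an invariant
`x` the commutation relation reads `aπ · x = ± x · aπ`.
-/

noncomputable section

namespace GradedFrobeniusAlgebra

/-! ### Parities -/

/-- The sign character `p ↦ (-1)^p` of `ℤ/2`. -/
def sgn (p : ZMod 2) : ℚ := if p = 1 then -1 else 1

theorem sgn_zero : sgn 0 = 1 := by simp [sgn]

theorem zmod_two_cases (p : ZMod 2) : p = 0 ∨ p = 1 := by
  revert p; decide

theorem sgn_add (p q : ZMod 2) : sgn (p + q) = sgn p * sgn q := by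
  have h : (1 + 1 : ZMod 2) = 0 := by decide
  rcases zmod_two_cases p with rfl | rfl <;> rcases zmod_two_cases q with rfl | rfl <;>
    simp [sgn, h]

theorem sgn_mul_self (p : ZMod 2) : sgn p * sgn p = 1 := by
  unfold sgn; split_ifs <;> norm_num

theorem sgn_ne_zero (p : ZMod 2) : sgn p ≠ 0 := by
  unfold sgn; split_ifs <;> norm_num

theorem sgn_sum {ι : Type*} (s : Finset ι) (f : ι → ZMod 2) :
    sgn (∑ i ∈ s, f i) = ∏ i ∈ s, sgn (f i) := by
  classical
  induction s using Finset.induction_on with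
  | empty => simp [sgn_zero]
  | insert i s hi ih => rw [Finset.sum_insert hi, Finset.prod_insert hi, sgn_add, ih]

theorem sgn_intCast (k : ℤ) : sgn (k : ZMod 2) = (-1 : ℚ) ^ k := by
  rcases Int.even_or_odd k with h | h
  · rw [h.neg_one_zpow, (ZMod.intCast_eq_zero_iff_even).2 h, sgn_zero]
  · rw [h.neg_one_zpow, (ZMod.intCast_eq_one_iff_odd).2 h, sgn, if_pos rfl]

variable {A : Type*} [Ring A] [Algebra ℚ A] {d : ℕ} (F : GradedFrobeniusAlgebra d A)

/-- The part `⨁_{i ≡ p mod 2} A^i` of `A` of parity `p`. -/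
def parityPart (p : ZMod 2) : Submodule ℚ A :=
  LinearMap.eqLocus (F.parityProj p) LinearMap.id

variable {F}

theorem mem_parityPart {p : ZMod 2} {a : A} : a ∈ F.parityPart p ↔ F.parityProj p a = a :=
  Iff.rfl

theorem mem_parityPart_of_mem_grade {i : ℤ} {a : A} (ha : a ∈ F.grade i) :
    a ∈ F.parityPart i := by
  rw [mem_parityPart, F.parityProj_of_mem _ ha, if_pos rfl]

theorem parityProj_parityProj (p q : ZMod 2) (a : A) :
    F.parityProj p (F.parityProj q a) = if p = q then F.parityProj q a else 0 := by
  induction a using F.homogeneous_induction with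
  | h0 => simp
  | hadd b b' hb hb' => simp only [map_add, hb, hb']; split_ifs <;> simp
  | hom j b hb =>
    by_cases h2 : (j : ZMod 2) = q <;> by_cases h3 : p = q <;>
      simp_all [F.parityProj_of_mem _ hb, eq_comm]

theorem parityProj_mem (p : ZMod 2) (a : A) : F.parityProj p a ∈ F.parityPart p := by
  rw [mem_parityPart, parityProj_parityProj, if_pos rfl]

theorem parityProj_of_mem_parityPart {p : ZMod 2} (q : ZMod 2) {a : A} (ha : a ∈ F.parityPart p) :
    F.parityProj q a = if q = p then a else 0 := by
  rw [mem_parityPart] at ha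
  rw [← ha, parityProj_parityProj]

theorem parityPart_induction {p : ZMod 2} {P : A → Prop} (h0 : P 0)
    (hadd : ∀ a b, P a → P b → P (a + b))
    (hom : ∀ i : ℤ, (i : ZMod 2) = p → ∀ a ∈ F.grade i, P a) {a : A} (ha : a ∈ F.parityPart p) :
    P a := by
  have key : ∀ a : A, P (F.parityProj p a) := fun a => by
    induction a using F.homogeneous_induction with
    | h0 => simpa using h0
    | hadd a b ha hb => rw [map_add]; exact hadd _ _ ha hb
    | hom i a ha =>
      rw [F.parityProj_of_mem _ ha]
      split_ifs with h
      · exact hom i h a ha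
      · exact h0
  rw [← mem_parityPart.1 ha]
  exact key a

/-- Comparing `1 * 1` with its graded commutation shows that an algebra of odd degree vanishes. -/
theorem even_or_subsingleton (F : GradedFrobeniusAlgebra d A) : Even d ∨ Subsingleton A := by
  rcases Nat.even_or_odd d with h | h
  · exact Or.inl h
  · right
    have h1 := F.graded_comm _ _ 1 1 F.one_mem F.one_mem
    have hodd : Odd (-(d : ℤ) * -(d : ℤ)) := by
      have : Odd (d : ℤ) := by exact_mod_cast h
      simpa using this.mul this
    rw [hodd.neg_one_zpow, mul_one, neg_one_smul] at h1
    have h2 : (2 : ℚ) • (1 : A) = 0 := by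
      rw [two_smul]; nth_rewrite 1 [h1]; simp
    have h3 : (1 : A) = 0 := (smul_eq_zero.1 h2).resolve_left (by norm_num)
    exact subsingleton_of_zero_eq_one h3.symm

theorem natCast_degree_eq_zero (h : Even d) : ((d : ℤ) : ZMod 2) = 0 :=
  (ZMod.intCast_eq_zero_iff_even).2 (by exact_mod_cast h)

theorem one_mem_parityPart : (1 : A) ∈ F.parityPart 0 := by
  rcases F.even_or_subsingleton with h | h
  · have := mem_parityPart_of_mem_grade F.one_mem
    rwa [Int.cast_neg, natCast_degree_eq_zero h, neg_zero] at this
  · rw [Subsingleton.elim (1 : A) 0]; exact zero_mem _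

theorem mul_mem_parityPart {p q : ZMod 2} {a b : A} (ha : a ∈ F.parityPart p)
    (hb : b ∈ F.parityPart q) : a * b ∈ F.parityPart (p + q) := by
  rcases F.even_or_subsingleton with h | h
  · refine parityPart_induction (P := fun a => a * b ∈ F.parityPart (p + q)) (by simp)
      (fun a a' h h' => by rw [add_mul]; exact add_mem h h') (fun i hi a ha => ?_) ha
    refine parityPart_induction (P := fun b => a * b ∈ F.parityPart (p + q)) (by simp)
      (fun a a' h h' => by rw [mul_add]; exact add_mem h h') (fun j hj b hb => ?_) hb
    have := mem_parityPart_of_mem_grade (F.mul_mem i j a b ha hb)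
    rwa [Int.cast_add, Int.cast_add, natCast_degree_eq_zero h, add_zero, hi, hj] at this
  · rw [Subsingleton.elim (a * b) 0]; exact zero_mem _

theorem mul_comm_of_mem_parityPart {p q : ZMod 2} {a b : A} (ha : a ∈ F.parityPart p)
    (hb : b ∈ F.parityPart q) : a * b = sgn (p * q) • (b * a) := by
  refine parityPart_induction (P := fun a => a * b = sgn (p * q) • (b * a)) (by simp)
    (fun a a' h h' => by rw [add_mul, h, h', mul_add, smul_add]) (fun i hi a ha => ?_) ha
  refine parityPart_induction (P := fun b => a * b = sgn (p * q) • (b * a)) (by simp)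
    (fun a a' h h' => by rw [mul_add, h, h', add_mul, smul_add]) (fun j hj b hb => ?_) hb
  rw [F.graded_comm i j a b ha hb, ← sgn_intCast, Int.cast_mul, hi, hj]

theorem integral_of_mem_parityPart_one {a : A} (ha : a ∈ F.parityPart 1) : F.integral a = 0 := by
  rcases F.even_or_subsingleton with h | h
  · refine parityPart_induction (P := fun a => F.integral a = 0) (by simp)
      (fun a a' h h' => by rw [map_add, h, h', add_zero]) (fun i hi a ha => ?_) ha
    refine F.integral_eq_zero i a ha ?_
    rintro rfl
    rw [natCast_degree_eq_zero h] at hi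
    exact absurd hi (by decide)
  · rw [Subsingleton.elim a 0, map_zero]

theorem list_prod_mem_parityPart {ι : Type*} {a : ι → A} {p : ι → ZMod 2}
    (ha : ∀ i, a i ∈ F.parityPart (p i)) (l : List ι) :
    (l.map a).prod ∈ F.parityPart (l.map p).sum := by
  induction l with
  | nil => simpa using one_mem_parityPart
  | cons i l ih => simpa using mul_mem_parityPart (ha i) ih

/-! ### The supercommutative algebra `A^{⊗ I}` -/

variable (F) in
/-- The vector space `A^{⊗ I}`, as a type of its own that carries the product `tensorMul` with its
signs. -/
def SuperPower (I : Type*) : Type _ := F.TensorPower I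

instance (I : Type*) : AddCommGroup (F.SuperPower I) :=
  inferInstanceAs (AddCommGroup (F.TensorPower I))

instance (I : Type*) : Module ℚ (F.SuperPower I) :=
  inferInstanceAs (Module ℚ (F.TensorPower I))

variable (F) in
/-- The tensor `⊗ a_i`, as a multilinear map. -/
def pureTensor (I : Type*) : MultilinearMap ℚ (fun _ : I => A) (F.SuperPower I) :=
  PiTensorProduct.tprod ℚ

/-- The tensors `⊗ a_i` of elements of pure parity span `A^{⊗ I}`. -/
theorem pure_induction {I : Type*} [Fintype I] {P : F.SuperPower I → Prop}
    (hom : ∀ (p : I → ZMod 2) (a : I → A), (∀ i, a i ∈ F.parityPart (p i)) → P (F.pureTensor I a))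
    (hadd : ∀ x y, P x → P y → P (x + y)) (hsmul : ∀ (r : ℚ) x, P x → P (r • x))
    (x : F.SuperPower I) : P x := by
  classical
  induction x using PiTensorProduct.induction_on with
  | add x y hx hy => exact hadd _ _ hx hy
  | smul_tprod r a =>
    refine hsmul r _ ?_
    have hb : a = fun i => ∑ p, F.parityProj p (a i) := funext fun i => (F.sum_parityProj _).symm
    have h0 : P 0 := by
      simpa using hsmul 0 _ (hom _ (fun _ => 0) fun i => zero_mem (F.parityPart 0))
    rw [hb, MultilinearMap.map_sum]
    exact Finset.sum_induction (M := F.SuperPower I) _ P hadd h0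
      fun p _ => hom p _ fun i => parityProj_mem _ _

theorem pure_parityProj {I : Type*} [Fintype I] {p q : I → ZMod 2} {a : I → A}
    (ha : ∀ i, a i ∈ F.parityPart (p i)) :
    F.pureTensor I (fun i => F.parityProj (q i) (a i)) = if q = p then F.pureTensor I a else 0 := by
  split_ifs with h
  · subst h
    congr 1
    exact funext fun i => ha i
  · obtain ⟨i, hi⟩ := Function.ne_iff.1 h
    refine MultilinearMap.map_coord_zero _ i ?_
    rw [parityProj_of_mem_parityPart _ (ha i), if_neg hi]

section Order

variable {I J : Type*} [Fintype I] [LinearOrder I] [Fintype J] [LinearOrder J]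

theorem shuffleSign_eq (p q : I → ZMod 2) :
    shuffleSign p q = ∏ i, ∏ j, if j < i then sgn (p i * q j) else 1 := by
  refine Finset.prod_congr rfl fun i _ => Finset.prod_congr rfl fun j _ => ?_
  rcases zmod_two_cases (p i) with h | h <;> rcases zmod_two_cases (q j) with h' | h' <;>
    simp [sgn, h, h']

theorem shuffleSign_add_left (p p' q : I → ZMod 2) :
    shuffleSign (p + p') q = shuffleSign p q * shuffleSign p' q := by
  simp only [shuffleSign_eq, ← Finset.prod_mul_distrib]
  refine Finset.prod_congr rfl fun i _ => Finset.prod_congr rfl fun j _ => ?_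
  split_ifs <;> simp [add_mul, sgn_add]

theorem shuffleSign_add_right (p q q' : I → ZMod 2) :
    shuffleSign p (q + q') = shuffleSign p q * shuffleSign p q' := by
  simp only [shuffleSign_eq, ← Finset.prod_mul_distrib]
  refine Finset.prod_congr rfl fun i _ => Finset.prod_congr rfl fun j _ => ?_
  split_ifs <;> simp [mul_add, sgn_add]

theorem shuffleSign_zero_left (q : I → ZMod 2) : shuffleSign 0 q = 1 := by
  simp [shuffleSign]

theorem shuffleSign_zero_right (q : I → ZMod 2) : shuffleSign q 0 = 1 := by
  simp [shuffleSign]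

/-- Exchanging the two families differs from exchanging `a_i` with `b_i` for each `i` by the sign
of moving all of the first family past all of the second. -/
theorem shuffleSign_comm (p q : I → ZMod 2) :
    shuffleSign p q * ∏ i, sgn (p i * q i) =
      shuffleSign q p * sgn ((∑ i, p i) * ∑ i, q i) := by
  have h1 : shuffleSign p q * ∏ i, sgn (p i * q i) =
      ∏ i, ∏ j, if j ≤ i then sgn (p i * q j) else 1 := by
    rw [shuffleSign_eq, ← Finset.prod_mul_distrib]
    refine Finset.prod_congr rfl fun i _ => ?_
    have : sgn (p i * q i) = ∏ j, if j = i then sgn (p i * q j) else 1 := by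
      rw [Finset.prod_ite_eq']; simp
    rw [this, ← Finset.prod_mul_distrib]
    refine Finset.prod_congr rfl fun j _ => ?_
    rcases lt_trichotomy j i with h | h | h
    · simp [h, h.le, h.ne]
    · simp [h]
    · simp [h.not_gt, h.not_ge, h.ne']
  have h2 : shuffleSign q p = ∏ i, ∏ j, if i < j then sgn (p i * q j) else 1 := by
    rw [shuffleSign_eq, Finset.prod_comm]
    simp only [mul_comm]
  rw [h1, h2, Finset.sum_mul_sum, sgn_sum, ← Finset.prod_mul_distrib]
  refine Finset.prod_congr rfl fun i _ => ?_
  rw [sgn_sum, ← Finset.prod_mul_distrib]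
  refine Finset.prod_congr rfl fun j _ => ?_
  rcases lt_or_ge i j with h | h
  · rw [if_neg h.not_ge, if_pos h, sgn_mul_self]
  · rw [if_pos h, if_neg h.not_gt, one_mul]

variable (F) in
theorem tensorMul_pure {p q : I → ZMod 2} {a b : I → A} (ha : ∀ i, a i ∈ F.parityPart (p i))
    (hb : ∀ i, b i ∈ F.parityPart (q i)) :
    F.tensorMul (F.pureTensor I a) (F.pureTensor I b) =
      shuffleSign p q • F.pureTensor I (fun i => a i * b i) := by
  have key : ∀ p' q' : I → ZMod 2, (PiTensorProduct.map₂ (fun _ : I => LinearMap.mul ℚ A))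
      (PiTensorProduct.map (fun i => F.parityProj (p' i)) (PiTensorProduct.tprod ℚ a))
      (PiTensorProduct.map (fun i => F.parityProj (q' i)) (PiTensorProduct.tprod ℚ b)) =
      if p' = p then if q' = q then F.pureTensor I (fun i => a i * b i) else 0 else 0 := by
    intro p' q'
    rw [PiTensorProduct.map_tprod, PiTensorProduct.map_tprod]
    have h1 := pure_parityProj (q := p') ha
    have h2 := pure_parityProj (q := q') hb
    rw [pureTensor] at h1 h2
    erw [h1, h2]
    split_ifs
    · exact PiTensorProduct.map₂_tprod_tprod _ _ _
    · exact LinearMap.map_zero _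
    · exact LinearMap.map_zero₂ _ _
    · exact LinearMap.map_zero₂ _ _
  have : F.tensorMul (PiTensorProduct.tprod ℚ a) (PiTensorProduct.tprod ℚ b) =
      ∑ p' : I → ZMod 2, ∑ q' : I → ZMod 2, shuffleSign p' q' •
      (PiTensorProduct.map₂ (fun _ : I => LinearMap.mul ℚ A))
      (PiTensorProduct.map (fun i => F.parityProj (p' i)) (PiTensorProduct.tprod ℚ a))
      (PiTensorProduct.map (fun i => F.parityProj (q' i)) (PiTensorProduct.tprod ℚ b)) := by
    simp only [tensorMul, LinearMap.sum_apply, LinearMap.smul_apply]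
    rfl
  refine this.trans ?_
  simp only [key]
  rw [Finset.sum_eq_single p
      (fun p' _ h => Finset.sum_eq_zero fun q' _ => by
        rw [if_neg h]
        exact smul_zero (A := F.TensorPower I) _) (by simp),
    Finset.sum_eq_single q
      (fun q' _ h => by
        rw [if_neg h, if_pos rfl]
        exact smul_zero (A := F.TensorPower I) _) (by simp),
    if_pos rfl, if_pos rfl]
  rfl

instance : Mul (F.SuperPower I) := ⟨fun x y => F.tensorMul x y⟩

instance : One (F.SuperPower I) := ⟨F.pureTensor I fun _ => 1⟩

omit [Fintype I] [LinearOrder I] in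
theorem superPower_one_def : (1 : F.SuperPower I) = F.pureTensor I fun _ => 1 := rfl

theorem pure_mul_pure {p q : I → ZMod 2} {a b : I → A} (ha : ∀ i, a i ∈ F.parityPart (p i))
    (hb : ∀ i, b i ∈ F.parityPart (q i)) :
    F.pureTensor I a * F.pureTensor I b = shuffleSign p q • F.pureTensor I (fun i => a i * b i) :=
  F.tensorMul_pure ha hb

protected theorem add_mul' (x y z : F.SuperPower I) : (x + y) * z = x * z + y * z :=
  LinearMap.map_add₂ F.tensorMul x y z

protected theorem mul_add' (x y z : F.SuperPower I) : x * (y + z) = x * y + x * z :=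
  LinearMap.map_add (F.tensorMul x) y z

protected theorem smul_mul' (r : ℚ) (x y : F.SuperPower I) : (r • x) * y = r • (x * y) :=
  LinearMap.map_smul₂ F.tensorMul r x y

protected theorem mul_smul' (r : ℚ) (x y : F.SuperPower I) : x * (r • y) = r • (x * y) :=
  LinearMap.map_smul (F.tensorMul x) r y

/-- The signs match because `shuffleSign` is multiplicative in both arguments. -/
protected theorem mul_assoc' (x y z : F.SuperPower I) : x * y * z = x * (y * z) := by
  induction x using pure_induction with
  | hadd x x' h h' => simp only [GradedFrobeniusAlgebra.add_mul', h, h']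
  | hsmul r x h => simp only [GradedFrobeniusAlgebra.smul_mul', h]
  | hom p a ha =>
  induction y using pure_induction with
  | hadd x x' h h' =>
    simp only [GradedFrobeniusAlgebra.add_mul', GradedFrobeniusAlgebra.mul_add', h, h']
  | hsmul r x h =>
    simp only [GradedFrobeniusAlgebra.smul_mul', GradedFrobeniusAlgebra.mul_smul', h]
  | hom q b hb =>
  induction z using pure_induction with
  | hadd x x' h h' => simp only [GradedFrobeniusAlgebra.mul_add', h, h']
  | hsmul r x h => simp only [GradedFrobeniusAlgebra.mul_smul', h]
  | hom r c hc =>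
  rw [pure_mul_pure ha hb, pure_mul_pure hb hc, GradedFrobeniusAlgebra.smul_mul',
    GradedFrobeniusAlgebra.mul_smul', pure_mul_pure (fun i => mul_mem_parityPart (ha i) (hb i)) hc,
    pure_mul_pure ha (fun i => mul_mem_parityPart (hb i) (hc i)), smul_smul, smul_smul]
  simp only [mul_assoc]
  congr 1
  have h1 := shuffleSign_add_left p q r
  have h2 := shuffleSign_add_right p q r
  simp only [Pi.add_def] at h1 h2
  rw [h1, h2]
  ring

protected theorem one_mul' (x : F.SuperPower I) : 1 * x = x := by
  induction x using pure_induction with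
  | hadd x x' h h' => simp only [GradedFrobeniusAlgebra.mul_add', h, h']
  | hsmul r x h => simp only [GradedFrobeniusAlgebra.mul_smul', h]
  | hom p a ha =>
    rw [superPower_one_def, pure_mul_pure (p := 0) (fun _ => one_mem_parityPart) ha,
      shuffleSign_zero_left, one_smul]
    simp

protected theorem mul_one' (x : F.SuperPower I) : x * 1 = x := by
  induction x using pure_induction with
  | hadd x x' h h' => simp only [GradedFrobeniusAlgebra.add_mul', h, h']
  | hsmul r x h => simp only [GradedFrobeniusAlgebra.smul_mul', h]
  | hom p a ha =>
    rw [superPower_one_def, pure_mul_pure (q := 0) ha (fun _ => one_mem_parityPart),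
      shuffleSign_zero_right, one_smul]
    simp

instance : Ring (F.SuperPower I) where
  __ := (inferInstance : AddCommGroup (F.SuperPower I))
  mul_assoc := GradedFrobeniusAlgebra.mul_assoc'
  one_mul := GradedFrobeniusAlgebra.one_mul'
  mul_one := GradedFrobeniusAlgebra.mul_one'
  left_distrib := GradedFrobeniusAlgebra.mul_add'
  right_distrib := GradedFrobeniusAlgebra.add_mul'
  zero_mul x := LinearMap.map_zero₂ F.tensorMul x
  mul_zero x := LinearMap.map_zero (F.tensorMul x)

instance : Algebra ℚ (F.SuperPower I) :=
  Algebra.ofModule GradedFrobeniusAlgebra.smul_mul' GradedFrobeniusAlgebra.mul_smul'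

variable (F) in
/-- The part of `A^{⊗ I}` of parity `p`. -/
def superPart (I : Type*) [Fintype I] (p : ZMod 2) : Submodule ℚ (F.SuperPower I) :=
  Submodule.span ℚ {x | ∃ (q : I → ZMod 2) (a : I → A),
    (∀ i, a i ∈ F.parityPart (q i)) ∧ ∑ i, q i = p ∧ x = F.pureTensor I a}

omit [LinearOrder I] in
theorem pure_mem_superPart {q : I → ZMod 2} {a : I → A} (ha : ∀ i, a i ∈ F.parityPart (q i)) :
    F.pureTensor I a ∈ F.superPart I (∑ i, q i) :=
  Submodule.subset_span ⟨q, a, ha, rfl, rfl⟩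

theorem superPart_induction {p : ZMod 2} {P : (x : F.SuperPower I) → x ∈ F.superPart I p → Prop}
    (hom : ∀ (q : I → ZMod 2) (a : I → A) (ha : ∀ i, a i ∈ F.parityPart (q i))
      (hq : ∑ i, q i = p), P (F.pureTensor I a) (hq ▸ pure_mem_superPart ha))
    (hzero : P 0 (zero_mem _)) (hadd : ∀ x y hx hy, P x hx → P y hy → P (x + y) (add_mem hx hy))
    (hsmul : ∀ (r : ℚ) x hx, P x hx → P (r • x) (Submodule.smul_mem _ r hx))
    {x : F.SuperPower I} (hx : x ∈ F.superPart I p) : P x hx := by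
  induction hx using Submodule.span_induction with
  | mem x hx => obtain ⟨q, a, ha, hq, rfl⟩ := hx; exact hom q a ha hq
  | zero => exact hzero
  | add x y _ _ hx hy => exact hadd x y _ _ hx hy
  | smul r x _ hx => exact hsmul r x _ hx

variable (F) in
/-- The identity, as an isomorphism of the two types for `A^{⊗ I}`. -/
def toSuper (I : Type*) : F.TensorPower I ≃ₗ[ℚ] F.SuperPower I :=
  LinearEquiv.refl ℚ (F.TensorPower I)

omit [LinearOrder I] in
theorem toSuper_mem_superPart {p : ℤ} {x : F.TensorPower I}
    (hx : x ∈ F.tensorGrade I p) : F.toSuper I x ∈ F.superPart I p := by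
  suffices h : F.tensorGrade I p ≤ (F.superPart I p).comap (F.toSuper I).toLinearMap from h hx
  refine Submodule.span_le.2 ?_
  rintro _ ⟨k, a, ha, rfl, rfl⟩
  exact Submodule.subset_span ⟨fun i => k i, a, fun i => mem_parityPart_of_mem_grade (ha i),
    by push_cast; rfl, rfl⟩

theorem superPower_induction {P : F.SuperPower I → Prop}
    (hom : ∀ p, ∀ x ∈ F.superPart I p, P x) (hadd : ∀ x y, P x → P y → P (x + y))
    (x : F.SuperPower I) : P x := by
  have : x ∈ F.superPart I 0 ⊔ F.superPart I 1 := by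
    induction x using pure_induction with
    | hadd x y hx hy => exact add_mem hx hy
    | hsmul r x hx => exact Submodule.smul_mem _ _ hx
    | hom p a ha =>
      have := pure_mem_superPart ha
      rcases zmod_two_cases (∑ i, p i) with h | h <;> rw [h] at this
      · exact Submodule.mem_sup_left this
      · exact Submodule.mem_sup_right this
  obtain ⟨y, hy, z, hz, rfl⟩ := Submodule.mem_sup.1 this
  exact hadd _ _ (hom _ _ hy) (hom _ _ hz)

omit [LinearOrder I] in
theorem one_mem_superPart : (1 : F.SuperPower I) ∈ F.superPart I 0 := by
  have := pure_mem_superPart (I := I) (F := F) (q := 0) (a := fun _ => 1)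
    fun _ => one_mem_parityPart
  rwa [show ∑ i : I, (0 : I → ZMod 2) i = 0 from Finset.sum_eq_zero fun _ _ => rfl] at this

theorem mul_mem_superPart {p q : ZMod 2} {x y : F.SuperPower I} (hx : x ∈ F.superPart I p)
    (hy : y ∈ F.superPart I q) : x * y ∈ F.superPart I (p + q) := by
  induction hx using superPart_induction with
  | hzero => simp
  | hadd x x' _ _ h h' => rw [add_mul]; exact add_mem h h'
  | hsmul r x _ h => rw [smul_mul_assoc]; exact Submodule.smul_mem _ _ h
  | hom p' a ha hp =>
  induction hy using superPart_induction with
  | hzero => simp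
  | hadd x x' _ _ h h' => rw [mul_add]; exact add_mem h h'
  | hsmul r x _ h => rw [mul_smul_comm]; exact Submodule.smul_mem _ _ h
  | hom q' b hb hq =>
  rw [pure_mul_pure ha hb]
  refine Submodule.smul_mem _ _ ?_
  have := pure_mem_superPart (fun i => mul_mem_parityPart (ha i) (hb i))
  rwa [Finset.sum_add_distrib, hp, hq] at this

theorem mul_comm_of_mem_superPart {p q : ZMod 2} {x y : F.SuperPower I}
    (hx : x ∈ F.superPart I p) (hy : y ∈ F.superPart I q) : x * y = sgn (p * q) • (y * x) := by
  induction hx using superPart_induction with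
  | hzero => simp
  | hadd x x' _ _ h h' => rw [add_mul, h, h', mul_add, smul_add]
  | hsmul r x _ h => rw [smul_mul_assoc, h, mul_smul_comm, smul_comm]
  | hom p' a ha hp =>
  induction hy using superPart_induction with
  | hzero => simp
  | hadd x x' _ _ h h' => rw [mul_add, h, h', add_mul, smul_add]
  | hsmul r x _ h => rw [mul_smul_comm, h, smul_mul_assoc, smul_comm]
  | hom q' b hb hq =>
  have h : F.pureTensor I (fun i => a i * b i) =
      (∏ i, sgn (p' i * q' i)) • F.pureTensor I (fun i => b i * a i) := by
    rw [← MultilinearMap.map_smul_univ]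
    congr 1
    exact funext fun i => mul_comm_of_mem_parityPart (ha i) (hb i)
  rw [pure_mul_pure ha hb, pure_mul_pure hb ha, h, smul_smul, smul_smul, shuffleSign_comm, hp, hq,
    mul_comm]

theorem commute_of_mem_superPart_zero {x : F.SuperPower I} (hx : x ∈ F.superPart I 0)
    (y : F.SuperPower I) : Commute x y := by
  induction y using superPower_induction with
  | hom p y hy =>
    have := mul_comm_of_mem_superPart hx hy
    rwa [zero_mul, sgn_zero, one_smul] at this
  | hadd y z hy hz => exact hy.add_right hz

end Order

/-! ### Generators of `A^{⊗ I}` and the ring homomorphisms `φ^*` -/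

section Order

variable {I J : Type*} [Fintype I] [LinearOrder I] [Fintype J] [LinearOrder J]

omit [Fintype I] in
theorem update_one_mem_parityPart {m : I} {p : ZMod 2} {a : A} (ha : a ∈ F.parityPart p) (i : I) :
    Function.update (fun _ => (1 : A)) m a i ∈ F.parityPart ((Pi.single m p : I → ZMod 2) i) := by
  by_cases h : i = m
  · subst h; simpa using ha
  · simpa [h] using one_mem_parityPart

theorem pureTensor_update_mul_pureTensor {m : I} {p : ZMod 2} {a : A} (ha : a ∈ F.parityPart p)
    {q : I → ZMod 2} {c : I → A} (hc : ∀ i, c i ∈ F.parityPart (q i)) :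
    F.pureTensor I (Function.update (fun _ => 1) m a) * F.pureTensor I c =
      (∏ j, if j < m then sgn (p * q j) else 1) •
        F.pureTensor I (Function.update c m (a * c m)) := by
  rw [pure_mul_pure (update_one_mem_parityPart ha) hc]
  congr 1
  · rw [shuffleSign_eq, Finset.prod_eq_single m (fun i _ hi => by simp [hi, sgn_zero]) (by simp)]
    simp
  · congr 1
    ext i
    by_cases h : i = m
    · subst h; simp
    · simp [h]

variable (F) in
/-- The inclusion of `A` as the factor of `A^{⊗ I}` with index `i`. -/
def inj (i : I) : A →ₐ[ℚ] F.SuperPower I :=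
  AlgHom.ofLinearMap ((F.pureTensor I).toLinearMap (fun _ => 1) i)
    (congrArg (F.pureTensor I) (Function.update_eq_self i fun _ => (1 : A))) (by
      intro a b
      suffices h : ∀ p, ∀ a ∈ F.parityPart p, ∀ q, ∀ b ∈ F.parityPart q,
          F.pureTensor I (Function.update (fun _ => 1) i (a * b)) =
          F.pureTensor I (Function.update (fun _ => 1) i a) *
            F.pureTensor I (Function.update (fun _ => 1) i b) by
        rw [← F.sum_parityProj a, ← F.sum_parityProj b, Finset.sum_mul_sum]
        simp only [map_sum, Finset.sum_mul_sum]
        exact Finset.sum_congr rfl fun p _ => Finset.sum_congr rfl fun q _ =>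
          h p _ (parityProj_mem _ _) q _ (parityProj_mem _ _)
      intro p a ha q b hb
      rw [pureTensor_update_mul_pureTensor ha (update_one_mem_parityPart hb),
        Finset.prod_eq_one, one_smul]
      · simp
      · intro j _
        split_ifs with h
        · simp [h.ne, sgn_zero]
        · rfl)

theorem inj_apply (i : I) (a : A) :
    F.inj i a = F.pureTensor I (Function.update (fun _ => 1) i a) := rfl

theorem inj_mul_pureTensor {m : I} {p : ZMod 2} {a : A} (ha : a ∈ F.parityPart p)
    {q : I → ZMod 2} {c : I → A} (hc : ∀ i, c i ∈ F.parityPart (q i)) :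
    F.inj m a * F.pureTensor I c = (∏ j, if j < m then sgn (p * q j) else 1) •
        F.pureTensor I (Function.update c m (a * c m)) :=
  pureTensor_update_mul_pureTensor ha hc

theorem inj_mem_superPart {i : I} {p : ZMod 2} {a : A} (ha : a ∈ F.parityPart p) :
    F.inj i a ∈ F.superPart I p := by
  have := pure_mem_superPart (update_one_mem_parityPart (m := i) ha)
  rwa [Finset.sum_pi_single' i p Finset.univ, if_pos (Finset.mem_univ i)] at this

omit [Fintype I] [LinearOrder I] [Fintype J] in
theorem list_prod_inj_sign [Fintype J] (φ : I → J) (p : I → ZMod 2) (r : ZMod 2) (m : J)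
    (l : List I) :
    (∏ j, if j < m then sgn (r * ((l.filter fun k => φ k = j).map p).sum) else 1) =
      (l.map fun k => if φ k < m then sgn (r * p k) else 1).prod := by
  induction l with
  | nil => simp [sgn_zero]
  | cons k l ih =>
    rw [List.map_cons, List.prod_cons, ← ih]
    have : (if φ k < m then sgn (r * p k) else 1) =
        ∏ j, if j = φ k then (if φ k < m then sgn (r * p k) else 1) else 1 := by
      rw [Finset.prod_ite_eq']; simp
    rw [this, ← Finset.prod_mul_distrib]
    refine Finset.prod_congr rfl fun j _ => ?_
    by_cases hj : φ k = j
    · subst hj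
      by_cases h : φ k < m <;> simp [h, mul_add, sgn_add]
    · simp [hj, Ne.symm hj]

/-- The sign of the reordering of `∏_{i ∈ l} a_i` by the values `φ i`, where `a_i` has parity
`p i`. -/
def listSign (φ : I → J) (p : I → ZMod 2) : List I → ℚ
  | [] => 1
  | i :: l => (l.map fun k => if φ k < φ i then sgn (p i * p k) else 1).prod * listSign φ p l

omit [Fintype I] [LinearOrder I] [Fintype J] in
theorem listSign_ne_zero (φ : I → J) (p : I → ZMod 2) : ∀ l, listSign φ p l ≠ 0
  | [] => one_ne_zero
  | i :: l => by
    refine mul_ne_zero (List.prod_ne_zero ?_) (listSign_ne_zero φ p l)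
    intro h
    obtain ⟨k, _, hk⟩ := List.mem_map.1 h
    split_ifs at hk
    · exact sgn_ne_zero _ hk
    · exact one_ne_zero hk

omit [Fintype I] [LinearOrder I] [Fintype J] in
theorem listSign_of_even (φ : I → J) {p : I → ZMod 2} :
    ∀ l : List I, (∀ i ∈ l, p i = 0) → listSign φ p l = 1
  | [], _ => rfl
  | i :: l, h => by
    simp [listSign, h i, sgn_zero, listSign_of_even φ l fun k hk => h k (List.mem_cons_of_mem _ hk)]

omit [Fintype I] [LinearOrder I] in
/-- A product of elements of factors of `A^{⊗ J}` is a pure tensor up to sign. -/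
theorem list_prod_inj (φ : I → J) {p : I → ZMod 2} {a : I → A}
    (ha : ∀ i, a i ∈ F.parityPart (p i)) (l : List I) :
    (l.map fun i => F.inj (φ i) (a i)).prod =
      listSign φ p l • F.pureTensor J fun j => ((l.filter fun i => φ i = j).map a).prod := by
  induction l with
  | nil => simp [listSign, superPower_one_def]
  | cons i l ih =>
    rw [List.map_cons, List.prod_cons, ih, mul_smul_comm, inj_mul_pureTensor (ha i)
      (fun j => list_prod_mem_parityPart ha _), list_prod_inj_sign, smul_smul, listSign, mul_comm]
    congr 2
    ext j
    by_cases hj : j = φ i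
    · subst hj; simp
    · simp [hj, Ne.symm hj]

theorem sort_filter (s : I → Prop) [DecidablePred s] :
    (Finset.univ.filter s).sort (· ≤ ·) = (Finset.univ.sort (· ≤ ·)).filter fun i => s i := by
  refine List.Perm.eq_of_pairwise' (r := (· ≤ ·)) (Finset.pairwise_sort _ _)
    ((Finset.pairwise_sort _ _).filter _) ?_
  rw [List.perm_ext_iff_of_nodup (Finset.sort_nodup _ _) ((Finset.sort_nodup _ _).filter _)]
  simp

omit [Fintype I] [Fintype J] in
/-- For an increasing list the sign is that of the inversions of `φ`. -/
theorem listSign_eq_prod (φ : I → J) (p : I → ZMod 2) (l : List I) (hl : l.Pairwise (· < ·)) :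
    listSign φ p l = ∏ i ∈ l.toFinset, ∏ j ∈ l.toFinset,
      if i < j ∧ φ j < φ i then sgn (p i * p j) else 1 := by
  induction l with
  | nil => simp [listSign]
  | cons i l ih =>
    rw [List.pairwise_cons] at hl
    have hi : i ∉ l.toFinset := fun h => (hl.1 i (List.mem_toFinset.1 h)).false
    rw [List.toFinset_cons, Finset.prod_insert hi, Finset.prod_insert hi, listSign, ih hl.2]
    simp only [lt_self_iff_false, false_and, if_false, one_mul]
    congr 1
    · rw [← List.prod_toFinset _ (hl.2.imp fun h => h.ne)]
      refine Finset.prod_congr rfl fun k hk => ?_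
      simp [hl.1 k (List.mem_toFinset.1 hk)]
    · refine Finset.prod_congr rfl fun k hk => ?_
      rw [Finset.prod_insert hi, if_neg, one_mul]
      exact fun h => (h.1.trans (hl.1 k (List.mem_toFinset.1 hk))).false

omit [Fintype J] in
theorem sortSign_eq (φ : I → J) (p : I → ZMod 2) :
    sortSign φ p = listSign φ p (Finset.univ.sort (· ≤ ·)) := by
  rw [listSign_eq_prod _ _ _ (Finset.sortedLT_sort _).pairwise, Finset.sort_toFinset]
  refine Finset.prod_congr rfl fun i _ => Finset.prod_congr rfl fun j _ => ?_
  rcases zmod_two_cases (p i) with h | h <;> rcases zmod_two_cases (p j) with h' | h' <;>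
    simp [sgn, h, h']

variable (F) in
omit [Fintype J] in
theorem pull_tprod (φ : I → J) {p : I → ZMod 2} {a : I → A}
    (ha : ∀ i, a i ∈ F.parityPart (p i)) :
    F.pull φ (PiTensorProduct.tprod ℚ a) = sortSign φ p • F.fiberProd φ a := by
  have key : ∀ q : I → ZMod 2, F.fiberProd φ (fun i => F.parityProj (q i) (a i)) =
      if q = p then F.fiberProd φ a else 0 := by
    intro q
    split_ifs with h
    · subst h
      congr 1
      exact funext fun i => ha i
    · obtain ⟨i, hi⟩ := Function.ne_iff.1 h
      refine MultilinearMap.map_coord_zero _ i ?_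
      rw [parityProj_of_mem_parityPart _ (ha i), if_neg hi]
  simp only [pull, LinearMap.sum_apply, LinearMap.smul_apply, PiTensorProduct.lift.tprod,
    MultilinearMap.compLinearMap_apply, key]
  rw [Finset.sum_eq_single p (fun q _ h => by rw [if_neg h]; simp) (by simp), if_pos rfl]

variable (F) in
/-- The map `φ^*` as a linear map between the algebras `A^{⊗ I}` and `A^{⊗ J}`. -/
def pullLinear (φ : I → J) : F.SuperPower I →ₗ[ℚ] F.SuperPower J :=
  (F.toSuper J).toLinearMap ∘ₗ F.pull φ ∘ₗ (F.toSuper I).symm.toLinearMap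

/-- Up to the identification of `A^{⊗ I}` with the products of elements of its factors, `φ^*` only
renames the factors; this is what makes it multiplicative. -/
theorem pullLinear_pureTensor (φ : I → J) {p : I → ZMod 2} {a : I → A}
    (ha : ∀ i, a i ∈ F.parityPart (p i)) :
    F.pullLinear φ (F.pureTensor I a) =
      ((Finset.univ.sort (· ≤ ·)).map fun i => F.inj (φ i) (a i)).prod := by
  refine (F.pull_tprod φ ha).trans ?_
  rw [list_prod_inj φ ha, sortSign_eq]
  simp only [← sort_filter]
  rfl

omit [Fintype I] [LinearOrder I] [Fintype J] in
theorem exists_filter_eq_singleton {φ : I → J} {l : List I} (hl : (l.map φ).Nodup) {j : J}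
    (hj : j ∈ l.map φ) : ∃ i ∈ l, φ i = j ∧ l.filter (fun i => φ i = j) = [i] := by
  have h1 : (l.filter fun i => φ i = j).length = 1 := by
    rw [← List.countP_eq_length_filter, ← List.count_eq_one_of_mem hl hj, List.count,
      List.countP_map]
    refine List.countP_congr fun i _ => ?_
    simp
  obtain ⟨i, hi⟩ := List.length_eq_one_iff.1 h1
  have h2 : i ∈ l.filter fun i => φ i = j := by simp [hi]
  exact ⟨i, List.mem_of_mem_filter h2, by simpa using (List.mem_filter.1 h2).2, hi⟩

omit [Fintype I] [LinearOrder I] in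
theorem list_prod_fiberwise {M : Type*} [CommMonoid M] (φ : I → J) (g : I → M) (l : List I) :
    ∏ j, ((l.filter fun i => φ i = j).map g).prod = (l.map g).prod := by
  induction l with
  | nil => simp
  | cons i l ih =>
    have : g i = ∏ j, if j = φ i then g i else 1 := by rw [Finset.prod_ite_eq']; simp
    rw [List.map_cons, List.prod_cons, ← ih, this, ← Finset.prod_mul_distrib]
    refine Finset.prod_congr rfl fun j _ => ?_
    by_cases hj : φ i = j
    · subst hj; simp
    · simp [hj, Ne.symm hj]

theorem pureTensor_eq_list_prod {p : I → ZMod 2} {a : I → A}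
    (ha : ∀ i, a i ∈ F.parityPart (p i)) {l : List I} (hl : l.Nodup) (hl' : ∀ i, i ∈ l) :
    (l.map fun i => F.inj i (a i)).prod = listSign id p l • F.pureTensor I a := by
  refine (list_prod_inj id ha l).trans ?_
  congr 2
  ext j
  obtain ⟨i, -, rfl, h⟩ := exists_filter_eq_singleton (φ := id) (l := l) (by simpa) (j := j)
    (by simpa using hl' j)
  rw [h]; simp

theorem pureTensor_eq_sort_prod {p : I → ZMod 2} {a : I → A}
    (ha : ∀ i, a i ∈ F.parityPart (p i)) :
    F.pureTensor I a = ((Finset.univ.sort (· ≤ ·)).map fun i => F.inj i (a i)).prod := by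
  rw [pureTensor_eq_list_prod ha (Finset.sort_nodup _ _) (by simp), ← sortSign_eq]
  have : sortSign id p = 1 :=
    Finset.prod_eq_one fun i _ => Finset.prod_eq_one fun j _ =>
      if_neg fun h => (h.1.trans h.2.1).false
  rw [this, one_smul]

theorem inj_mul_inj {j k : J} {p q : ZMod 2} {a b : A} (ha : a ∈ F.parityPart p)
    (hb : b ∈ F.parityPart q) : F.inj j a * F.inj k b = sgn (p * q) • (F.inj k b * F.inj j a) :=
  mul_comm_of_mem_superPart (inj_mem_superPart ha) (inj_mem_superPart hb)

omit [Fintype I] in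
/-- The effect of multiplying the `i`-th of the elements `b_k` by `a` on the product of the `b_k`:
the element `a` moves past the `b_k` with `k < i`, whatever the factors `φ k` that they lie in. -/
theorem inj_mul_list_prod (φ : I → J) {p : ZMod 2} {a : A} (ha : a ∈ F.parityPart p)
    {q : I → ZMod 2} {b : I → A} (hb : ∀ i, b i ∈ F.parityPart (q i)) (i : I) (l : List I)
    (hl : l.Pairwise (· < ·)) (hi : i ∈ l) :
    F.inj (φ i) a * (l.map fun k => F.inj (φ k) (b k)).prod =
      (l.map fun k => if k < i then sgn (p * q k) else 1).prod •
        (l.map fun k => F.inj (φ k) (Function.update b i (a * b i) k)).prod := by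
  induction l with
  | nil => simp at hi
  | cons k l ih =>
    rw [List.pairwise_cons] at hl
    simp only [List.map_cons, List.prod_cons]
    by_cases hk : k = i
    · subst hk
      have h1 : l.map (fun j => F.inj (φ j) (Function.update b k (a * b k) j)) =
          l.map fun j => F.inj (φ j) (b j) :=
        List.map_congr_left fun j hj => by rw [Function.update_of_ne (hl.1 j hj).ne']
      have h2 : (l.map fun j => if j < k then sgn (p * q j) else 1).prod = 1 :=
        List.prod_eq_one fun x hx => by
          obtain ⟨j, hj, rfl⟩ := List.mem_map.1 hx
          exact if_neg (hl.1 j hj).not_gt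
      rw [h1, h2]
      simp [mul_assoc]
    · have hi' : i ∈ l := (List.mem_cons.1 hi).resolve_left (Ne.symm hk)
      rw [← mul_assoc, inj_mul_inj ha (hb k), smul_mul_assoc, mul_assoc, ih hl.2 hi',
        Function.update_of_ne hk, if_pos (hl.1 i hi'), mul_smul_comm, smul_smul]

theorem pullLinear_inj_mul (φ : I → J) (i : I) (a : A) (y : F.SuperPower I) :
    F.pullLinear φ (F.inj i a * y) = F.inj (φ i) a * F.pullLinear φ y := by
  suffices h : ∀ p, ∀ a ∈ F.parityPart p,
      F.pullLinear φ (F.inj i a * y) = F.inj (φ i) a * F.pullLinear φ y by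
    rw [← F.sum_parityProj a]
    simp only [map_sum, Finset.sum_mul]
    exact Finset.sum_congr rfl fun p _ => h p _ (parityProj_mem _ _)
  intro p a ha
  induction y using pure_induction with
  | hadd x y hx hy => simp only [mul_add, map_add, hx, hy]
  | hsmul r x hx => simp only [mul_smul_comm, map_smul, hx]
  | hom q b hb =>
    have hu : ∀ k, Function.update b i (a * b i) k ∈
        F.parityPart (Function.update q i (p + q i) k) := by
      intro k
      by_cases h : k = i
      · subst h; simpa using mul_mem_parityPart ha (hb k)
      · simpa [h] using hb k
    rw [inj_mul_pureTensor ha hb, map_smul, pullLinear_pureTensor φ hu, pullLinear_pureTensor φ hb,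
      inj_mul_list_prod φ ha hb i _ (Finset.sortedLT_sort _).pairwise (by simp)]
    congr 1
    rw [← List.prod_toFinset _ (Finset.sort_nodup _ _), Finset.sort_toFinset]

theorem pullLinear_one (φ : I → J) : F.pullLinear φ 1 = 1 := by
  rw [superPower_one_def, pullLinear_pureTensor φ (p := 0) fun _ => one_mem_parityPart]
  simp

/-- An induction principle: `A^{⊗ I}` is generated by its factors. -/
theorem inj_induction {P : F.SuperPower I → Prop} (hone : P 1)
    (hinj : ∀ i a x, P x → P (F.inj i a * x)) (hadd : ∀ x y, P x → P y → P (x + y))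
    (hsmul : ∀ (r : ℚ) x, P x → P (r • x)) (x : F.SuperPower I) : P x := by
  induction x using pure_induction with
  | hadd x y hx hy => exact hadd x y hx hy
  | hsmul r x hx => exact hsmul r x hx
  | hom p a ha =>
    rw [pureTensor_eq_sort_prod ha]
    induction Finset.univ.sort (fun x y : I => x ≤ y) with
    | nil => simpa using hone
    | cons i l ih => simpa using hinj i (a i) _ ih

variable (F) in
/-- The ring homomorphism `φ^* : A^{⊗ I} → A^{⊗ J}`. -/
def pullHom (φ : I → J) : F.SuperPower I →ₐ[ℚ] F.SuperPower J :=
  AlgHom.ofLinearMap (F.pullLinear φ) (pullLinear_one φ) fun x y => by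
    induction x using inj_induction with
    | hone => rw [one_mul, pullLinear_one, one_mul]
    | hinj i a x hx => rw [mul_assoc, pullLinear_inj_mul, hx, pullLinear_inj_mul, mul_assoc]
    | hadd x x' hx hx' => simp only [add_mul, map_add, hx, hx']
    | hsmul r x hx => simp only [smul_mul_assoc, map_smul, hx]

@[simp]
theorem pullHom_inj (φ : I → J) (i : I) (a : A) : F.pullHom φ (F.inj i a) = F.inj (φ i) a := by
  have := pullLinear_inj_mul (F := F) φ i a 1
  rwa [pullLinear_one, mul_one, mul_one] at this

theorem algHom_ext {C : Type*} [Ring C] [Algebra ℚ C] {f g : F.SuperPower I →ₐ[ℚ] C}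
    (h : ∀ i a, f (F.inj i a) = g (F.inj i a)) : f = g := by
  ext x
  induction x using inj_induction with
  | hone => rw [map_one, map_one]
  | hinj i a x hx => rw [map_mul, map_mul, h, hx]
  | hadd x y hx hy => rw [map_add, map_add, hx, hy]
  | hsmul r x hx => rw [map_smul, map_smul, hx]

variable (F) in
theorem pullHom_comp {K : Type*} [Fintype K] [LinearOrder K] (ψ : J → K) (φ : I → J) :
    (F.pullHom ψ).comp (F.pullHom φ) = F.pullHom (ψ ∘ φ) :=
  algHom_ext fun i a => by simp

theorem pullHom_pullHom {K : Type*} [Fintype K] [LinearOrder K] (ψ : J → K) (φ : I → J)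
    (x : F.SuperPower I) : F.pullHom ψ (F.pullHom φ x) = F.pullHom (ψ ∘ φ) x := by
  rw [← pullHom_comp]; rfl

theorem pullHom_id (x : F.SuperPower I) : F.pullHom id x = x := by
  have : F.pullHom (id : I → I) = AlgHom.id ℚ _ := algHom_ext fun i a => by simp
  rw [this]; rfl

theorem pullHom_surjective {φ : I → J} (hφ : Function.Surjective φ) :
    Function.Surjective (F.pullHom φ) := fun y => by
  obtain ⟨s, hs⟩ := hφ.hasRightInverse
  exact ⟨F.pullHom s y, by rw [pullHom_pullHom, hs.comp_eq_id, pullHom_id]⟩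

theorem pullHom_mem_superPart (φ : I → J) {p : ZMod 2} {x : F.SuperPower I}
    (hx : x ∈ F.superPart I p) : F.pullHom φ x ∈ F.superPart J p := by
  induction hx using superPart_induction with
  | hzero => simp
  | hadd x x' _ _ h h' => rw [map_add]; exact add_mem h h'
  | hsmul r x _ h => rw [map_smul]; exact Submodule.smul_mem _ _ h
  | hom q a ha hq =>
    rw [pureTensor_eq_sort_prod ha, map_list_prod, List.map_map, ← hq]
    have : ∑ i, q i = ((Finset.univ.sort (fun x y : I => x ≤ y)).map q).sum := by
      rw [← List.sum_toFinset _ (Finset.sort_nodup _ _), Finset.sort_toFinset]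
    rw [this]
    induction Finset.univ.sort (fun x y : I => x ≤ y) with
    | nil => simpa using one_mem_superPart
    | cons i l ih =>
      simpa using mul_mem_superPart (inj_mem_superPart (i := φ i) (ha i)) ih

/-! ### The integral of `A^{⊗ I}` -/

variable (F) in
/-- The integral, as a linear form on the algebra `A^{⊗ I}`. -/
def superIntegral (I : Type*) [Fintype I] [LinearOrder I] : F.SuperPower I →ₗ[ℚ] ℚ :=
  F.tensorIntegral ∘ₗ (F.toSuper I).symm.toLinearMap

theorem superIntegral_pureTensor (a : I → A) :
    F.superIntegral I (F.pureTensor I a) = ∏ i, F.integral (a i) := by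
  refine (PiTensorProduct.lift.tprod _).trans ?_
  simp

theorem superIntegral_of_mem_superPart_one {x : F.SuperPower I} (hx : x ∈ F.superPart I 1) :
    F.superIntegral I x = 0 := by
  induction hx using superPart_induction with
  | hzero => simp
  | hadd x x' _ _ h h' => rw [map_add, h, h', add_zero]
  | hsmul r x _ h => rw [map_smul, h, smul_zero]
  | hom q a ha hq =>
    rw [superIntegral_pureTensor]
    obtain ⟨i, hi⟩ : ∃ i, q i ≠ 0 := by
      by_contra! h
      simp [h] at hq
    refine Finset.prod_eq_zero (Finset.mem_univ i) (integral_of_mem_parityPart_one ?_)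
    rw [← (zmod_two_cases (q i)).resolve_left hi]
    exact ha i

/-- The integral of a product with one element of each factor does not depend on the order of the
factors: where the order matters there is an odd element, and its integral vanishes. -/
theorem superIntegral_list_prod (φ : I → J) {p : I → ZMod 2} {a : I → A} {l : List I}
    (ha : ∀ i, a i ∈ F.parityPart (p i)) (hl : (l.map φ).Nodup) (hl' : ∀ j, j ∈ l.map φ) :
    F.superIntegral J (l.map fun i => F.inj (φ i) (a i)).prod =
      (l.map fun i => F.integral (a i)).prod := by
  have h : ∀ j, F.integral ((l.filter fun i => φ i = j).map a).prod =
      ((l.filter fun i => φ i = j).map fun i => F.integral (a i)).prod := fun j => by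
    obtain ⟨i, -, -, hi⟩ := exists_filter_eq_singleton hl (hl' j)
    simp [hi]
  rw [list_prod_inj φ ha, map_smul, superIntegral_pureTensor]
  simp only [h]
  rw [list_prod_fiberwise]
  by_cases hp : ∀ i ∈ l, p i = 0
  · rw [listSign_of_even φ l hp, one_smul]
  · push Not at hp
    obtain ⟨i, hi, hpi⟩ := hp
    have h0 : F.integral (a i) = 0 := integral_of_mem_parityPart_one
      ((zmod_two_cases (p i)).resolve_left hpi ▸ ha i)
    rw [List.prod_eq_zero (List.mem_map.2 ⟨i, hi, h0⟩), smul_zero]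

theorem eq_of_superIntegral_mul {x x' : F.SuperPower I}
    (h : ∀ y, F.superIntegral I (x * y) = F.superIntegral I (x' * y)) : x = x' :=
  F.pairing_injective (I := I) (LinearMap.ext h)

end Order

/-! ### The adjoint maps `φ_*` -/

section Push

variable {I J K : Type*} [Fintype I] [LinearOrder I] [Fintype J] [LinearOrder J]
  [Fintype K] [LinearOrder K]

variable (F) in
/-- The map `φ_*` as a linear map between the algebras `A^{⊗ J}` and `A^{⊗ I}`. -/
def pushLinear (φ : I → J) : F.SuperPower J →ₗ[ℚ] F.SuperPower I :=
  (F.toSuper I).toLinearMap ∘ₗ F.push φ ∘ₗ (F.toSuper J).symm.toLinearMap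

theorem superIntegral_pushLinear_mul (φ : I → J) (x : F.SuperPower J) (y : F.SuperPower I) :
    F.superIntegral I (F.pushLinear φ x * y) = F.superIntegral J (x * F.pullHom φ y) :=
  F.pairing_push φ x y

/-- The adjoint property characterises `φ_*`. -/
theorem pushLinear_eq {φ : I → J} {x : F.SuperPower J} {z : F.SuperPower I}
    (h : ∀ y, F.superIntegral I (z * y) = F.superIntegral J (x * F.pullHom φ y)) :
    F.pushLinear φ x = z :=
  eq_of_superIntegral_mul fun y => by rw [superIntegral_pushLinear_mul, h]

/-- The projection formula. -/
theorem pushLinear_mul (φ : I → J) (x : F.SuperPower J) (y : F.SuperPower I) :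
    F.pushLinear φ x * y = F.pushLinear φ (x * F.pullHom φ y) :=
  (pushLinear_eq fun z => by
    rw [mul_assoc, superIntegral_pushLinear_mul, map_mul (F.pullHom φ), mul_assoc]).symm

theorem pushLinear_pushLinear (φ : I → J) (ψ : J → K) (x : F.SuperPower K) :
    F.pushLinear φ (F.pushLinear ψ x) = F.pushLinear (ψ ∘ φ) x :=
  (pushLinear_eq fun z => by
    rw [superIntegral_pushLinear_mul, superIntegral_pushLinear_mul, pullHom_pullHom]).symm

theorem pushLinear_id (x : F.SuperPower I) : F.pushLinear id x = x :=
  pushLinear_eq fun z => by rw [pullHom_id]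

theorem superPower_eq_add (p : ZMod 2) (x : F.SuperPower I) :
    ∃ y ∈ F.superPart I p, ∃ z ∈ F.superPart I (p + 1), x = y + z := by
  induction x using superPower_induction with
  | hom q x hx =>
    rcases zmod_two_cases (q - p) with h | h
    · obtain rfl := sub_eq_zero.1 h
      exact ⟨x, hx, 0, zero_mem _, (add_zero x).symm⟩
    · obtain rfl := sub_eq_iff_eq_add'.1 h
      exact ⟨0, zero_mem _, x, hx, (zero_add x).symm⟩
  | hadd x x' hx hx' =>
    obtain ⟨y, hy, z, hz, rfl⟩ := hx
    obtain ⟨y', hy', z', hz', rfl⟩ := hx'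
    exact ⟨y + y', add_mem hy hy', z + z', add_mem hz hz', by abel⟩

theorem superIntegral_mul_eq_zero {p q : ZMod 2} (hpq : p + q = 1) {x y : F.SuperPower I}
    (hx : x ∈ F.superPart I p) (hy : y ∈ F.superPart I q) : F.superIntegral I (x * y) = 0 :=
  superIntegral_of_mem_superPart_one (hpq ▸ mul_mem_superPart hx hy)

/-- As the integral is even, `φ_*` preserves the parity. -/
theorem pushLinear_mem_superPart (φ : I → J) {p : ZMod 2} {x : F.SuperPower J}
    (hx : x ∈ F.superPart J p) : F.pushLinear φ x ∈ F.superPart I p := by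
  obtain ⟨y, hy, z, hz, h⟩ := superPower_eq_add p (F.pushLinear φ x)
  suffices z = 0 by rwa [h, this, add_zero]
  have h2 : (1 + 1 : ZMod 2) = 0 := by decide
  refine eq_of_superIntegral_mul fun t => ?_
  rw [zero_mul, map_zero]
  obtain ⟨t₀, ht₀, t₁, ht₁, rfl⟩ := superPower_eq_add p t
  have hp : p + p = 0 := by rw [← two_mul]; simp [show (2 : ZMod 2) = 0 by decide]
  have e1 : p + 1 + p = 1 := by rw [add_right_comm, hp, zero_add]
  have e2 : p + (p + 1) = 1 := by rw [← add_assoc, hp, zero_add]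
  have h3 := superIntegral_pushLinear_mul φ x t₁
  rw [h, add_mul, map_add, superIntegral_mul_eq_zero e2 hy ht₁,
    superIntegral_mul_eq_zero e2 hx (pullHom_mem_superPart φ ht₁), zero_add] at h3
  rw [mul_add, map_add, superIntegral_mul_eq_zero e1 hz ht₀, h3, add_zero]

/-- The projection formula on the other side; it has no sign, as `φ_*` is even. -/
theorem mul_pushLinear (φ : I → J) (y : F.SuperPower I) (x : F.SuperPower J) :
    y * F.pushLinear φ x = F.pushLinear φ (F.pullHom φ y * x) := by
  induction x using superPower_induction with
  | hadd x x' hx hx' => rw [map_add, mul_add, hx, hx', mul_add, map_add]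
  | hom p x hx =>
  induction y using superPower_induction with
  | hadd y y' hy hy' => rw [add_mul, hy, hy', map_add, add_mul, map_add]
  | hom q y hy =>
  rw [mul_comm_of_mem_superPart hy (pushLinear_mem_superPart φ hx), pushLinear_mul,
    mul_comm_of_mem_superPart (pullHom_mem_superPart φ hy) hx, map_smul]

theorem superIntegral_pullHom {φ : I → J} (hφ : Function.Bijective φ) (x : F.SuperPower I) :
    F.superIntegral J (F.pullHom φ x) = F.superIntegral I x := by
  induction x using pure_induction with
  | hadd x y hx hy => simp only [map_add, hx, hy]
  | hsmul r x hx => simp only [map_smul, hx]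
  | hom p a ha =>
    have h : ∀ j, j ∈ (Finset.univ.sort (fun x y : I => x ≤ y)).map φ := fun j => by
      simpa using hφ.2 j
    rw [superIntegral_pureTensor]
    refine (congrArg _ (pullLinear_pureTensor φ ha)).trans ?_
    rw [superIntegral_list_prod φ ha ((Finset.sort_nodup _ _).map hφ.1) h,
      ← List.prod_toFinset _ (Finset.sort_nodup _ _), Finset.sort_toFinset]

theorem pushLinear_one_of_bijective {φ : I → J} (hφ : Function.Bijective φ) :
    F.pushLinear φ 1 = 1 :=
  pushLinear_eq fun y => by rw [one_mul, one_mul, superIntegral_pullHom hφ]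

theorem pushLinear_pullHom {φ : I → J} (hφ : Function.Bijective φ) (x : F.SuperPower I) :
    F.pushLinear φ (F.pullHom φ x) = x := by
  have := pushLinear_mul (F := F) φ 1 x
  rwa [pushLinear_one_of_bijective hφ, one_mul, one_mul, eq_comm] at this

theorem pullHom_pushLinear {φ : I → J} (hφ : Function.Bijective φ) (x : F.SuperPower J) :
    F.pullHom φ (F.pushLinear φ x) = x := by
  obtain ⟨y, rfl⟩ := pullHom_surjective hφ.2 x
  rw [pushLinear_pullHom hφ]

/-! ### The Euler class and the classes of the diagonals -/

variable (F) in
/-- The element `Δ_*(1) ∈ A ⊗ A`. -/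
def copairing : F.SuperPower (Fin 2) := F.pushLinear (fun _ : Fin 2 => (0 : Fin 1)) 1

variable (F) in
/-- The element `Δ_*(1)`, put into the factors of `A^{⊗ I}` with indices `i` and `j`. -/
def diagClass (i j : I) : F.SuperPower I := F.pullHom ![i, j] F.copairing

theorem pullHom_diagClass (φ : I → J) (i j : I) :
    F.pullHom φ (F.diagClass i j) = F.diagClass (φ i) (φ j) := by
  rw [diagClass, pullHom_pullHom, diagClass]
  congr 2
  ext x
  fin_cases x <;> rfl

theorem diagClass_mem_superPart (i j : I) : F.diagClass i j ∈ F.superPart I 0 :=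
  pullHom_mem_superPart _ (pushLinear_mem_superPart _ one_mem_superPart)

/-- The identification of `A^{⊗ 1}` with `A` in the definition of the Euler class is inverse to the
inclusion of the only factor. -/
theorem inj_subsingletonEquiv (z : F.SuperPower (Fin 1)) :
    F.inj 0 (PiTensorProduct.subsingletonEquiv (R := ℚ) (s := fun _ : Fin 1 => A) 0
      ((F.toSuper (Fin 1)).symm z)) = z := by
  induction z using pure_induction with
  | hadd x y hx hy => simp only [map_add, hx, hy]
  | hsmul r x hx => simp only [map_smul, hx]
  | hom p a ha =>
    rw [inj_apply]
    congr 1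
    ext i
    obtain rfl := Subsingleton.elim 0 i
    rw [Function.update_self]
    exact PiTensorProduct.subsingletonEquiv_apply_tprod (R := ℚ) (s := fun _ : Fin 1 => A) 0 a

theorem subsingletonEquiv_mem_parityPart {p : ZMod 2} {z : F.SuperPower (Fin 1)}
    (hz : z ∈ F.superPart (Fin 1) p) :
    PiTensorProduct.subsingletonEquiv (R := ℚ) (s := fun _ : Fin 1 => A) 0
      ((F.toSuper (Fin 1)).symm z) ∈ F.parityPart p := by
  induction hz using superPart_induction with
  | hzero => simp
  | hadd x y _ _ hx hy => simp only [map_add]; exact add_mem hx hy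
  | hsmul r x _ hx => simp only [map_smul]; exact Submodule.smul_mem _ _ hx
  | hom q a ha hq =>
    rw [Fin.sum_univ_one] at hq
    have := ha 0
    rw [hq] at this
    convert this
    exact PiTensorProduct.subsingletonEquiv_apply_tprod (R := ℚ) (s := fun _ : Fin 1 => A) 0 a

theorem eulerClass_mem_parityPart : F.eulerClass ∈ F.parityPart 0 :=
  subsingletonEquiv_mem_parityPart (z := F.pullHom (fun _ => 0) F.copairing)
    (pullHom_mem_superPart _ (pushLinear_mem_superPart _ one_mem_superPart))

/-- The restriction of the class of the diagonal to the diagonal is the Euler class. -/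
theorem diagClass_self (i : I) : F.diagClass i i = F.inj i F.eulerClass := by
  have h : F.inj 0 F.eulerClass = F.pullHom (fun _ : Fin 2 => (0 : Fin 1)) F.copairing :=
    inj_subsingletonEquiv _
  have h' := congrArg (F.pullHom fun _ : Fin 1 => i) h
  rw [pullHom_inj, pullHom_pullHom] at h'
  rw [h', diagClass]
  congr 2
  ext x
  fin_cases x <;> rfl

variable (F) in
/-- The element `e^ν` of the algebra `A^{⊗ I}`. -/
def superEulerPow (ν : I → ℕ) : F.SuperPower I := F.toSuper I (F.eulerPow ν)

omit [Fintype I] [LinearOrder I] in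
theorem superEulerPow_eq (ν : I → ℕ) :
    F.superEulerPow ν = F.pureTensor I fun i => F.eulerClass ^ ν i := rfl

theorem eulerClass_pow_mem_parityPart (k : ℕ) : F.eulerClass ^ k ∈ F.parityPart 0 := by
  induction k with
  | zero => simpa using one_mem_parityPart
  | succ k ih => simpa [pow_succ] using mul_mem_parityPart ih eulerClass_mem_parityPart

omit [LinearOrder I] in
theorem superEulerPow_mem_superPart (ν : I → ℕ) : F.superEulerPow ν ∈ F.superPart I 0 := by
  have := pure_mem_superPart (F := F) (q := 0) fun i : I => eulerClass_pow_mem_parityPart (ν i)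
  rwa [show ∑ i : I, (0 : I → ZMod 2) i = 0 from Finset.sum_eq_zero fun _ _ => rfl] at this

theorem superEulerPow_commute (ν : I → ℕ) (x : F.SuperPower I) : Commute (F.superEulerPow ν) x :=
  commute_of_mem_superPart_zero (superEulerPow_mem_superPart ν) x

omit [Fintype I] [LinearOrder I] in
theorem superEulerPow_zero : F.superEulerPow (0 : I → ℕ) = 1 := by
  rw [superEulerPow_eq, superPower_one_def]; simp

theorem superEulerPow_add (ν μ : I → ℕ) :
    F.superEulerPow (ν + μ) = F.superEulerPow ν * F.superEulerPow μ := by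
  simp only [superEulerPow_eq]
  rw [pure_mul_pure (p := 0) (q := 0) (fun _ => eulerClass_pow_mem_parityPart _)
    fun _ => eulerClass_pow_mem_parityPart _, shuffleSign_zero_left, one_smul]
  simp [pow_add]

theorem superEulerPow_single (i : I) : F.superEulerPow (Pi.single i 1) = F.inj i F.eulerClass := by
  rw [superEulerPow_eq, inj_apply]
  congr 1
  ext j
  by_cases h : j = i
  · subst h; simp
  · simp [h]

theorem list_prod_pow {M ι : Type*} [Monoid M] (x : M) (f : ι → ℕ) (l : List ι) :
    (l.map fun i => x ^ f i).prod = x ^ (l.map f).sum := by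
  induction l with
  | nil => simp
  | cons i l ih => simp [ih, pow_add]

theorem pullHom_superEulerPow (φ : I → J) (ν : I → ℕ) :
    F.pullHom φ (F.superEulerPow ν) =
      F.superEulerPow fun j => ∑ i with φ i = j, ν i := by
  refine (pullLinear_pureTensor φ (p := 0) fun _ => eulerClass_pow_mem_parityPart _).trans ?_
  rw [list_prod_inj φ (p := 0) fun _ => eulerClass_pow_mem_parityPart _,
    listSign_of_even (p := (0 : I → ZMod 2)) φ _ fun _ _ => rfl, one_smul, superEulerPow_eq]
  congr 1
  ext j
  rw [← sort_filter, list_prod_pow, ← List.sum_toFinset _ (Finset.sort_nodup _ _),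
    Finset.sort_toFinset]

/-! ### Contraction of an edge -/

/-- The contraction of the two points `i` and `j` to a point, realised on the complement of `j`. -/
def contract {i j : I} (h : i ≠ j) (x : I) : {x : I // x ≠ j} :=
  if hx : x = j then ⟨i, h⟩ else ⟨x, hx⟩

omit [Fintype I] in
theorem contract_left {i j : I} (h : i ≠ j) : contract h i = ⟨i, h⟩ := dif_neg h

omit [Fintype I] in
theorem contract_right {i j : I} (h : i ≠ j) : contract h j = ⟨i, h⟩ := dif_pos rfl

omit [Fintype I] in
theorem contract_of_ne {i j x : I} (h : i ≠ j) (hx : x ≠ j) : contract h x = ⟨x, hx⟩ := dif_neg hx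

/-- The class `φ_*(1)` of the diagonal, for the map `φ` that contracts two points. Both sides have
the same integrals against products of elements of the factors; the factors with other indices
contribute the same integrals to both. -/
theorem pushLinear_contract_one {i j : I} (h : i ≠ j) :
    F.pushLinear (contract h) 1 = F.diagClass i j := by
  refine pushLinear_eq fun y => ?_
  rw [one_mul]
  induction y using pure_induction with
  | hadd x y hx hy => simp only [map_add, mul_add, hx, hy]
  | hsmul r x hx => simp only [map_smul, mul_smul_comm, hx]
  | hom p a ha =>
  -- the list of the other indices
  set t := (Finset.univ.filter fun x : I => x ≠ i ∧ x ≠ j).toList with ht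
  have htn : t.Nodup := Finset.nodup_toList _
  have hmem : ∀ x, x ∈ t ↔ x ≠ i ∧ x ≠ j := fun x => by simp [ht]
  have hnodup : (i :: j :: t).Nodup := by simp [htn, hmem, h]
  have hcover : ∀ x, x ∈ i :: j :: t := fun x => by
    simp only [List.mem_cons, hmem]; tauto
  set w := (t.map fun x => F.inj x (a x)).prod with hw
  set T := (t.map fun x => F.integral (a x)).prod with hT
  -- the factors with other indices split off from the integral
  have key : ∀ u : F.SuperPower (Fin 2), F.superIntegral I (F.pullHom ![i, j] u * w) =
      F.superIntegral (Fin 2) u * T := by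
    intro u
    induction u using pure_induction with
    | hadd x y hx hy => simp only [map_add, add_mul, hx, hy]
    | hsmul r x hx => simp only [map_smul, smul_mul_assoc, hx]
    | hom r b hb =>
      have h1 := superIntegral_list_prod (F := F) (id : I → I)
        (p := Function.update (Function.update p i (r 0)) j (r 1))
        (a := Function.update (Function.update a i (b 0)) j (b 1)) (l := i :: j :: t)
        (fun x => by
          by_cases hx : x = j
          · subst hx; simpa using hb 1
          · by_cases hx' : x = i
            · subst hx'; simpa [hx] using hb 0
            · simpa [hx, hx'] using ha x) (by simpa using hnodup) (by simpa using hcover)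
      simp only [id] at h1
      have h2 : t.map (fun x => F.inj x
          (Function.update (Function.update a i (b 0)) j (b 1) x)) =
          t.map fun x => F.inj x (a x) := List.map_congr_left fun x hx => by
        rw [Function.update_of_ne ((hmem x).1 hx).2, Function.update_of_ne ((hmem x).1 hx).1]
      have h3 : t.map (fun x => F.integral
          (Function.update (Function.update a i (b 0)) j (b 1) x)) =
          t.map fun x => F.integral (a x) := List.map_congr_left fun x hx => by
        rw [Function.update_of_ne ((hmem x).1 hx).2, Function.update_of_ne ((hmem x).1 hx).1]
      simp only [List.map_cons, List.prod_cons, h2, h3, Function.update_self,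
        Function.update_of_ne h] at h1
      rw [superIntegral_pureTensor, Fin.prod_univ_two, pureTensor_eq_sort_prod hb, Fin.sort_univ,
        mul_assoc, ← h1, show List.finRange 2 = [0, 1] from rfl]
      simp [mul_assoc, hw]
  -- the factors `i` and `j` are moved to the front
  have hP := pureTensor_eq_list_prod ha hnodup hcover
  rw [← inv_smul_eq_iff₀ (listSign_ne_zero _ _ _)] at hP
  simp only [List.map_cons, List.prod_cons] at hP
  rw [← hP]
  simp only [map_smul, mul_smul_comm]
  congr 1
  have hu : F.inj i (a i) * (F.inj j (a j) * w) =
      F.pullHom ![i, j] (F.inj 0 (a i) * F.inj 1 (a j)) * w := by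
    simp [mul_assoc]
  rw [hu, diagClass, ← mul_assoc, ← map_mul, key, copairing, superIntegral_pushLinear_mul, one_mul]
  have h1 := superIntegral_list_prod (F := F) (contract h)
    (p := Function.update p i (p i + p j)) (a := Function.update a i (a i * a j)) (l := i :: t)
    (fun x => by
      by_cases hx : x = i
      · subst hx; simpa using mul_mem_parityPart (ha x) (ha j)
      · simpa [hx] using ha x) (by
        rw [List.nodup_map_iff_inj_on (by simp [htn, hmem])]
        intro x hx y hy hxy
        have hx' : x ≠ j := by
          rcases List.mem_cons.1 hx with rfl | hx
          exacts [h, ((hmem x).1 hx).2]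
        have hy' : y ≠ j := by
          rcases List.mem_cons.1 hy with rfl | hy
          exacts [h, ((hmem y).1 hy).2]
        rw [contract_of_ne h hx', contract_of_ne h hy'] at hxy
        simpa using hxy) (fun x => by
          refine List.mem_map.2 ⟨x, ?_, contract_of_ne h x.2⟩
          have := hcover x
          simp only [List.mem_cons] at this ⊢
          have := x.2
          tauto)
  have h2 : t.map (fun x => F.inj (contract h x) (Function.update a i (a i * a j) x)) =
      t.map fun x => F.inj (contract h x) (a x) := List.map_congr_left fun x hx => by
    rw [Function.update_of_ne ((hmem x).1 hx).1]
  have h3 : t.map (fun x => F.integral (Function.update a i (a i * a j) x)) =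
      t.map fun x => F.integral (a x) := List.map_congr_left fun x hx => by
    rw [Function.update_of_ne ((hmem x).1 hx).1]
  simp only [List.map_cons, List.prod_cons, h2, h3, Function.update_self] at h1
  have h4 : F.pullHom (contract h) (F.pullHom ![i, j] (F.inj 0 (a i) * F.inj 1 (a j)) * w) =
      F.inj (contract h i) (a i * a j) * (t.map fun x => F.inj (contract h x) (a x)).prod := by
    simp [hw, map_list_prod, List.map_map, Function.comp_def, contract_left, contract_right]
  have h5 : F.superIntegral (Fin 1) (F.pullHom (fun _ : Fin 2 => (0 : Fin 1))
      (F.inj 0 (a i) * F.inj 1 (a j))) = F.integral (a i * a j) := by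
    rw [map_mul (F.pullHom _), pullHom_inj, pullHom_inj, ← map_mul (F.inj 0), inj_apply,
      superIntegral_pureTensor]
    simp
  rw [h4, h1, h5]

end Push

/-! ### Products of diagonal classes along a graph, and base change -/

section Graph

universe u
variable {L : Type*} [Fintype L] [LinearOrder L]

/-- The number of elements of the fibre of `f` over `y`. -/
def fiberCard {X Y : Type*} (f : X → Y) (y : Y) : ℕ := Nat.card {x // f x = y}

theorem fiberCard_eq {X Y : Type*} [Fintype X] [DecidableEq Y] (f : X → Y) (y : Y) :
    fiberCard f y = (Finset.univ.filter fun x => f x = y).card := by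
  rw [fiberCard, Nat.card_eq_fintype_card, Fintype.card_subtype]

theorem fiberCard_comp {X Y Z : Type*} {φ : X → Y} (hφ : Function.Bijective φ) (f : Y → Z)
    (z : Z) : fiberCard (fun x => f (φ x)) z = fiberCard f z :=
  Nat.card_congr ((Equiv.ofBijective φ hφ).subtypeEquiv fun _ => Iff.rfl)

theorem sum_fiberCard {X Y Z : Type*} [Finite X] [Fintype Y] [DecidableEq Z] (f : X → Y)
    (φ : Y → Z) (z : Z) :
    ∑ y with φ y = z, fiberCard f y = fiberCard (fun x => φ (f x)) z := by
  classical
  have := Fintype.ofFinite X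
  simp only [fiberCard_eq]
  rw [Finset.card_eq_sum_card_fiberwise (f := f) (t := Finset.univ.filter fun y => φ y = z)
    (fun x hx => by simpa using hx)]
  refine Finset.sum_congr rfl fun y hy => ?_
  congr 1
  ext x
  simp only [Finset.mem_filter, Finset.mem_univ, true_and] at hy ⊢
  constructor
  · rintro rfl; exact ⟨hy, rfl⟩
  · exact fun h => h.2

omit [Fintype L] in
theorem card_filter_contract {K : Type u} [Fintype K] [LinearOrder K] (q : K → L) (k' : K) (l : L) :
    (Finset.univ.filter fun x : {x : K // x ≠ k'} => q x = l).card + (if q k' = l then 1 else 0) =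
      (Finset.univ.filter fun x : K => q x = l).card := by
  have h : (Finset.univ.filter fun x : {x : K // x ≠ k'} => q x = l).map
      (Function.Embedding.subtype _) = (Finset.univ.filter fun x : K => q x = l).erase k' := by
    ext x
    simp [and_comm]
  rw [← Finset.card_map (Function.Embedding.subtype _), h]
  split_ifs with h'
  · exact Finset.card_erase_add_one (by simpa using h')
  · rw [Finset.erase_eq_of_notMem (by simpa using h'), add_zero]

theorem eqvGen_lift {X Y : Type*} {r : X → X → Prop} {s : Y → Y → Prop} (f : X → Y)
    (h : ∀ x y, r x y → Relation.EqvGen s (f x) (f y)) {x y : X} (hxy : Relation.EqvGen r x y) :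
    Relation.EqvGen s (f x) (f y) := by
  induction hxy with
  | rel x y hr => exact h x y hr
  | refl x => exact .refl _
  | symm x y _ ih => exact .symm _ _ ih
  | trans x y z _ _ ih ih' => exact .trans _ _ _ ih ih'

/-- The product of the diagonal classes along the edges of a graph with vertex set `K` is
`q_*(e^ν)`, where `q` is the projection to the set of connected components and `ν` is the first
Betti number of the components. The edges are contracted one after the other; a loop gives a
factor `e`. -/
theorem list_prod_diagClass (m : ℕ) : ∀ {K : Type u} [Fintype K] [LinearOrder K]
    (E : List (K × K)) (_ : E.length = m) (q : K → L) (_ : Function.Surjective q)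
    (_ : ∀ e ∈ E, q e.1 = q e.2)
    (_ : ∀ x y, q x = q y → Relation.EqvGen (fun x y => (x, y) ∈ E) x y),
    ∃ ν : L → ℕ, (∀ l, ν l + (Finset.univ.filter fun k => q k = l).card =
        E.countP (fun e => q e.1 = l) + 1) ∧
      (E.map fun e => F.diagClass e.1 e.2).prod = F.pushLinear q (F.superEulerPow ν) := by
  induction m with
  | zero =>
    intro K _ _ E hE q hq _ h2
    obtain rfl := List.length_eq_zero_iff.1 hE
    have hinj : Function.Injective q := fun x y hxy => by
      have h := eqvGen_lift (s := Eq) id (fun x y h => absurd h List.not_mem_nil) (h2 x y hxy)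
      exact eq_equivalence.eqvGen_iff.1 h
    refine ⟨0, fun l => ?_, ?_⟩
    · obtain ⟨k, rfl⟩ := hq l
      simp [hinj.eq_iff, Finset.filter_eq']
    · rw [superEulerPow_zero, pushLinear_one_of_bijective ⟨hinj, hq⟩]; rfl
  | succ m ih =>
    intro K _ _ E hE q hq h1 h2
    obtain ⟨⟨k, k'⟩, E, rfl⟩ := List.exists_cons_of_length_eq_add_one hE
    have hE' : E.length = m := by simpa using hE
    have hk : q k = q k' := h1 (k, k') (by simp)
    by_cases hkk : k = k'
    · subst hkk
      obtain ⟨ν, hν, hprod⟩ := ih E hE' q hq (fun e he => h1 e (List.mem_cons_of_mem _ he))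
        fun x y hxy => eqvGen_lift id (fun x y h => by
          rcases List.mem_cons.1 h with h | h
          · obtain ⟨rfl, rfl⟩ := Prod.mk.inj h
            exact .refl _
          · exact .rel _ _ h) (h2 x y hxy)
      refine ⟨ν + Pi.single (q k) 1, fun l => ?_, ?_⟩
      · rw [List.countP_cons, Pi.add_apply, add_right_comm, hν, Pi.single_apply]
        simp only [decide_eq_true_eq, eq_comm (a := l)]
        ring
      · rw [List.map_cons, List.prod_cons, hprod, superEulerPow_add, superEulerPow_single,
          diagClass_self, ← pullHom_inj q, ← pushLinear_mul, ← diagClass_self]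
        exact commute_of_mem_superPart_zero (diagClass_mem_superPart k k) _
    · have hc : ∀ x, q (contract hkk x) = q x := fun x => by
        by_cases hx : x = k'
        · subst hx; rw [contract_right, hk]
        · rw [contract_of_ne hkk hx]
      obtain ⟨ν, hν, hprod⟩ := ih (E.map (Prod.map (contract hkk) (contract hkk)))
        (by simpa using hE') (fun x => q x) (fun l => by
          obtain ⟨x, rfl⟩ := hq l
          exact ⟨contract hkk x, hc x⟩) (by
          simp only [List.mem_map, forall_exists_index, and_imp]
          rintro _ e he rfl
          simp only [Prod.map_fst, Prod.map_snd, hc]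
          exact h1 e (List.mem_cons_of_mem _ he)) (fun x y hxy => by
          have := eqvGen_lift
            (s := fun x y => (x, y) ∈ E.map (Prod.map (contract hkk) (contract hkk)))
            (contract hkk) (fun x y h => by
              rcases List.mem_cons.1 h with h | h
              · obtain ⟨rfl, rfl⟩ := Prod.mk.inj h
                rw [contract_left, contract_right]
                exact .refl _
              · exact .rel _ _ (List.mem_map.2 ⟨_, h, rfl⟩)) (h2 x y hxy)
          rwa [contract_of_ne hkk x.2, contract_of_ne hkk y.2] at this)
      refine ⟨ν, fun l => ?_, ?_⟩
      · rw [← card_filter_contract q k', ← add_assoc, hν, List.countP_cons, List.countP_map]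
        simp only [Function.comp_def, Prod.map_fst, hc, hk, decide_eq_true_eq]
        ring
      · rw [List.map_cons, List.prod_cons, ← pushLinear_contract_one hkk, pushLinear_mul, one_mul,
          map_list_prod, List.map_map]
        simp only [Function.comp_def, pullHom_diagClass]
        rw [List.map_map] at hprod
        simp only [Function.comp_def, Prod.map_fst, Prod.map_snd] at hprod
        rw [hprod, pushLinear_pushLinear]
        simp only [Function.comp_def, hc]

variable {I J K : Type*} [Fintype I] [LinearOrder I] [Fintype J] [LinearOrder J]
  [Fintype K] [LinearOrder K]

/-- Base change for a pushout square of finite sets with `I → J` and `K → L` surjective: the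
pull back of a push forward, corrected by the Euler class. -/
theorem base_change (α : I → J) (β : I → K) (α' : J → L) (β' : K → L)
    (hα : Function.Surjective α) (hβ' : Function.Surjective β')
    (comm : ∀ i, α' (α i) = β' (β i))
    (pushout : ∀ k k', β' k = β' k' →
      Relation.EqvGen (fun x y => ∃ i i', α i = α i' ∧ β i = x ∧ β i' = y) k k') :
    ∃ ν : L → ℕ,
      (∀ l, ν l + fiberCard β' l + fiberCard α' l = fiberCard (fun i => α' (α i)) l + 1) ∧
      ∀ x : F.SuperPower J, F.pullHom β (F.pushLinear α x) =
        F.pushLinear β' (F.pullHom α' x * F.superEulerPow ν) := by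
  obtain ⟨s, hs⟩ := hα.hasRightInverse
  -- the edges of a forest whose components are the fibres of `α`
  set t := (Finset.univ.filter fun i => i ≠ s (α i)).toList with ht
  have hcount : ∀ P : I → Prop, ∀ [DecidablePred P], t.countP (fun i => P i) =
      (Finset.univ.filter fun i => i ≠ s (α i) ∧ P i).card := by
    intro P _
    rw [List.countP_eq_length_filter, ← List.toFinset_card_of_nodup
      ((Finset.nodup_toList _).filter _)]
    congr 1
    ext i
    simp
  have hone : F.pushLinear α 1 = (t.map fun i => F.diagClass i (s (α i))).prod := by
    obtain ⟨ν, hν, hprod⟩ := list_prod_diagClass (F := F) _ (t.map fun i => (i, s (α i))) rfl α hα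
      (by simp [hs.eq]) (fun x y hxy => by
        have : ∀ x, Relation.EqvGen (fun x y => (x, y) ∈ t.map fun i => (i, s (α i))) x
            (s (α x)) := fun x => by
          by_cases hx : x = s (α x)
          · rw [← hx]; exact .refl _
          · exact .rel _ _ (List.mem_map.2 ⟨x, by simpa [ht] using hx, rfl⟩)
        exact .trans _ _ _ (this x) (.symm _ _ (hxy ▸ this y)))
    -- every fibre of `α` is a tree, with one edge for each point other than the chosen one
    have hν0 : ν = 0 := by
      ext j
      have h1 := hν j
      rw [List.countP_map] at h1
      have h2 := hcount fun i => α i = j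
      simp only [Function.comp_def] at h1
      have h3 : (Finset.univ.filter fun i => i ≠ s (α i) ∧ α i = j) =
          (Finset.univ.filter fun i => α i = j).erase (s j) := by
        ext i
        simp only [Finset.mem_filter, Finset.mem_univ, true_and, Finset.mem_erase]
        constructor
        · rintro ⟨h, rfl⟩; exact ⟨h, rfl⟩
        · rintro ⟨h, rfl⟩; exact ⟨h, rfl⟩
      have h4 := Finset.card_erase_add_one (s := Finset.univ.filter fun i => α i = j) (a := s j)
        (by simp [hs.eq])
      rw [h3] at h2
      simp only [Pi.zero_apply]
      lia
    rw [hν0, superEulerPow_zero, List.map_map] at hprod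
    exact hprod.symm
  -- the image of the forest in `K`, a graph whose components are the fibres of `β'`
  obtain ⟨ν, hν, hprod⟩ := list_prod_diagClass (F := F) _ (t.map fun i => (β i, β (s (α i)))) rfl
    β' hβ' (by simp [← comm, hs.eq]) (fun x y hxy => by
      have h1 : ∀ i, Relation.EqvGen (fun x y => (x, y) ∈ t.map fun i => (β i, β (s (α i))))
          (β i) (β (s (α i))) := fun i => by
        by_cases hi : i = s (α i)
        · rw [← hi]; exact .refl _
        · exact .rel _ _ (List.mem_map.2 ⟨i, by simpa [ht] using hi, rfl⟩)
      refine eqvGen_lift id ?_ (pushout x y hxy)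
      rintro _ _ ⟨i, i', hii, rfl, rfl⟩
      exact .trans _ _ _ (h1 i) (.symm _ _ (hii ▸ h1 i')))
  refine ⟨ν, fun l => ?_, fun x => ?_⟩
  · rw [fiberCard_eq, fiberCard_eq, fiberCard_eq, hν, List.countP_map]
    have h2 := hcount fun i => β' (β i) = l
    have h3 : (Finset.univ.filter fun j => α' j = l).card =
        (Finset.univ.filter fun i => i = s (α i) ∧ β' (β i) = l).card := by
      refine Finset.card_bij (fun j _ => s j) ?_ ?_ ?_
      · intro j hj
        simpa [hs.eq, ← comm] using hj
      · intro j _ j' _ h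
        exact hs.injective h
      · intro i hi
        simp only [Finset.mem_filter, Finset.mem_univ, true_and] at hi
        exact ⟨α i, by simpa [comm] using hi.2, hi.1.symm⟩
    have h4 := Finset.card_filter_add_card_filter_not
      (s := Finset.univ.filter fun i => β' (β i) = l) fun i => i = s (α i)
    simp only [Finset.filter_filter, and_comm] at h4 h2 h3
    simp only [Function.comp_def, comm]
    lia
  · obtain ⟨y, rfl⟩ := pullHom_surjective hα x
    have h1 := pushLinear_mul (F := F) α 1 y
    rw [one_mul] at h1
    have h2 : α' ∘ α = β' ∘ β := funext comm
    rw [← h1, hone, map_mul, map_list_prod, List.map_map]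
    simp only [Function.comp_def, pullHom_diagClass]
    rw [List.map_map] at hprod
    simp only [Function.comp_def] at hprod
    rw [hprod, pushLinear_mul, pullHom_pullHom, pullHom_pullHom, h2,
      (superEulerPow_commute ν _).eq]

end Graph

end GradedFrobeniusAlgebra

/-! ### Cycles of a permutation: parity and genus -/

section Genus

variable {X : Type*} [Fintype X] [DecidableEq X]

/-- The sign of a permutation is determined by the number of its cycles, fixed points included;
these are the elements of `Q`. -/
theorem sign_eq_neg_one_pow_card_add_card {Q : Type*} [Fintype Q] (π : Equiv.Perm X) {c : X → Q}
    (hc : Function.Surjective c) (hcπ : ∀ x y, c x = c y ↔ π.SameCycle x y) :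
    Equiv.Perm.sign π = (-1) ^ (Fintype.card X + Fintype.card Q) := by
  classical
  -- fixed points and cycles of length at least two, as disjoint summands
  let f : X → Equiv.Perm X ⊕ X := fun x => if π x = x then .inr x else .inl (π.cycleOf x)
  have hf : ∀ x y, f x = f y ↔ c x = c y := by
    intro x y
    rw [hcπ]
    constructor
    · intro h
      by_cases hx : π x = x <;> by_cases hy : π y = y <;>
        simp only [f, hx, hy, if_true, if_false, Sum.inr.injEq, Sum.inl.injEq, reduceCtorEq] at h
      · rw [h]
      · have hy' : y ∈ (π.cycleOf x).support := by
          rw [h, Equiv.Perm.mem_support_cycleOf_iff]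
          exact ⟨.refl _ _, by simpa using hy⟩
        exact (Equiv.Perm.mem_support_cycleOf_iff.1 hy').1
    · intro h
      have hfix : π x = x ↔ π y = y := h.apply_eq_self_iff
      by_cases hx : π x = x
      · have : x = y := h.eq_of_left hx
        rw [this]
      · have hy : π y ≠ y := fun hy => hx (hfix.2 hy)
        simp [f, hx, hy, h.cycleOf_eq]
  have himage : Finset.univ.image f = π.cycleFactorsFinset.disjSum π.supportᶜ := by
    ext z
    simp only [Finset.mem_image, Finset.mem_univ, true_and, Finset.mem_disjSum]
    constructor
    · rintro ⟨x, rfl⟩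
      by_cases hx : π x = x
      · right; exact ⟨x, by simpa using hx, by simp [f, hx]⟩
      · left
        exact ⟨π.cycleOf x, Equiv.Perm.cycleOf_mem_cycleFactorsFinset_iff.2 (by simpa using hx),
          by simp [f, hx]⟩
    · rintro (⟨σ, hσ, rfl⟩ | ⟨x, hx, rfl⟩)
      · obtain ⟨x, hx⟩ := (Equiv.Perm.mem_cycleFactorsFinset_iff.1 hσ).1.nonempty_support
        have h1 := Equiv.Perm.cycle_is_cycleOf hx hσ
        have h2 : π x ≠ x := by
          simpa using Equiv.Perm.mem_cycleFactorsFinset_support_le hσ hx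
        exact ⟨x, by simp [f, h2, h1]⟩
      · exact ⟨x, by simpa [f] using hx⟩
  have hcard : Fintype.card Q = (Finset.univ.image f).card := by
    rw [← Finset.card_univ]
    refine Finset.card_bij (fun q _ => f (hc q).choose) (by simp) ?_ ?_
    · intro q _ q' _ h
      rw [hf, (hc q).choose_spec, (hc q').choose_spec] at h
      exact h
    · intro z hz
      obtain ⟨x, -, rfl⟩ := Finset.mem_image.1 hz
      exact ⟨c x, Finset.mem_univ _, (hf _ _).2 (hc (c x)).choose_spec⟩
  have hsupp : π.support.card ≤ Fintype.card X := Finset.card_le_univ _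
  rw [Equiv.Perm.sign_of_cycleType, Equiv.Perm.sum_cycleType, Equiv.Perm.cycleType_def,
    Multiset.card_map, hcard, himage, Finset.card_disjSum, Finset.card_compl]
  obtain ⟨k, hk⟩ := Nat.exists_eq_add_of_le hsupp
  rw [hk, Nat.add_sub_cancel_left]
  change (-1 : ℤˣ) ^ (_ + π.cycleFactorsFinset.card) = _
  rw [show π.support.card + k + (π.cycleFactorsFinset.card + k) =
    π.support.card + π.cycleFactorsFinset.card + 2 * k by ring, pow_add _ _ (2 * k), pow_mul]
  simp

/-- The map `f ↦ f ∘ π - f` on functions; its rank is the number of points minus the number of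
cycles. -/
def permDiff (π : Equiv.Perm X) : (X → ℚ) →ₗ[ℚ] (X → ℚ) := LinearMap.funLeft ℚ ℚ π - 1

omit [Fintype X] [DecidableEq X] in
theorem permDiff_apply (π : Equiv.Perm X) (f : X → ℚ) (x : X) :
    permDiff π f x = f (π x) - f x := rfl

omit [DecidableEq X] in
/-- The kernel of `permDiff π` consists of the functions that are constant on the cycles. -/
theorem finrank_range_permDiff {Q : Type*} [Fintype Q] (π : Equiv.Perm X) {c : X → Q}
    (hc : Function.Surjective c) (hcπ : ∀ x y, c x = c y ↔ π.SameCycle x y) :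
    Module.finrank ℚ (LinearMap.range (permDiff π)) + Fintype.card Q = Fintype.card X := by
  have h1 : LinearMap.ker (permDiff π) = LinearMap.range (LinearMap.funLeft ℚ ℚ c) := by
    ext f
    rw [LinearMap.mem_ker, LinearMap.mem_range]
    constructor
    · intro h
      have hπ : ∀ x, f (π x) = f x := fun x => by
        have := congrFun h x
        rw [permDiff_apply] at this
        exact sub_eq_zero.1 this
      have hcyc : ∀ x y, π.SameCycle x y → f x = f y := by
        rintro x _ ⟨i, rfl⟩
        induction i with
        | zero => simp
        | succ i ih => rw [add_comm, zpow_add, zpow_one, Equiv.Perm.mul_apply, hπ]; exact ih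
        | pred i ih =>
          rw [ih, ← hπ ((π ^ (-(i : ℤ) - 1)) x), ← Equiv.Perm.mul_apply, ← zpow_one_add]
          congr 3; ring
      refine ⟨fun q => f (hc q).choose, funext fun x => hcyc _ _ ?_⟩
      exact (hcπ _ _).1 (hc (c x)).choose_spec
    · rintro ⟨g, rfl⟩
      ext x
      rw [permDiff_apply]
      have : c (π x) = c x := (hcπ _ _).2 (Equiv.Perm.sameCycle_apply_left.2 (.refl _ _))
      simp [LinearMap.funLeft_apply, this]
  have h2 := LinearMap.finrank_range_add_finrank_ker (permDiff π)
  rwa [h1, LinearMap.finrank_range_of_inj (LinearMap.funLeft_injective_of_surjective ℚ ℚ c hc),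
    Module.finrank_fintype_fun_eq_card, Module.finrank_fintype_fun_eq_card] at h2

/-- Scott's lemma for a transitive pair of permutations: the space of functions maps to the sum of
the ranges of `permDiff` for `π`, `ρ` and `π * ρ` with kernel of dimension at most one, this sum
maps to the space of functions with image of codimension at most one, and the composition
vanishes. -/
theorem two_mul_card_le_finrank_permDiff [Nonempty X] (π ρ : Equiv.Perm X)
    (hconn : ∀ r : X → X → Prop, Equivalence r → (∀ x, r x (π x)) → (∀ x, r x (ρ x)) →
      ∀ x y, r x y) :
    2 * Fintype.card X ≤ Module.finrank ℚ (LinearMap.range (permDiff π)) +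
      (Module.finrank ℚ (LinearMap.range (permDiff ρ)) +
        Module.finrank ℚ (LinearMap.range (permDiff (π * ρ)))) + 2 := by
  obtain ⟨x₀⟩ := ‹Nonempty X›
  let β := (permDiff π).rangeRestrict.prod
    ((permDiff ρ).rangeRestrict.prod (permDiff (π * ρ)).rangeRestrict)
  -- `β` and `γ` compose to zero because of `f ∘ (πρ) - f = (f ∘ π - f) ∘ ρ + (f ∘ ρ - f)`
  let γ := (LinearMap.funLeft ℚ ℚ ρ ∘ₗ (LinearMap.range (permDiff π)).subtype).coprod
    ((LinearMap.range (permDiff ρ)).subtype.coprod (-(LinearMap.range (permDiff (π * ρ))).subtype))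
  have hγβ : LinearMap.range β ≤ LinearMap.ker γ := by
    rintro _ ⟨f, rfl⟩
    rw [LinearMap.mem_ker]
    ext x
    change permDiff π f (ρ x) + (permDiff ρ f x + -permDiff (π * ρ) f x) = 0
    simp only [permDiff_apply, Equiv.Perm.mul_apply]
    ring
  have hker : Module.finrank ℚ (LinearMap.ker β) ≤ 1 := by
    refine (Submodule.finrank_mono (t := ℚ ∙ (1 : X → ℚ)) ?_).trans
      (finrank_span_singleton one_ne_zero).le
    intro f hf
    have hf' : permDiff π f = 0 ∧ permDiff ρ f = 0 := by
      have := LinearMap.mem_ker.1 hf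
      exact ⟨congrArg (fun z => (z.1 : X → ℚ)) this, congrArg (fun z => (z.2.1 : X → ℚ)) this⟩
    have hconst := hconn (fun x y => f x = f y) ⟨fun _ => rfl, Eq.symm, Eq.trans⟩
      (fun x => (sub_eq_zero.1 (congrFun hf'.1 x)).symm)
      (fun x => (sub_eq_zero.1 (congrFun hf'.2 x)).symm)
    refine Submodule.mem_span_singleton.2 ⟨f x₀, funext fun x => ?_⟩
    simp [hconst x x₀]
  have hsup : LinearMap.range γ ⊔ ℚ ∙ (Pi.single x₀ 1 : X → ℚ) = ⊤ := by
    have hρ : ∀ f, permDiff ρ f ∈ LinearMap.range γ := fun f =>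
      ⟨(0, ⟨permDiff ρ f, LinearMap.mem_range_self _ _⟩, 0), by simp [γ]⟩
    have hπ : ∀ f, permDiff π f ∈ LinearMap.range γ := fun f => by
      have h1 : LinearMap.funLeft ℚ ℚ ρ (permDiff π f) ∈ LinearMap.range γ :=
        ⟨(⟨permDiff π f, LinearMap.mem_range_self _ _⟩, 0, 0), by simp [γ]⟩
      have h2 := sub_mem h1 (hρ (permDiff π f))
      have h3 : LinearMap.funLeft ℚ ℚ ρ (permDiff π f) - permDiff ρ (permDiff π f) =
          permDiff π f := by
        ext x
        simp [permDiff_apply, LinearMap.funLeft_apply]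
      rwa [h3] at h2
    have hsingle : ∀ (σ : Equiv.Perm X) (x : X), permDiff σ (Pi.single (σ x) 1) =
        Pi.single x 1 - Pi.single (σ x) 1 := fun σ x => by
      ext y
      simp [permDiff_apply, Pi.single_apply]
    have hall := hconn
      (fun x y => (Pi.single x 1 - Pi.single y 1 : X → ℚ) ∈ LinearMap.range γ)
      ⟨fun x => by simp, fun h => by simpa using neg_mem h, fun h h' => by simpa using add_mem h h'⟩
      (fun x => hsingle π x ▸ hπ _) (fun x => hsingle ρ x ▸ hρ _)
    refine eq_top_iff.2 fun f _ => ?_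
    have hf : f = ∑ x, f x • (Pi.single x 1 : X → ℚ) := by
      ext y
      simp [Finset.sum_apply, Pi.single_apply]
    rw [hf]
    refine Submodule.sum_mem _ fun x _ => Submodule.smul_mem _ _ ?_
    rw [← sub_add_cancel (Pi.single x 1 : X → ℚ) (Pi.single x₀ 1)]
    exact add_mem (Submodule.mem_sup_left (hall x x₀))
      (Submodule.mem_sup_right (Submodule.mem_span_singleton_self _))
  have hrange : Fintype.card X ≤ Module.finrank ℚ (LinearMap.range γ) + 1 := by
    have h1 := Submodule.finrank_add_le_finrank_add_finrank (LinearMap.range γ)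
      (ℚ ∙ (Pi.single x₀ 1 : X → ℚ))
    rw [hsup, finrank_top, Module.finrank_fintype_fun_eq_card] at h1
    have h2 : Module.finrank ℚ (ℚ ∙ (Pi.single x₀ 1 : X → ℚ)) = 1 :=
      finrank_span_singleton (by simp)
    lia
  have h1 := LinearMap.finrank_range_add_finrank_ker β
  have h2 := LinearMap.finrank_range_add_finrank_ker γ
  have h3 := Submodule.finrank_mono hγβ
  rw [Module.finrank_fintype_fun_eq_card] at h1
  rw [Module.finrank_prod, Module.finrank_prod] at h2
  lia

/-- The genus of a transitive pair of permutations is a non-negative integer: it is an integer by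
the multiplicativity of the sign, and non-negative by Scott's lemma. Transitivity is expressed
through invariant equivalence relations. -/
theorem exists_genus [Nonempty X] (π ρ : Equiv.Perm X)
    (hconn : ∀ r : X → X → Prop, Equivalence r → (∀ x, r x (π x)) → (∀ x, r x (ρ x)) →
      ∀ x y, r x y)
    {Q₁ Q₂ Q₃ : Type*} [Fintype Q₁] [Fintype Q₂] [Fintype Q₃] {c₁ : X → Q₁} {c₂ : X → Q₂}
    {c₃ : X → Q₃} (h₁ : Function.Surjective c₁) (h₂ : Function.Surjective c₂)
    (h₃ : Function.Surjective c₃) (hc₁ : ∀ x y, c₁ x = c₁ y ↔ π.SameCycle x y)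
    (hc₂ : ∀ x y, c₂ x = c₂ y ↔ ρ.SameCycle x y)
    (hc₃ : ∀ x y, c₃ x = c₃ y ↔ (π * ρ).SameCycle x y) :
    ∃ k, 2 * k + Fintype.card Q₁ + Fintype.card Q₂ + Fintype.card Q₃ = Fintype.card X + 2 := by
  have hle := two_mul_card_le_finrank_permDiff π ρ hconn
  have r₁ := finrank_range_permDiff π h₁ hc₁
  have r₂ := finrank_range_permDiff ρ h₂ hc₂
  have r₃ := finrank_range_permDiff (π * ρ) h₃ hc₃
  have hs := map_mul Equiv.Perm.sign π ρ
  rw [sign_eq_neg_one_pow_card_add_card π h₁ hc₁, sign_eq_neg_one_pow_card_add_card ρ h₂ hc₂,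
    sign_eq_neg_one_pow_card_add_card (π * ρ) h₃ hc₃, ← pow_add] at hs
  have heven : Even (Fintype.card X + Fintype.card Q₃ + (Fintype.card X + Fintype.card Q₁ +
      (Fintype.card X + Fintype.card Q₂))) := by
    by_contra h
    rw [Nat.not_even_iff_odd] at h
    have h1 := h.neg_one_pow (α := ℤ)
    have h2 : ((-1 : ℤˣ) ^ (Fintype.card X + Fintype.card Q₃ + (Fintype.card X + Fintype.card Q₁ +
      (Fintype.card X + Fintype.card Q₂)))) = 1 := by
      rw [pow_add, hs, ← pow_add, ← two_mul, pow_mul]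
      simp
    have h3 := congrArg (fun u : ℤˣ => (u : ℤ)) h2
    simp only [Units.val_pow_eq_pow_val, Units.val_neg, Units.val_one] at h3
    rw [h1] at h3
    norm_num at h3
  obtain ⟨m, hm⟩ := heven
  refine ⟨(Fintype.card X + 2 - Fintype.card Q₁ - Fintype.card Q₂ - Fintype.card Q₃) / 2, ?_⟩
  lia

end Genus

/-! ### Orbit spaces and the graph defect -/

section Orbits

namespace OrbitSpace

open GradedFrobeniusAlgebra (fiberCard fiberCard_eq fiberCard_comp sum_fiberCard)

variable {n : ℕ}

theorem mk_zpowers_apply (π : Equiv.Perm (Fin n)) (x : Fin n) :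
    mk (Subgroup.zpowers π) (π x) = mk _ x :=
  mk_eq_mk.2 ⟨π, Subgroup.mem_zpowers π, rfl⟩

theorem mk_apply_of_mem {H : Subgroup (Equiv.Perm (Fin n))} {g : Equiv.Perm (Fin n)} (hg : g ∈ H)
    (x : Fin n) : mk H (g x) = mk H x :=
  mk_eq_mk.2 ⟨g, hg, rfl⟩

theorem mk_zpowers_eq_iff {π : Equiv.Perm (Fin n)} {x y : Fin n} :
    mk (Subgroup.zpowers π) x = mk _ y ↔ π.SameCycle x y := by
  rw [mk_eq_mk]
  constructor
  · rintro ⟨_, ⟨i, rfl⟩, h⟩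
    exact Equiv.Perm.SameCycle.symm ⟨i, h⟩
  · intro h
    obtain ⟨i, hi⟩ := h.symm
    exact ⟨π ^ i, ⟨i, rfl⟩, hi⟩

/-- The orbits of the subgroup generated by a set are the classes of the equivalence relation
generated by the action of the set. -/
theorem rel_of_mk_closure_eq {S : Set (Equiv.Perm (Fin n))} {r : Fin n → Fin n → Prop}
    (hr : Equivalence r) (hS : ∀ s ∈ S, ∀ x, r x (s x)) {x y : Fin n}
    (h : mk (Subgroup.closure S) x = mk _ y) : r x y := by
  obtain ⟨g, hg, rfl⟩ := mk_eq_mk.1 h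
  refine hr.symm ?_
  clear h
  induction hg using Subgroup.closure_induction generalizing y with
  | mem s hs => exact hS s hs y
  | one => exact hr.refl y
  | mul g h _ _ ihg ihh => exact hr.trans (ihh (y := y)) (ihg (y := h y))
  | inv g _ ih => simpa using hr.symm (ih (y := g⁻¹ y))

variable {L : Type*} [Fintype L] [LinearOrder L]

/-- The maps `f_1`, `f_2`, `f_3` from the sets of cycles of `π`, `ρ` and `τ = π ρ` to a set `L`
that `p` identifies with the set of orbits of `⟨π, ρ⟩`, together with the graph defect `ν`. -/
structure Model (π ρ τ : Equiv.Perm (Fin n)) (p : Fin n → L) (f₁ : cyc π → L) (f₂ : cyc ρ → L)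
    (f₃ : cyc τ → L) : Prop where
  mul_eq : π * ρ = τ
  surjective : Function.Surjective p
  fiber : ∀ x y, p x = p y ↔ mk (Subgroup.closure {π, ρ}) x = mk _ y
  left : ∀ x, f₁ (mk _ x) = p x
  right : ∀ x, f₂ (mk _ x) = p x
  mul : ∀ x, f₃ (mk _ x) = p x

/-- `ν` is the graph defect of `π` and `ρ` as a function on `L`. -/
def IsDefect {π ρ τ : Equiv.Perm (Fin n)} (p : Fin n → L) (f₁ : cyc π → L) (f₂ : cyc ρ → L)
    (f₃ : cyc τ → L) (ν : L → ℕ) : Prop :=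
  ∀ l, 2 * ν l + fiberCard f₁ l + fiberCard f₂ l + fiberCard f₃ l = fiberCard p l + 2

variable {π ρ τ : Equiv.Perm (Fin n)} {p : Fin n → L} {f₁ : cyc π → L} {f₂ : cyc ρ → L}
  {f₃ : cyc τ → L}

omit [Fintype L] in
theorem Model.exists_isDefect (h : Model π ρ τ p f₁ f₂ f₃) :
    ∃ ν : L → ℕ, IsDefect p f₁ f₂ f₃ ν := by
  suffices ∀ l, ∃ k, 2 * k + fiberCard f₁ l + fiberCard f₂ l + fiberCard f₃ l =
      fiberCard p l + 2 from ⟨_, fun l => (this l).choose_spec⟩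
  intro l
  obtain rfl := h.mul_eq
  have hπ : ∀ x, p (π x) = p x := fun x => by rw [← h.left, mk_zpowers_apply, h.left]
  have hρ : ∀ x, p (ρ x) = p x := fun x => by rw [← h.right, mk_zpowers_apply, h.right]
  have : Nonempty {x // p x = l} := by
    obtain ⟨x, hx⟩ := h.surjective l
    exact ⟨⟨x, hx⟩⟩
  -- the restrictions of the permutations to the orbit
  let π' : Equiv.Perm {x // p x = l} := π.subtypePerm fun x => by rw [hπ]
  let ρ' : Equiv.Perm {x // p x = l} := ρ.subtypePerm fun x => by rw [hρ]
  have hsame : ∀ (σ : Equiv.Perm (Fin n)) (hσ : ∀ x, p (σ x) = l ↔ p x = l)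
      (x y : {x // p x = l}), OrbitSpace.mk (Subgroup.zpowers σ) x.1 = OrbitSpace.mk _ y.1 ↔
        (σ.subtypePerm hσ).SameCycle x y := fun σ hσ x y => by
    rw [mk_zpowers_eq_iff, Equiv.Perm.sameCycle_subtypePerm]
  have hsurj : ∀ (σ : Equiv.Perm (Fin n)) (f : cyc σ → L) (hf : ∀ x, f (OrbitSpace.mk _ x) = p x),
      Function.Surjective fun x : {x // p x = l} =>
        (⟨OrbitSpace.mk _ x.1, (hf _).trans x.2⟩ : {C : cyc σ // f C = l}) := by
    rintro σ f hf ⟨C, hC⟩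
    obtain ⟨x, rfl⟩ := mk_surjective _ C
    exact ⟨⟨x, (hf x).symm.trans hC⟩, rfl⟩
  obtain ⟨k, hk⟩ := exists_genus π' ρ' (fun r hr h1 h2 x y => by
      have := rel_of_mk_closure_eq (S := {π, ρ})
        (r := fun x y => p x = p y ∧ ∀ (hx : p x = l) (hy : p y = l), r ⟨x, hx⟩ ⟨y, hy⟩)
        ⟨fun x => ⟨rfl, fun _ _ => hr.refl _⟩,
          fun h => ⟨h.1.symm, fun hx hy => hr.symm (h.2 hy hx)⟩,
          fun h h' => ⟨h.1.trans h'.1, fun hx hy =>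
            hr.trans (h.2 hx (h.1.symm.trans hx)) (h'.2 (h.1.symm.trans hx) hy)⟩⟩
        (by
          rintro s (rfl | rfl) x
          · exact ⟨(hπ x).symm, fun hx _ => h1 ⟨x, hx⟩⟩
          · exact ⟨(hρ x).symm, fun hx _ => h2 ⟨x, hx⟩⟩)
        ((h.fiber x.1 y.1).1 (x.2.trans y.2.symm))
      exact this.2 x.2 y.2)
    (hsurj π f₁ h.left) (hsurj ρ f₂ h.right) (hsurj (π * ρ) f₃ h.mul)
    (fun x y => by rw [Subtype.mk.injEq]; exact hsame π _ x y)
    (fun x y => by rw [Subtype.mk.injEq]; exact hsame ρ _ x y)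
    (fun x y => by
      rw [Subtype.mk.injEq]
      exact hsame (π * ρ) (fun x => by rw [Equiv.Perm.mul_apply, hπ, hρ]) x y)
  refine ⟨k, ?_⟩
  simpa only [fiberCard, Nat.card_eq_fintype_card] using hk

theorem proj_mk {H K : Subgroup (Equiv.Perm (Fin n))} (h : H ≤ K) (x : Fin n) :
    proj h (mk H x) = mk K x := rfl

theorem proj_surjective {H K : Subgroup (Equiv.Perm (Fin n))} (h : H ≤ K) :
    Function.Surjective (proj h) := fun C => by
  obtain ⟨x, rfl⟩ := mk_surjective _ C
  exact ⟨mk H x, rfl⟩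

theorem proj_proj {H K M : Subgroup (Equiv.Perm (Fin n))} (h : H ≤ K) (h' : K ≤ M)
    (C : OrbitSpace H) : proj h' (proj h C) = proj (h.trans h') C := by
  obtain ⟨x, rfl⟩ := mk_surjective _ C
  rfl

theorem conj_mk (σ π : Equiv.Perm (Fin n)) (x : Fin n) :
    conj σ π (mk _ x) = mk _ (σ x) := rfl

theorem conj_bijective (σ π : Equiv.Perm (Fin n)) : Function.Bijective (conj σ π) := by
  constructor
  · intro C D h
    obtain ⟨x, rfl⟩ := mk_surjective _ C
    obtain ⟨y, rfl⟩ := mk_surjective _ D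
    rw [conj_mk, conj_mk, mk_zpowers_eq_iff, Equiv.Perm.sameCycle_conj] at h
    rw [mk_zpowers_eq_iff]
    simpa using h
  · intro C
    obtain ⟨x, rfl⟩ := mk_surjective _ C
    exact ⟨mk _ (σ⁻¹ x), by rw [conj_mk]; simp⟩

/-- The map on an orbit space induced by an invariant map `p`; the value is that of `p` at the
smallest element of the orbit. -/
def desc {H : Subgroup (Equiv.Perm (Fin n))} (p : Fin n → L) (C : OrbitSpace H) : L := p C.minElt

omit [Fintype L] [LinearOrder L] in
theorem desc_mk {H : Subgroup (Equiv.Perm (Fin n))} {p : Fin n → L}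
    (h : ∀ x y, mk H x = mk H y → p x = p y) (x : Fin n) : desc p (mk H x) = p x :=
  h _ _ (mk_minElt _)

section Model

variable {π ρ τ : Equiv.Perm (Fin n)} {p : Fin n → L} {f₁ : cyc π → L} {f₂ : cyc ρ → L}
  {f₃ : cyc τ → L} {ν : L → ℕ}

omit [LinearOrder L] in
/-- Summation of the equation for the graph defect over the fibre of a map `φ` to a coarser set of
orbits. -/
theorem IsDefect.sum (hν : IsDefect p f₁ f₂ f₃ ν) {M : Type*} [LinearOrder M] (φ : L → M)
    {q : Fin n → M} (hq : ∀ x, φ (p x) = q x) {g₁ : cyc π → M} (h₁ : ∀ C, φ (f₁ C) = g₁ C)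
    {g₂ : cyc ρ → M} (h₂ : ∀ C, φ (f₂ C) = g₂ C) {g₃ : cyc τ → M} (h₃ : ∀ C, φ (f₃ C) = g₃ C)
    (m : M) :
    2 * (∑ l with φ l = m, ν l) + fiberCard g₁ m + fiberCard g₂ m + fiberCard g₃ m =
      fiberCard q m + 2 * fiberCard φ m := by
  obtain rfl : (fun x => φ (p x)) = q := funext hq
  obtain rfl : (fun C => φ (f₁ C)) = g₁ := funext h₁
  obtain rfl : (fun C => φ (f₂ C)) = g₂ := funext h₂
  obtain rfl : (fun C => φ (f₃ C)) = g₃ := funext h₃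
  rw [← sum_fiberCard p, ← sum_fiberCard f₁, ← sum_fiberCard f₂, ← sum_fiberCard f₃,
    fiberCard_eq φ, Finset.mul_sum, ← Finset.sum_add_distrib, ← Finset.sum_add_distrib,
    ← Finset.sum_add_distrib, Finset.card_eq_sum_ones, Finset.mul_sum, ← Finset.sum_add_distrib]
  exact Finset.sum_congr rfl fun l _ => hν l

variable (π ρ) in
theorem Model.canonical : Model π ρ (π * ρ) (OrbitSpace.mk (Subgroup.closure {π, ρ}))
    (proj (le_left π ρ)) (proj (le_right π ρ)) (proj (le_mul π ρ)) :=
  ⟨rfl, mk_surjective _, fun _ _ => Iff.rfl, fun _ => rfl, fun _ => rfl, fun _ => rfl⟩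

omit [Fintype L] [LinearOrder L] in
theorem Model.desc_bijective (h : Model π ρ τ p f₁ f₂ f₃) :
    Function.Bijective (desc p : gen π ρ → L) := by
  have hmk : ∀ x, desc p (OrbitSpace.mk (Subgroup.closure {π, ρ}) x) = p x :=
    desc_mk fun x y hxy => (h.fiber x y).2 hxy
  constructor
  · intro C D hCD
    obtain ⟨x, rfl⟩ := mk_surjective _ C
    obtain ⟨y, rfl⟩ := mk_surjective _ D
    rw [hmk, hmk] at hCD
    exact (h.fiber x y).1 hCD
  · intro l
    obtain ⟨x, rfl⟩ := h.surjective l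
    exact ⟨_, hmk x⟩

omit [Fintype L] [LinearOrder L] in
/-- The exponents in the definition of the product are the graph defect of the model. -/
theorem floor_graphDefect {f₃ : cyc (π * ρ) → L} (h : Model π ρ (π * ρ) p f₁ f₂ f₃)
    (hν : IsDefect p f₁ f₂ f₃ ν) (B : gen π ρ) : ⌊graphDefect π ρ B⌋₊ = ν (desc p B) := by
  have hmk : ∀ x, desc p (OrbitSpace.mk (Subgroup.closure {π, ρ}) x) = p x :=
    desc_mk fun x y hxy => (h.fiber x y).2 hxy
  have key : ∀ {X : Type} (u : X → gen π ρ) (v : X → L) (_ : ∀ x, v x = desc p (u x)),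
      Nat.card {x // u x = B} = fiberCard v (desc p B) := by
    intro X u v huv
    simp only [fiberCard, huv, h.desc_bijective.1.eq_iff]
  have hf : ∀ (ω : Equiv.Perm (Fin n)) (hω : Subgroup.zpowers ω ≤ Subgroup.closure {π, ρ})
      (f : cyc ω → L) (_ : ∀ x, f (OrbitSpace.mk _ x) = p x) (C : cyc ω),
      f C = desc p (proj hω C) := by
    intro ω hω f hf C
    obtain ⟨x, rfl⟩ := mk_surjective _ C
    rw [hf, proj_mk, hmk]
  have h4 := hν (desc p B)
  have : graphDefect π ρ B = ν (desc p B) := by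
    rw [graphDefect, key _ p (fun x => (hmk x).symm), key _ f₁ (hf π _ f₁ h.left),
      key _ f₂ (hf ρ _ f₂ h.right), key _ f₃ (hf (π * ρ) _ f₃ h.mul)]
    have h5 := congrArg (Nat.cast : ℕ → ℚ) h4
    push_cast at h5
    linarith
  rw [this, Nat.floor_natCast]

end Model

end OrbitSpace

end Orbits

namespace GradedFrobeniusAlgebra

open OrbitSpace

variable {A : Type*} [Ring A] [Algebra ℚ A] {d : ℕ} {F : GradedFrobeniusAlgebra d A} {n : ℕ}

/-! ### The product of `A{S_n}` -/

variable (F) in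
/-- The element `a π` of `A{S_n}`, for `a` in the algebra `A^{⊗ ⟨π⟩ \ [n]}`. -/
def superTerm (π : Equiv.Perm (Fin n)) : F.SuperPower (cyc π) →ₗ[ℚ] F.SymAlg n :=
  F.term π ∘ₗ (F.toSuper _).symm.toLinearMap

theorem superTerm_toSuper (π : Equiv.Perm (Fin n)) (a : F.TensorPower (cyc π)) :
    F.superTerm π (F.toSuper _ a) = F.term π a := rfl

theorem symAlg_induction {P : F.SymAlg n → Prop} (hzero : P 0)
    (hterm : ∀ π a, P (F.superTerm π a)) (hadd : ∀ x y, P x → P y → P (x + y))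
    (x : F.SymAlg n) : P x := by
  induction x using DirectSum.induction_on with
  | zero => exact hzero
  | of π a =>
    exact hterm π (F.toSuper _ a)
  | add x y hx hy => exact hadd x y hx hy

theorem symAlg_add_mul (x y z : F.SymAlg n) : (x + y) * z = x * z + y * z :=
  LinearMap.map_add₂ (F.symMul n) x y z

theorem symAlg_mul_add (x y z : F.SymAlg n) : x * (y + z) = x * y + x * z :=
  LinearMap.map_add (F.symMul n x) y z

theorem symAlg_zero_mul (x : F.SymAlg n) : 0 * x = 0 := LinearMap.map_zero₂ (F.symMul n) x

theorem symAlg_mul_zero (x : F.SymAlg n) : x * 0 = 0 := LinearMap.map_zero (F.symMul n x)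

theorem symMul_term (π : Equiv.Perm (Fin n)) (a : F.TensorPower (cyc π)) :
    F.symMul n (F.term π a) =
      (DirectSum.toModule ℚ (Equiv.Perm (Fin n))
      (F.TensorPower (OrbitSpace.cyc π) →ₗ[ℚ] F.SymAlg n) fun ρ =>
        ((F.termMul π ρ).compr₂ (F.term (π * ρ))).flip).flip a := by
  rw [symMul, term]
  erw [DirectSum.toModule_lof]
  rfl

theorem term_mul_term (π ρ : Equiv.Perm (Fin n)) (a : F.TensorPower (cyc π))
    (b : F.TensorPower (cyc ρ)) :
    F.term π a * F.term ρ b = F.term (π * ρ) (F.termMul π ρ a b) := by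
  have h : F.term π a * F.term ρ b = (DirectSum.toModule ℚ (Equiv.Perm (Fin n))
      (F.TensorPower (OrbitSpace.cyc π) →ₗ[ℚ] F.SymAlg n) fun ρ =>
        ((F.termMul π ρ).compr₂ (F.term (π * ρ))).flip) (F.term ρ b) a :=
    LinearMap.congr_fun (symMul_term π a) (F.term ρ b)
  rw [h, term]
  erw [DirectSum.toModule_lof]
  rfl
section Model

variable {L : Type*} [Fintype L] [LinearOrder L] {π ρ τ : Equiv.Perm (Fin n)} {p : Fin n → L}
  {f₁ : cyc π → L} {f₂ : cyc ρ → L} {f₃ : cyc τ → L} {ν : L → ℕ}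

/-- The product of `A{S_n}`, computed with any model of the set of orbits of `⟨π, ρ⟩`. -/
theorem superTerm_mul_superTerm (h : Model π ρ τ p f₁ f₂ f₃) (hν : IsDefect p f₁ f₂ f₃ ν)
    (a : F.SuperPower (cyc π)) (b : F.SuperPower (cyc ρ)) :
    F.superTerm π a * F.superTerm ρ b = F.superTerm τ
      (F.pushLinear f₃ (F.pullHom f₁ a * F.pullHom f₂ b * F.superEulerPow ν)) := by
  obtain rfl := h.mul_eq
  have hmk : ∀ x, desc p (OrbitSpace.mk (Subgroup.closure {π, ρ}) x) = p x :=
    desc_mk fun x y hxy => (h.fiber x y).2 hxy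
  have hf : ∀ (ω : Equiv.Perm (Fin n)) (hω : Subgroup.zpowers ω ≤ Subgroup.closure {π, ρ})
      (f : cyc ω → L) (_ : ∀ x, f (OrbitSpace.mk _ x) = p x), f = desc p ∘ proj hω := by
    intro ω hω f hf
    ext C
    obtain ⟨x, rfl⟩ := mk_surjective _ C
    rw [hf, Function.comp_apply, proj_mk, hmk]
  have hbij := h.desc_bijective
  have he : F.superEulerPow ν = F.pullHom (desc p : gen π ρ → L)
      (F.superEulerPow fun B => ⌊graphDefect π ρ B⌋₊) := by
    rw [pullHom_superEulerPow]
    congr 1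
    ext l
    obtain ⟨B, rfl⟩ := hbij.2 l
    simp only [hbij.1.eq_iff, Finset.sum_filter, Finset.sum_ite_eq', Finset.mem_univ, if_true,
      floor_graphDefect h hν]
  rw [he, hf π (le_left π ρ) f₁ h.left, hf ρ (le_right π ρ) f₂ h.right,
    hf (π * ρ) (le_mul π ρ) f₃ h.mul, ← pushLinear_pushLinear, ← pullHom_pullHom,
    ← pullHom_pullHom, ← map_mul, ← map_mul, pushLinear_pullHom hbij]
  exact term_mul_term π ρ _ _

end Model

theorem one_eq_superTerm : (1 : F.SymAlg n) = F.superTerm 1 1 := rfl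

theorem fiberCard_cyc_one {L : Type*} (f : cyc (1 : Equiv.Perm (Fin n)) → L) (l : L) :
    fiberCard f l = fiberCard (fun x => f (OrbitSpace.mk _ x)) l := by
  refine (fiberCard_comp (φ := OrbitSpace.mk (Subgroup.zpowers (1 : Equiv.Perm (Fin n))))
    ⟨fun x y h => ?_, mk_surjective _⟩ f l).symm
  rw [mk_zpowers_eq_iff] at h
  simpa using h

theorem desc_cyc_one {L : Type*} (p : Fin n → L) (x : Fin n) :
    (desc p : cyc (1 : Equiv.Perm (Fin n)) → L) (OrbitSpace.mk _ x) = p x :=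
  desc_mk (fun x y h => by
    rw [mk_zpowers_eq_iff, Equiv.Perm.sameCycle_one] at h
    rw [h]) x

theorem fiberCard_id {L : Type*} (l : L) : fiberCard id l = 1 := by
  simp [fiberCard]

theorem symAlg_one_mul (x : F.SymAlg n) : 1 * x = x := by
  induction x using symAlg_induction with
  | hzero => exact symAlg_mul_zero 1
  | hadd x y hx hy => rw [symAlg_mul_add, hx, hy]
  | hterm ρ b =>
    have h : Model 1 ρ ρ (OrbitSpace.mk (Subgroup.zpowers ρ)) (desc (OrbitSpace.mk _)) id id :=
      ⟨one_mul ρ, mk_surjective _, fun x y => by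
        rw [Subgroup.closure_insert_one, Subgroup.zpowers_eq_closure],
        desc_cyc_one _, fun _ => rfl, fun _ => rfl⟩
    have hν : IsDefect (OrbitSpace.mk (Subgroup.zpowers ρ))
        (desc (OrbitSpace.mk (Subgroup.zpowers ρ)) : cyc 1 → cyc ρ) (id : cyc ρ → cyc ρ)
        (id : cyc ρ → cyc ρ) 0 := fun l => by
      rw [fiberCard_cyc_one, fiberCard_id]
      simp only [desc_cyc_one, Pi.zero_apply]
      ring
    rw [one_eq_superTerm, superTerm_mul_superTerm h hν, superEulerPow_zero, map_one, one_mul,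
      mul_one, pullHom_id, pushLinear_id]

theorem symAlg_mul_one (x : F.SymAlg n) : x * 1 = x := by
  induction x using symAlg_induction with
  | hzero => exact symAlg_zero_mul 1
  | hadd x y hx hy => rw [symAlg_add_mul, hx, hy]
  | hterm ρ b =>
    have h : Model ρ 1 ρ (OrbitSpace.mk (Subgroup.zpowers ρ)) id (desc (OrbitSpace.mk _)) id :=
      ⟨mul_one ρ, mk_surjective _, fun x y => by
        rw [Set.pair_comm, Subgroup.closure_insert_one, Subgroup.zpowers_eq_closure],
        fun _ => rfl, desc_cyc_one _, fun _ => rfl⟩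
    have hν : IsDefect (OrbitSpace.mk (Subgroup.zpowers ρ)) (id : cyc ρ → cyc ρ)
        (desc (OrbitSpace.mk (Subgroup.zpowers ρ)) : cyc 1 → cyc ρ)
        (id : cyc ρ → cyc ρ) 0 := fun l => by
      rw [fiberCard_cyc_one, fiberCard_id]
      simp only [desc_cyc_one, Pi.zero_apply]
      ring
    rw [one_eq_superTerm, superTerm_mul_superTerm h hν, superEulerPow_zero, map_one, mul_one,
      mul_one, pullHom_id, pushLinear_id]

/-! ### Associativity -/

/-- Base change for the orbit spaces of `H ≤ J, K ≤ ⟨S⟩`, where `S` is contained in the union of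
`J` and `K`. -/
theorem base_change_orbitSpace {S : Set (Equiv.Perm (Fin n))}
    {H J K : Subgroup (Equiv.Perm (Fin n))}
    (hJ : H ≤ J) (hK : H ≤ K) (hJS : J ≤ Subgroup.closure S) (hKS : K ≤ Subgroup.closure S)
    (hS : ∀ s ∈ S, s ∈ J ∨ s ∈ K) :
    ∃ κ : OrbitSpace (Subgroup.closure S) → ℕ,
      (∀ l, κ l + fiberCard (proj hKS) l + fiberCard (proj hJS) l =
        fiberCard (proj (hJ.trans hJS)) l + 1) ∧
      ∀ x : F.SuperPower (OrbitSpace J), F.pullHom (proj hK) (F.pushLinear (proj hJ) x) =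
        F.pushLinear (proj hKS) (F.pullHom (proj hJS) x * F.superEulerPow κ) := by
  obtain ⟨κ, hκ, h⟩ := base_change (F := F) (proj hJ) (proj hK) (proj hJS) (proj hKS)
    (proj_surjective _) (proj_surjective _) (fun C => by rw [proj_proj, proj_proj])
    (fun k k' hkk => by
      obtain ⟨x, rfl⟩ := mk_surjective _ k
      obtain ⟨y, rfl⟩ := mk_surjective _ k'
      rw [proj_mk, proj_mk] at hkk
      refine rel_of_mk_closure_eq (r := fun x y => Relation.EqvGen _ (OrbitSpace.mk K x)
        (OrbitSpace.mk K y)) ⟨fun _ => .refl _, .symm _ _, .trans _ _ _⟩ (fun s hs x => ?_) hkk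
      rcases hS s hs with h | h
      · exact .rel _ _ ⟨OrbitSpace.mk H x, OrbitSpace.mk H (s x), (mk_apply_of_mem h x).symm,
          rfl, rfl⟩
      · rw [mk_apply_of_mem h]
        exact .refl _)
  simp only [proj_proj] at hκ
  exact ⟨κ, hκ, h⟩

section Assoc

variable {π ρ σ τ : Equiv.Perm (Fin n)}

/-- A triple product in `A{S_n}` is a push forward from the set of orbits of `⟨π, ρ, σ⟩`, with an
exponent of the Euler class that does not depend on the bracketing. -/
def IsTripleProduct (F : GradedFrobeniusAlgebra d A) (π ρ σ τ : Equiv.Perm (Fin n))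
    (a : F.SuperPower (cyc π)) (b : F.SuperPower (cyc ρ)) (c : F.SuperPower (cyc σ))
    (x : F.SymAlg n) : Prop :=
  ∃ (hπ : Subgroup.zpowers π ≤ Subgroup.closure {π, ρ, σ})
    (hρ : Subgroup.zpowers ρ ≤ Subgroup.closure {π, ρ, σ})
    (hσ : Subgroup.zpowers σ ≤ Subgroup.closure {π, ρ, σ})
    (hτ : Subgroup.zpowers τ ≤ Subgroup.closure {π, ρ, σ})
    (t : OrbitSpace (Subgroup.closure {π, ρ, σ}) → ℕ),
    (∀ l, 2 * t l + fiberCard (proj hπ) l + fiberCard (proj hρ) l + fiberCard (proj hσ) l +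
      fiberCard (proj hτ) l = 2 * fiberCard (OrbitSpace.mk _) l + 2) ∧
    x = F.superTerm τ (F.pushLinear (proj hτ) (F.pullHom (proj hπ) a * F.pullHom (proj hρ) b *
      F.pullHom (proj hσ) c * F.superEulerPow t))

variable {a : F.SuperPower (cyc π)} {b : F.SuperPower (cyc ρ)} {c : F.SuperPower (cyc σ)}

theorem IsTripleProduct.unique {x y : F.SymAlg n} (hx : F.IsTripleProduct π ρ σ τ a b c x)
    (hy : F.IsTripleProduct π ρ σ τ a b c y) : x = y := by
  obtain ⟨_, _, _, _, t, ht, rfl⟩ := hx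
  obtain ⟨_, _, _, _, t', ht', rfl⟩ := hy
  have : t = t' := by
    ext l
    have h1 := ht l
    have h2 := ht' l
    omega
  rw [this]

theorem isTripleProduct_left (a : F.SuperPower (cyc π)) (b : F.SuperPower (cyc ρ))
    (c : F.SuperPower (cyc σ)) : F.IsTripleProduct π ρ σ (π * ρ * σ) a b c
      (F.superTerm π a * F.superTerm ρ b * F.superTerm σ c) := by
  have hm : ∀ {ω}, ω ∈ ({π, ρ, σ} : Set _) → ω ∈ Subgroup.closure {π, ρ, σ} :=
    fun h => Subgroup.subset_closure h
  have hJS : Subgroup.closure {π, ρ} ≤ Subgroup.closure {π, ρ, σ} := by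
    rw [Subgroup.closure_le]
    rintro _ (rfl | rfl)
    exacts [hm (by simp), hm (by simp)]
  have hKS : Subgroup.closure {π * ρ, σ} ≤ Subgroup.closure {π, ρ, σ} := by
    rw [Subgroup.closure_le]
    rintro _ (rfl | rfl)
    exacts [Subgroup.mul_mem _ (hm (by simp)) (hm (by simp)), hm (by simp)]
  obtain ⟨ν, hν⟩ := (Model.canonical π ρ).exists_isDefect
  obtain ⟨μ, hμ⟩ := (Model.canonical (π * ρ) σ).exists_isDefect
  obtain ⟨κ, hκ, hbc⟩ := base_change_orbitSpace (F := F) (S := {π, ρ, σ}) (le_mul π ρ)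
    (le_left (π * ρ) σ) hJS hKS (by
      rintro _ (rfl | rfl | rfl)
      exacts [.inl (Subgroup.subset_closure (by simp)), .inl (Subgroup.subset_closure (by simp)),
        .inr (Subgroup.subset_closure (by simp))])
  refine ⟨(le_left π ρ).trans hJS, (le_right π ρ).trans hJS, (le_right (π * ρ) σ).trans hKS,
    (le_mul (π * ρ) σ).trans hKS, (fun l => ∑ j with proj hJS j = l, ν j) + κ +
      fun l => ∑ k with proj hKS k = l, μ k, fun l => ?_, ?_⟩
  · have h1 := hν.sum (proj hJS) (fun x => proj_mk _ _) (fun C => proj_proj _ _ _)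
      (fun C => proj_proj _ _ _) (fun C => proj_proj _ _ _) l
    have h2 := hμ.sum (proj hKS) (fun x => proj_mk _ _) (fun C => proj_proj _ _ _)
      (fun C => proj_proj _ _ _) (fun C => proj_proj _ _ _) l
    have h3 := hκ l
    simp only [Pi.add_apply]
    omega
  · rw [superTerm_mul_superTerm (Model.canonical π ρ) hν,
      superTerm_mul_superTerm (Model.canonical (π * ρ) σ) hμ, hbc, pushLinear_mul, pushLinear_mul,
      pushLinear_pushLinear]
    have hp : ∀ {H K M : Subgroup (Equiv.Perm (Fin n))} (h : H ≤ K) (h' : K ≤ M),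
        proj h' ∘ proj h = proj (h.trans h') := fun h h' => funext (proj_proj h h')
    simp only [map_mul, pullHom_pullHom, pullHom_superEulerPow, superEulerPow_add, hp]
    -- the powers of the Euler class are central
    have he : ∀ (t : OrbitSpace (Subgroup.closure {π, ρ, σ}) → ℕ) (u v : F.SuperPower _),
        F.superEulerPow t * (u * v) = u * (F.superEulerPow t * v) := fun t u v => by
      rw [← mul_assoc, (superEulerPow_commute t u).eq, mul_assoc]
    simp only [mul_assoc, he _ (F.pullHom _ c)]

theorem isTripleProduct_right (a : F.SuperPower (cyc π)) (b : F.SuperPower (cyc ρ))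
    (c : F.SuperPower (cyc σ)) : F.IsTripleProduct π ρ σ (π * (ρ * σ)) a b c
      (F.superTerm π a * (F.superTerm ρ b * F.superTerm σ c)) := by
  have hm : ∀ {ω}, ω ∈ ({π, ρ, σ} : Set _) → ω ∈ Subgroup.closure {π, ρ, σ} :=
    fun h => Subgroup.subset_closure h
  have hJS : Subgroup.closure {ρ, σ} ≤ Subgroup.closure {π, ρ, σ} := by
    rw [Subgroup.closure_le]
    rintro _ (rfl | rfl)
    exacts [hm (by simp), hm (by simp)]
  have hKS : Subgroup.closure {π, ρ * σ} ≤ Subgroup.closure {π, ρ, σ} := by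
    rw [Subgroup.closure_le]
    rintro _ (rfl | rfl)
    exacts [hm (by simp), Subgroup.mul_mem _ (hm (by simp)) (hm (by simp))]
  obtain ⟨ν, hν⟩ := (Model.canonical ρ σ).exists_isDefect
  obtain ⟨μ, hμ⟩ := (Model.canonical π (ρ * σ)).exists_isDefect
  obtain ⟨κ, hκ, hbc⟩ := base_change_orbitSpace (F := F) (S := {π, ρ, σ}) (le_mul ρ σ)
    (le_right π (ρ * σ)) hJS hKS (by
      rintro _ (rfl | rfl | rfl)
      exacts [.inr (Subgroup.subset_closure (by simp)), .inl (Subgroup.subset_closure (by simp)),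
        .inl (Subgroup.subset_closure (by simp))])
  refine ⟨(le_left π (ρ * σ)).trans hKS, (le_left ρ σ).trans hJS, (le_right ρ σ).trans hJS,
    (le_mul π (ρ * σ)).trans hKS, (fun l => ∑ j with proj hJS j = l, ν j) + κ +
      fun l => ∑ k with proj hKS k = l, μ k, fun l => ?_, ?_⟩
  · have h1 := hν.sum (proj hJS) (fun x => proj_mk _ _) (fun C => proj_proj _ _ _)
      (fun C => proj_proj _ _ _) (fun C => proj_proj _ _ _) l
    have h2 := hμ.sum (proj hKS) (fun x => proj_mk _ _) (fun C => proj_proj _ _ _)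
      (fun C => proj_proj _ _ _) (fun C => proj_proj _ _ _) l
    have h3 := hκ l
    simp only [Pi.add_apply]
    omega
  · rw [superTerm_mul_superTerm (Model.canonical ρ σ) hν,
      superTerm_mul_superTerm (Model.canonical π (ρ * σ)) hμ, hbc, mul_pushLinear, pushLinear_mul,
      pushLinear_pushLinear]
    have hp : ∀ {H K M : Subgroup (Equiv.Perm (Fin n))} (h : H ≤ K) (h' : K ≤ M),
        proj h' ∘ proj h = proj (h.trans h') := fun h h' => funext (proj_proj h h')
    simp only [map_mul, pullHom_pullHom, pullHom_superEulerPow, superEulerPow_add, hp]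
    simp only [mul_assoc]

end Assoc

theorem symAlg_mul_assoc (x y z : F.SymAlg n) : x * y * z = x * (y * z) := by
  induction x using symAlg_induction with
  | hzero => simp only [symAlg_zero_mul]
  | hadd x x' h h' => simp only [symAlg_add_mul, h, h']
  | hterm π a =>
  induction y using symAlg_induction with
  | hzero => simp only [symAlg_zero_mul, symAlg_mul_zero]
  | hadd x x' h h' => simp only [symAlg_add_mul, symAlg_mul_add, h, h']
  | hterm ρ b =>
  induction z using symAlg_induction with
  | hzero => simp only [symAlg_mul_zero]
  | hadd x x' h h' => simp only [symAlg_mul_add, h, h']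
  | hterm σ c =>
  have h := isTripleProduct_right a b c
  rw [← mul_assoc] at h
  exact (isTripleProduct_left a b c).unique h

/-! ### The commutation relation -/

/-- The commutation relation. As `⟨πρπ⁻¹, π⟩ = ⟨π, ρ⟩` and the two projections from the cycles of
`ρ` agree, both sides are the same push forward up to the order of two factors. -/
theorem superTerm_mul_superTerm_comm {π ρ : Equiv.Perm (Fin n)} {p q : ZMod 2}
    {a : F.SuperPower (cyc π)} {b : F.SuperPower (cyc ρ)} (ha : a ∈ F.superPart _ p)
    (hb : b ∈ F.superPart _ q) :
    F.superTerm π a * F.superTerm ρ b =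
      sgn (p * q) • (F.superTerm (π * ρ * π⁻¹) (F.pullHom (conj π ρ) b) * F.superTerm π a) := by
  have hπ : π ∈ Subgroup.closure {π, ρ} := Subgroup.subset_closure (by simp)
  have hρ : ρ ∈ Subgroup.closure {π, ρ} := Subgroup.subset_closure (by simp)
  have hc : Subgroup.zpowers (π * ρ * π⁻¹) ≤ Subgroup.closure {π, ρ} :=
    Subgroup.zpowers_le.2 (Subgroup.mul_mem _ (Subgroup.mul_mem _ hπ hρ) (Subgroup.inv_mem _ hπ))
  have hcl : Subgroup.closure {π * ρ * π⁻¹, π} = Subgroup.closure {π, ρ} := by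
    refine le_antisymm ((Subgroup.closure_le _).2 ?_) ((Subgroup.closure_le _).2 ?_)
    · rintro _ (rfl | rfl)
      exacts [hc (Subgroup.mem_zpowers _), hπ]
    · have h1 : π ∈ Subgroup.closure {π * ρ * π⁻¹, π} := Subgroup.subset_closure (by simp)
      have h2 : π * ρ * π⁻¹ ∈ Subgroup.closure {π * ρ * π⁻¹, π} :=
        Subgroup.subset_closure (by simp)
      rintro _ (rfl | rfl)
      · exact h1
      · simpa [mul_assoc] using
          Subgroup.mul_mem _ (Subgroup.mul_mem _ (Subgroup.inv_mem _ h1) h2) h1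
  have hconj : proj hc ∘ conj π ρ = proj (le_right π ρ) := by
    ext C
    obtain ⟨x, rfl⟩ := mk_surjective _ C
    exact mk_apply_of_mem hπ x
  have h : Model (π * ρ * π⁻¹) π (π * ρ) (OrbitSpace.mk (Subgroup.closure {π, ρ})) (proj hc)
      (proj (le_left π ρ)) (proj (le_mul π ρ)) :=
    ⟨by group, mk_surjective _, fun x y => by rw [hcl], fun _ => rfl, fun _ => rfl, fun _ => rfl⟩
  obtain ⟨ν, hν⟩ := (Model.canonical π ρ).exists_isDefect
  have hν' : IsDefect (OrbitSpace.mk (Subgroup.closure {π, ρ})) (proj hc)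
      (proj (le_left π ρ)) (proj (le_mul π ρ)) ν := fun l => by
    have h1 := hν l
    rw [← hconj] at h1
    have h2 := fiberCard_comp (conj_bijective π ρ) (proj hc) l
    simp only [Function.comp_def] at h1
    omega
  rw [superTerm_mul_superTerm (Model.canonical π ρ) hν, superTerm_mul_superTerm h hν',
    pullHom_pullHom, hconj, mul_comm_of_mem_superPart (pullHom_mem_superPart _ ha)
      (pullHom_mem_superPart _ hb), smul_mul_assoc, map_smul, map_smul]

/-! ### The action of the symmetric group -/

theorem act_term (σ π : Equiv.Perm (Fin n)) (a : F.TensorPower (cyc π)) :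
    F.act σ (F.term π a) = F.term (σ * π * σ⁻¹) (F.conjMap σ π a) := by
  rw [act, term]
  erw [DirectSum.toModule_lof]
  rfl

theorem act_superTerm (σ π : Equiv.Perm (Fin n)) (a : F.SuperPower (cyc π)) :
    F.act σ (F.superTerm π a) = F.superTerm (σ * π * σ⁻¹) (F.pullHom (conj σ π) a) :=
  act_term σ π a

/-- The terms `f^*(a) π` for equal permutations `π` and maps `f` that agree. The types of cycles of
equal permutations are not definitionally equal, so the maps are compared on representatives. -/
theorem superTerm_pullHom_congr {I : Type*} [Fintype I] [LinearOrder I]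
    {π π' : Equiv.Perm (Fin n)} (h : π = π') {f : I → cyc π} {f' : I → cyc π'}
    (hf : ∀ i, ∃ x, f i = OrbitSpace.mk _ x ∧ f' i = OrbitSpace.mk _ x) (a : F.SuperPower I) :
    F.superTerm π (F.pullHom f a) = F.superTerm π' (F.pullHom f' a) := by
  subst h
  have : f = f' := funext fun i => by
    obtain ⟨x, h, h'⟩ := hf i
    rw [h, h']
  rw [this]

theorem act_act (σ τ : Equiv.Perm (Fin n)) (x : F.SymAlg n) :
    F.act σ (F.act τ x) = F.act (σ * τ) x := by
  induction x using symAlg_induction with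
  | hzero => simp only [map_zero]
  | hadd x y hx hy => simp only [map_add, hx, hy]
  | hterm π a =>
    rw [act_superTerm, act_superTerm, act_superTerm, pullHom_pullHom]
    refine superTerm_pullHom_congr (by group) (fun C => ?_) a
    obtain ⟨x, rfl⟩ := mk_surjective _ C
    exact ⟨σ (τ x), rfl, rfl⟩

theorem act_one (σ : Equiv.Perm (Fin n)) : F.act σ 1 = 1 := by
  have h := superTerm_pullHom_congr (F := F) (by group : σ * 1 * σ⁻¹ = 1) (f := conj σ 1)
    (f' := fun C => OrbitSpace.mk _ (σ C.minElt)) (fun C => ⟨σ C.minElt, by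
      rw [← conj_mk, mk_minElt], rfl⟩) 1
  rw [one_eq_superTerm, act_superTerm, h, map_one]

/-- `S_n` acts by automorphisms: the orbits of `⟨π, ρ⟩`, with `x` sent to the orbit of `σ⁻¹ x`,
are a model of those of `⟨σπσ⁻¹, σρσ⁻¹⟩`. -/
theorem act_mul (σ : Equiv.Perm (Fin n)) (x y : F.SymAlg n) :
    F.act σ (x * y) = F.act σ x * F.act σ y := by
  induction x using symAlg_induction with
  | hzero => simp only [symAlg_zero_mul, map_zero]
  | hadd x x' h h' => simp only [symAlg_add_mul, map_add, h, h']
  | hterm π a =>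
  induction y using symAlg_induction with
  | hzero => simp only [symAlg_mul_zero, map_zero]
  | hadd x x' h h' => simp only [symAlg_mul_add, map_add, h, h']
  | hterm ρ b =>
  let G := Subgroup.closure {π, ρ}
  let p : Fin n → gen π ρ := fun x => OrbitSpace.mk G (σ⁻¹ x)
  have hp : ∀ {ω : Equiv.Perm (Fin n)} (_ : Subgroup.zpowers ω ≤ G) (x : Fin n),
      (desc p : cyc (σ * ω * σ⁻¹) → gen π ρ) (OrbitSpace.mk _ x) = p x := fun {ω} hω =>
    desc_mk fun x y hxy => by
      rw [mk_zpowers_eq_iff, Equiv.Perm.sameCycle_conj, ← mk_zpowers_eq_iff] at hxy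
      exact congrArg (proj hω) hxy
  have hd : ∀ {ω : Equiv.Perm (Fin n)} (hω : Subgroup.zpowers ω ≤ G),
      (desc p : cyc (σ * ω * σ⁻¹) → gen π ρ) ∘ conj σ ω = proj hω := fun {ω} hω => by
    ext C
    obtain ⟨x, rfl⟩ := mk_surjective _ C
    rw [Function.comp_apply, conj_mk, hp hω, proj_mk]
    simp [p, G]
  have h : Model (σ * π * σ⁻¹) (σ * ρ * σ⁻¹) (σ * (π * ρ) * σ⁻¹) p (desc p) (desc p)
      (desc p) := by
    refine ⟨by group, fun C => ?_, fun x y => ⟨fun hxy => ?_, fun hxy => ?_⟩, hp (le_left π ρ),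
      hp (le_right π ρ), hp (le_mul π ρ)⟩
    · obtain ⟨x, rfl⟩ := mk_surjective _ C
      exact ⟨σ x, by simp [p, G]⟩
    · have := rel_of_mk_closure_eq (r := fun u v =>
        OrbitSpace.mk (Subgroup.closure {σ * π * σ⁻¹, σ * ρ * σ⁻¹}) (σ u) = OrbitSpace.mk _ (σ v))
        ⟨fun _ => rfl, Eq.symm, Eq.trans⟩ (fun s hs x => by
          have hs' : σ * s * σ⁻¹ ∈ Subgroup.closure {σ * π * σ⁻¹, σ * ρ * σ⁻¹} := by
            rcases hs with rfl | rfl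
            exacts [Subgroup.subset_closure (by simp), Subgroup.subset_closure (by simp)]
          simpa using (mk_apply_of_mem hs' (σ x)).symm) hxy
      simpa using this
    · refine rel_of_mk_closure_eq (r := fun u v => p u = p v) ⟨fun _ => rfl, Eq.symm, Eq.trans⟩
        (fun s hs x => ?_) hxy
      rcases hs with rfl | rfl
      · simpa [p] using (mk_apply_of_mem (H := G) (Subgroup.subset_closure (by simp)) _).symm
      · simpa [p] using (mk_apply_of_mem (H := G) (Subgroup.subset_closure (by simp)) _).symm
  obtain ⟨ν, hν⟩ := (Model.canonical π ρ).exists_isDefect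
  have hν' : IsDefect p (desc p : cyc (σ * π * σ⁻¹) → gen π ρ)
      (desc p : cyc (σ * ρ * σ⁻¹) → gen π ρ) (desc p : cyc (σ * (π * ρ) * σ⁻¹) → gen π ρ) ν := by
    intro l
    have h1 := hν l
    rw [← hd (le_left π ρ), ← hd (le_right π ρ), ← hd (le_mul π ρ)] at h1
    have h2 := fiberCard_comp (conj_bijective σ π) (desc p) l
    have h3 := fiberCard_comp (conj_bijective σ ρ) (desc p) l
    have h4 := fiberCard_comp (conj_bijective σ (π * ρ)) (desc p) l
    have h5 := fiberCard_comp (σ⁻¹).bijective (OrbitSpace.mk (Subgroup.closure {π, ρ})) l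
    simp only [Function.comp_def] at h1
    change 2 * ν l + _ + _ + _ =
      fiberCard (fun x => OrbitSpace.mk (Subgroup.closure {π, ρ}) (σ⁻¹ x)) l + 2
    omega
  rw [superTerm_mul_superTerm (Model.canonical π ρ) hν, act_superTerm, act_superTerm,
    act_superTerm, superTerm_mul_superTerm h hν', pullHom_pullHom, pullHom_pullHom,
    hd (le_left π ρ), hd (le_right π ρ), ← hd (le_mul π ρ), ← pushLinear_pushLinear,
    pullHom_pushLinear (conj_bijective σ (π * ρ))]

theorem mem_invariants {x : F.SymAlg n} : x ∈ F.invariants n ↔ ∀ σ, F.act σ x = x := by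
  simp [invariants, Submodule.mem_iInf]

theorem sum_act_mem_invariants (x : F.SymAlg n) : ∑ σ, F.act σ x ∈ F.invariants n :=
  mem_invariants.2 fun τ => by
    rw [map_sum]
    simp only [act_act]
    exact Fintype.sum_equiv (Equiv.mulLeft τ) _ _ fun _ => rfl

/-! ### The grading -/

theorem iSup_tensorGrade (I : Type*) [Fintype I] : ⨆ p, F.tensorGrade I p = ⊤ := by
  classical
  let _ := F.isInternal.chooseDecomposition
  rw [eq_top_iff, ← PiTensorProduct.span_tprod_eq_top, Submodule.span_le]
  rintro _ ⟨a, rfl⟩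
  have ha : a = fun i => ∑ k ∈ (DirectSum.decompose F.grade (a i)).support,
      (DirectSum.decompose F.grade (a i) k : A) :=
    funext fun i => (DirectSum.sum_support_decompose F.grade (a i)).symm
  rw [ha, MultilinearMap.map_sum_finset]
  exact sum_mem fun k _ => Submodule.mem_iSup_of_mem (∑ i, k i)
    (Submodule.subset_span ⟨k, _, fun i => SetLike.coe_mem _, rfl, rfl⟩)

theorem pull_mem_tensorGrade {I J : Type*} [Fintype I] [LinearOrder I] [Fintype J] [LinearOrder J]
    {φ : I → J} (hφ : Function.Bijective φ) {p : ℤ} {x : F.TensorPower I}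
    (hx : x ∈ F.tensorGrade I p) : F.pull φ x ∈ F.tensorGrade J p := by
  suffices F.tensorGrade I p ≤ (F.tensorGrade J p).comap (F.pull φ) from this hx
  refine Submodule.span_le.2 ?_
  rintro _ ⟨k, a, ha, hk, rfl⟩
  let e := Equiv.ofBijective φ hφ
  rw [SetLike.mem_coe, Submodule.mem_comap,
    pull_tprod F φ fun i => mem_parityPart_of_mem_grade (ha i)]
  refine Submodule.smul_mem _ _ (Submodule.subset_span ⟨fun j => k (e.symm j),
    fun j => a (e.symm j), fun j => ha _, ?_, ?_⟩)
  · rw [← hk]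
    exact Equiv.sum_comp e.symm k
  · change PiTensorProduct.tprod ℚ _ = _
    congr 1
    ext j
    have : (Finset.univ.filter fun i => φ i = j) = {e.symm j} := by
      ext i
      simp only [Finset.mem_filter, Finset.mem_univ, true_and, Finset.mem_singleton,
        Equiv.eq_symm_apply]
      rfl
    rw [this]
    simp

theorem coeff_term_self (π : Equiv.Perm (Fin n)) (a : F.TensorPower (cyc π)) :
    F.coeff π (F.term π a) = a := DirectSum.component.lof_self ℚ _ _

theorem coeff_term_of_ne {π ρ : Equiv.Perm (Fin n)} (h : π ≠ ρ) (a : F.TensorPower (cyc π)) :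
    F.coeff ρ (F.term π a) = 0 :=
  (DirectSum.component.of ℚ _ _ _).trans (dif_neg h)

theorem sum_term_coeff (x : F.SymAlg n) : ∑ π, F.term π (F.coeff π x) = x := by
  induction x using symAlg_induction with
  | hzero => simp only [map_zero, Finset.sum_const_zero]
  | hadd x y hx hy => simp only [map_add, Finset.sum_add_distrib, hx, hy]
  | hterm π a =>
    obtain ⟨a, rfl⟩ := (F.toSuper _).surjective a
    rw [superTerm_toSuper]
    rw [Finset.sum_eq_single_of_mem π (Finset.mem_univ π) fun ρ _ h => by
      rw [coeff_term_of_ne h.symm, map_zero], coeff_term_self]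

theorem mem_symGrade {p : ℤ} {x : F.SymAlg n} :
    x ∈ F.symGrade n p ↔ ∀ π, F.coeff π x ∈ F.tensorGrade (cyc π) p := by
  simp [symGrade, Submodule.mem_iInf]

theorem term_mem_symGrade {p : ℤ} {π : Equiv.Perm (Fin n)} {a : F.TensorPower (cyc π)}
    (ha : a ∈ F.tensorGrade (cyc π) p) : F.term π a ∈ F.symGrade n p :=
  mem_symGrade.2 fun ρ => by
    by_cases h : π = ρ
    · subst h
      rwa [coeff_term_self]
    · rw [coeff_term_of_ne h]
      exact zero_mem _

theorem iSup_symGrade : ⨆ p, F.symGrade n p = ⊤ := by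
  refine eq_top_iff.2 fun x _ => ?_
  rw [← sum_term_coeff x]
  refine sum_mem fun π _ => ?_
  have h : F.coeff π x ∈ ⨆ p, F.tensorGrade (cyc π) p := by
    rw [iSup_tensorGrade]
    trivial
  refine Submodule.iSup_induction (motive := fun a => F.term π a ∈ ⨆ p, F.symGrade n p) _ h
    (fun p a ha => Submodule.mem_iSup_of_mem p (term_mem_symGrade ha)) ?_ fun a b ha hb => ?_
  · rw [map_zero]
    exact zero_mem _
  · rw [map_add]
    exact add_mem ha hb

theorem act_mem_symGrade (σ : Equiv.Perm (Fin n)) {p : ℤ} {x : F.SymAlg n}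
    (hx : x ∈ F.symGrade n p) : F.act σ x ∈ F.symGrade n p := by
  rw [← sum_term_coeff x, map_sum]
  refine sum_mem fun π _ => ?_
  rw [act_term]
  exact term_mem_symGrade (pull_mem_tensorGrade (conj_bijective σ π) (mem_symGrade.1 hx π))

/-- The sum over `S_n` maps to the invariants, preserves degrees, and multiplies invariants by
`n!`; so an invariant element is a sum of homogeneous invariant elements. -/
theorem invariants_eq_iSup : F.invariants n = ⨆ p : ℤ, F.invariants n ⊓ F.symGrade n p := by
  refine le_antisymm (fun x hx => ?_) (iSup_le fun p => inf_le_left)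
  have hsum : ∑ σ, F.act σ x ∈ ⨆ p : ℤ, F.invariants n ⊓ F.symGrade n p := by
    have h : x ∈ ⨆ p, F.symGrade n p := by
      rw [iSup_symGrade]
      trivial
    refine Submodule.iSup_induction
      (motive := fun x => ∑ σ, F.act σ x ∈ ⨆ p : ℤ, F.invariants n ⊓ F.symGrade n p) _ h
      (fun p y hy => Submodule.mem_iSup_of_mem p ⟨sum_act_mem_invariants y,
        sum_mem fun σ _ => act_mem_symGrade σ hy⟩) ?_ fun y z hy hz => ?_
    · simp only [map_zero, Finset.sum_const_zero]
      exact zero_mem _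
    · simp only [map_add, Finset.sum_add_distrib]
      exact add_mem hy hz
  simp only [mem_invariants.1 hx, Finset.sum_const] at hsum
  rw [← Nat.cast_smul_eq_nsmul ℚ] at hsum
  exact (Submodule.smul_mem_iff _ (Nat.cast_ne_zero.2 Fintype.card_ne_zero)).1 hsum

theorem term_mul_term_comm (π ρ : Equiv.Perm (Fin n)) (p q : ℤ) {a : F.TensorPower (cyc π)}
    (ha : a ∈ F.tensorGrade (cyc π) p) {b : F.TensorPower (cyc ρ)}
    (hb : b ∈ F.tensorGrade (cyc ρ) q) :
    F.term π a * F.term ρ b =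
      (-1 : ℚ) ^ (p * q) • (F.act π (F.term ρ b) * F.term π a) := by
  rw [← sgn_intCast, Int.cast_mul, act_term]
  exact superTerm_mul_superTerm_comm (toSuper_mem_superPart ha) (toSuper_mem_superPart hb)

theorem mul_term_of_mem_invariants {π : Equiv.Perm (Fin n)} {p q : ℤ} {x : F.SymAlg n}
    (hx : x ∈ F.invariants n) (hxp : x ∈ F.symGrade n p) {a : F.TensorPower (cyc π)}
    (ha : a ∈ F.tensorGrade (cyc π) q) :
    x * F.term π a = (-1 : ℚ) ^ (p * q) • (F.term π a * x) := by
  have h : F.term π a * x = (-1 : ℚ) ^ (p * q) • (F.act π x * F.term π a) := by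
    rw [← sum_term_coeff x]
    change F.symMul n (F.term π a) _ = (-1 : ℚ) ^ (p * q) • F.symMul n _ (F.term π a)
    rw [map_sum, map_sum, map_sum, LinearMap.sum_apply, Finset.smul_sum]
    refine Finset.sum_congr rfl fun ρ _ => ?_
    rw [mul_comm p q]
    exact term_mul_term_comm π ρ q p ha (mem_symGrade.1 hxp ρ)
  rw [h, mem_invariants.1 hx, smul_smul, ← sgn_intCast, sgn_mul_self, one_smul]

theorem mul_comm_of_mem_invariants {p q : ℤ} {x y : F.SymAlg n} (hx : x ∈ F.invariants n)
    (hxp : x ∈ F.symGrade n p) (hy : y ∈ F.symGrade n q) :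
    x * y = (-1 : ℚ) ^ (p * q) • (y * x) := by
  rw [← sum_term_coeff y]
  change F.symMul n x _ = (-1 : ℚ) ^ (p * q) • F.symMul n _ x
  rw [map_sum, map_sum, LinearMap.sum_apply, Finset.smul_sum]
  exact Finset.sum_congr rfl fun π _ =>
    mul_term_of_mem_invariants hx hxp (mem_symGrade.1 hy π)

end GradedFrobeniusAlgebra

end

theorem mainTheorem3 {A : Type*} [Ring A] [Algebra ℚ A] {d : ℕ}
    (F : GradedFrobeniusAlgebra d A) (n : ℕ) :
    -- `A{S_n}` is an associative ring with unit (the product being bilinear by construction)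
    ((∀ x y z : F.SymAlg n, x * y * z = x * (y * z)) ∧
      ∀ x : F.SymAlg n, 1 * x = x ∧ x * 1 = x) ∧
    -- the commutation relation
    (∀ (π ρ : Equiv.Perm (Fin n)) (p q : ℤ),
      ∀ a ∈ F.tensorGrade (OrbitSpace.cyc π) p, ∀ b ∈ F.tensorGrade (OrbitSpace.cyc ρ) q,
        F.term π a * F.term ρ b =
          (-1 : ℚ) ^ (p * q) • (F.term (π * ρ * π⁻¹) (F.conjMap π ρ b) * F.term π a) ∧
        F.term π a * F.term ρ b =
          (-1 : ℚ) ^ (p * q) • (F.act π (F.term ρ b) * F.term π a)) ∧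
    -- the invariants form a graded subspace which is a subring
    (F.invariants n = ⨆ p : ℤ, F.invariants n ⊓ F.symGrade n p) ∧
    (1 ∈ F.invariants n ∧ ∀ x ∈ F.invariants n, ∀ y ∈ F.invariants n, x * y ∈ F.invariants n) ∧
    -- this subring lies in the graded centre; in particular it is graded commutative
    (∀ p q : ℤ, ∀ x ∈ F.invariants n, x ∈ F.symGrade n p → ∀ y ∈ F.symGrade n q,
      x * y = (-1 : ℚ) ^ (p * q) • (y * x)) := by
  open GradedFrobeniusAlgebra in
  exact ⟨⟨symAlg_mul_assoc, fun x => ⟨symAlg_one_mul x, symAlg_mul_one x⟩⟩,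
    fun π ρ p q a ha b hb => ⟨act_term (F := F) π ρ b ▸ term_mul_term_comm π ρ p q ha hb,
      term_mul_term_comm π ρ p q ha hb⟩,
    invariants_eq_iSup,
    ⟨mem_invariants.2 act_one, fun x hx y hy => mem_invariants.2 fun σ => by
      rw [act_mul, mem_invariants.1 hx, mem_invariants.1 hy]⟩,
    fun p q x hx hxp y hy => mul_comm_of_mem_invariants hx hxp hy⟩
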